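/- Work on $\mathcal H=L^2(\mathbb R,\mathbb C)$ with the position operator $({\bf q}\psi)(x)=x\psi(x)$ and the momentum operator ${\bf p}=-i\,\frac{d}{dx}$ (self-adjoint, on their natural domains, so that $[{\bf q},{\bf p}]=i$), and let ${\bf N}=\frac12({\bf q}^2+{\bf p}^2-{\bf 1})$. Let $M=2$, $\eta=2\sqrt\pi$, $\epsilon>0$, $\kappa\in\mathbb R$, and put $$\mathcal A=e^{-\epsilon\eta/2},\qquad \sigma=\frac{\mathcal A\epsilon\eta}{4}+\frac{\kappa\eta}{8\mathcal A\epsilon},$$ $${\bf L}_0=\mathcal A\,e^{i\eta{\bf q}}({\bf 1}-\epsilon{\bf p})-{\bf 1},\qquad {\bf L}_k=e^{i\theta_k{\bf N}}\,{\bf L}_0\,e^{-i\theta_k{\bf N}},\quad \theta_k=\frac{k\pi}{M},\quad 0\le k\le 2M-1.$$ For an unbounded operator ${\bf L}$ write $\mathcal D[{\bf L}](\rho)={\bf L}\rho{\bf L}^\dagger-\frac12({\bf L}^\dagger{\bf L}\rho+\rho{\bf L}^\dagger{\bf L})$; it is defined at $\rho$ if $\rho$ maps $\mathcal H$ into the domain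 of ${\bf L}^\dagger{\bf L}$ and the three products are (extend to) trace class operators. Let $I\subseteq\mathbb R$ be a set of times (for instance $I=[0,\infty)$) and let $(\rho_t)_{t\in I}$ be a classical solution of $$\frac{d}{dt}\rho_t=\sum_{k=0}^{2M-1}\mathcal D[{\bf L}_k](\rho_t)+\kappa\,\mathcal D[{\bf q}](\rho_t)+\kappa\,\mathcal D[{\bf p}](\rho_t),\qquad t\in I,$$ that is: each $\rho_t$ is a density operator (positive, trace class, of trace $1$), for each $t\in I$ all dissipators on the right-hand side are defined at $\rho_t$, and the equation holds with the derivative taken within $I$ in trace norm. Let $f,g:\mathbb R\to\mathbb R$ be $2\pi$-periodic functions of class $C^2$, let $h(\theta_1,\theta_2)=f(\theta_1)g(\theta_2)$, and for separable functions let $(u\otimes v)(\tfrac\eta2{\bf q},\tfrac\eta2{\bf p})=u(\tfrac\eta2{\bf q})\,v(\tfrac\eta2{\bf p})$ (extended to sums of such functions), so that ${\bf h}=h(\tfrac\eta2{\bf q},\tfrac\eta2{\bf p})=f(\tfrac\eta2{\bf q})\,g(\tfrac\eta2{\bf p})$. Then for every $t\in I$ the function $s\mapsto\mathrm{tr}({\bf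 h}\rho_s)$ is differentiable at $t$ within $I$ and $$\frac{d}{dt}\mathrm{tr}({\bf h}\rho_t)=-\mathcal A\epsilon\eta\;\mathrm{tr}\big((\mathcal L_\sigma h)(\tfrac\eta2{\bf q},\tfrac\eta2{\bf p})\,\rho_t\big),$$ where $\mathcal L_\sigma=\mathcal T_\sigma\otimes{\bf 1}+{\bf 1}\otimes\mathcal T_\sigma$ and $(\mathcal T_\sigma f)(\theta)=\sin(2\theta)f'(\theta)-\sigma f''(\theta)$. -/

import Mathlib

open MeasureTheory Filter Topology
open scoped ENNReal InnerProductSpace LinearPMap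

noncomputable section

namespace GKP

section Abstract

variable {E : Type*} [NormedAddCommGroup E] [InnerProductSpace ℂ E]

/-! ### Trace class operators on a Hilbert space -/

/-- `T = ∑ₙ |aₙ⟩⟨bₙ|`, the series converging strongly. -/
def IsRankOneExpansion (T : E →L[ℂ] E) (a b : ℕ → E) : Prop :=
  ∀ ψ : E, HasSum (fun n => ⟪b n, ψ⟫_ℂ • a n) (T ψ)

/-- The trace norm `‖T‖₁`, as the infimum of `∑ₙ ‖aₙ‖ ‖bₙ‖` over all expansions
`T = ∑ₙ |aₙ⟩⟨bₙ|`. It is `∞` if `T` is not trace class. -/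
def traceNorm (T : E →L[ℂ] E) : ℝ≥0∞ :=
  ⨅ (a : ℕ → E) (b : ℕ → E) (_ : IsRankOneExpansion T a b), ∑' n, ‖a n‖ₑ * ‖b n‖ₑ

/-- Trace class operators. -/
def IsTraceClass (T : E →L[ℂ] E) : Prop := traceNorm T ≠ ∞

/-- `T ↦ tr T = ∑ᵢ ⟨eᵢ, T eᵢ⟩` for a Hilbert basis `(eᵢ)`; for trace class `T` the value does not
depend on the basis. -/
def trace [CompleteSpace E] (T : E →L[ℂ] E) : ℂ :=
  ∑' i, ⟪(exists_hilbertBasis ℂ E).choose_spec.choose i,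
    T ((exists_hilbertBasis ℂ E).choose_spec.choose i)⟫_ℂ

/-- Density operators: positive (hence self-adjoint), trace class, of trace one. -/
structure IsDensityOperator [CompleteSpace E] (ρ : E →L[ℂ] E) : Prop where
  isPositive : ρ.IsPositive
  isTraceClass : IsTraceClass ρ
  trace_eq_one : trace ρ = 1

/-- `D` is the derivative at time `t`, within the set of times `I` and for the trace norm, of the
operator-valued function `ρ`. -/
def HasTraceNormDerivWithinAt (ρ : ℝ → E →L[ℂ] E) (D : E →L[ℂ] E) (I : Set ℝ) (t : ℝ) : Prop :=
  Tendsto (fun s => traceNorm (((s - t : ℝ) : ℂ)⁻¹ • (ρ s - ρ t) - D)) (𝓝[I \ {t}] t) (𝓝 0)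

/-! ### Unbounded operators and dissipators -/

/-- A bounded operator, seen as an operator with domain the whole space. -/
def ofCLM (T : E →L[ℂ] E) : E →ₗ.[ℂ] E := (T : E →ₗ[ℂ] E).toPMap ⊤

/-- The product `S T` of two unbounded operators, with its natural domain
`{ψ ∈ dom T | T ψ ∈ dom S}`. -/
def prod (S T : E →ₗ.[ℂ] E) : E →ₗ.[ℂ] E where
  domain := (S.domain.comap T.toFun).map T.domain.subtype
  toFun :=
    { toFun := fun ψ =>
        S ⟨T ⟨ψ.1, by obtain ⟨_, χ, _, rfl⟩ := ψ; exact χ.2⟩, by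
          obtain ⟨_, χ, hχ, rfl⟩ := ψ; exact hχ⟩
      map_add' := fun ψ χ => by
        rw [← LinearPMap.map_add]; congr 1; apply Subtype.ext
        simp only [Submodule.coe_add]; rw [← LinearPMap.map_add]; rfl
      map_smul' := fun c ψ => by
        rw [RingHom.id_apply, ← LinearPMap.map_smul]; congr 1; apply Subtype.ext
        simp only [Submodule.coe_smul]; rw [← LinearPMap.map_smul]; rfl }

infixr:80 " ⊚ " => prod

theorem mem_domain_prod {S T : E →ₗ.[ℂ] E} {ψ : E} :
    ψ ∈ (S ⊚ T).domain ↔ ∃ h : ψ ∈ T.domain, T ⟨ψ, h⟩ ∈ S.domain := by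
  constructor
  · rintro ⟨χ, hχ, rfl⟩
    exact ⟨χ.2, hχ⟩
  · rintro ⟨h, h'⟩
    exact ⟨⟨ψ, h⟩, h', rfl⟩

theorem prod_apply {S T : E →ₗ.[ℂ] E} {ψ : E} (h : ψ ∈ T.domain) (h' : T ⟨ψ, h⟩ ∈ S.domain) :
    (S ⊚ T) ⟨ψ, mem_domain_prod.2 ⟨h, h'⟩⟩ = S ⟨T ⟨ψ, h⟩, h'⟩ := rfl

/-- `D` is the value at `ρ` of the dissipator
`𝓓[L](ρ) = L ρ L† - ½ (L† L ρ + ρ L† L)` of the unbounded operator `L`. It is required that `ρ` maps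
into the domain of `L† L`, so that `L† L ρ` is defined everywhere and `L ρ L†` on the domain of
`L†`, and that the three products are trace class; those which are only densely defined are
identified with their bounded extension. -/
def IsDissipator [CompleteSpace E] (L : E →ₗ.[ℂ] E) (ρ D : E →L[ℂ] E) : Prop :=
  (∀ ψ, ρ ψ ∈ (L† ⊚ L).domain) ∧
  ∃ J K K' : E →L[ℂ] E, IsTraceClass J ∧ IsTraceClass K ∧ IsTraceClass K' ∧
    L ⊚ ofCLM ρ ⊚ L† ≤ ofCLM J ∧
    L† ⊚ L ⊚ ofCLM ρ ≤ ofCLM K ∧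
    ofCLM ρ ⊚ L† ⊚ L ≤ ofCLM K' ∧
    D = J - (1 / 2 : ℂ) • (K + K')

end Abstract

/-! ### The quantum harmonic oscillator on `L²(ℝ, ℂ)` -/

/-- The Hilbert space `L²(ℝ, ℂ)`. -/
abbrev H : Type := Lp ℂ 2 (volume : Measure ℝ)

/-- The operator of multiplication by `m`, with its maximal domain `{ψ ∈ L² | m ψ ∈ L²}`. -/
def mulOp (m : ℝ → ℂ) : H →ₗ.[ℂ] H where
  domain :=
    { carrier := {ψ | MemLp (fun x => m x * ψ x) 2 volume}
      add_mem' := fun {ψ χ} hψ hχ => by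
        refine (MemLp.add hψ hχ).ae_eq ?_
        filter_upwards [Lp.coeFn_add ψ χ] with x hx
        exact ((congrArg (m x * ·) hx).trans (mul_add _ _ _)).symm
      zero_mem' := by
        refine (MemLp.zero (ε := ℂ)).ae_eq ?_
        filter_upwards [Lp.coeFn_zero ℂ 2 (volume : Measure ℝ)] with x hx
        exact ((congrArg (m x * ·) hx).trans (mul_zero _)).symm
      smul_mem' := fun c ψ hψ => by
        refine (MemLp.const_smul hψ c).ae_eq ?_
        filter_upwards [Lp.coeFn_smul c ψ] with x hx
        simp [hx, mul_left_comm] }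
  toFun :=
    { toFun := fun ψ => MemLp.toLp _ ψ.2
      map_add' := fun ψ χ => by
        refine Lp.ext ?_
        filter_upwards [Lp.coeFn_add ψ.1 χ.1, MemLp.coeFn_toLp (ψ + χ).2, MemLp.coeFn_toLp ψ.2,
          MemLp.coeFn_toLp χ.2, Lp.coeFn_add (MemLp.toLp _ ψ.2) (MemLp.toLp _ χ.2)]
          with x h1 h2 h3 h4 h5
        rw [h2, h5, Pi.add_apply, h3, h4, Submodule.coe_add, h1, Pi.add_apply, mul_add]
      map_smul' := fun c ψ => by
        refine Lp.ext ?_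
        filter_upwards [Lp.coeFn_smul c ψ.1, MemLp.coeFn_toLp (c • ψ).2, MemLp.coeFn_toLp ψ.2,
          Lp.coeFn_smul c (MemLp.toLp _ ψ.2)] with x h1 h2 h3 h4
        rw [RingHom.id_apply, h2, h4, Pi.smul_apply, h3, Submodule.coe_smul, h1, Pi.smul_apply,
          smul_eq_mul, smul_eq_mul, mul_left_comm] }

open Classical in
/-- The bounded operator `m(q)` of multiplication by an essentially bounded function `m`
(by convention `0` if `m` is not essentially bounded). -/
def posFun (m : ℝ → ℂ) : H →L[ℂ] H :=
  if h : MemLp m ∞ (volume : Measure ℝ) then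
    (ContinuousLinearMap.mul ℂ ℂ).holderL (volume : Measure ℝ) ∞ 2 2 (h.toLp m)
  else 0

theorem posFun_apply {m : ℝ → ℂ} (h : MemLp m ∞ (volume : Measure ℝ)) (ψ : H) :
    posFun m ψ =ᵐ[volume] fun x => m x * ψ x := by
  rw [posFun, dif_pos h]
  filter_upwards [(ContinuousLinearMap.mul ℂ ℂ).coeFn_holder (r := 2) (h.toLp m) ψ, h.coeFn_toLp]
    with x h1 h2
  refine h1.trans ?_
  simp [h2]

/-- The Fourier transform on `L²(ℝ, ℂ)`, `ψ ↦ (ξ ↦ ∫ exp (-2πi x ξ) ψ(x) dx)`. -/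
def fourier : H ≃ₗᵢ[ℂ] H := Lp.fourierTransformₗᵢ ℝ ℂ

/-- The Fourier transform as a bounded operator. -/
def fourierCLM : H →L[ℂ] H := (fourier.toContinuousLinearEquiv : H →L[ℂ] H)

/-- The inverse Fourier transform as a bounded operator. -/
def fourierInvCLM : H →L[ℂ] H := (fourier.symm.toContinuousLinearEquiv : H →L[ℂ] H)

/-- The position operator `q`, `(q ψ)(x) = x ψ(x)`. -/
def q : H →ₗ.[ℂ] H := mulOp fun x => (x : ℂ)

/-- The momentum operator `p = -i d/dx`, with domain the Sobolev space `H¹(ℝ)`: since the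
Fourier transform is normalised with `exp (-2πi x ξ)`, it is multiplication by `2πξ` on the
Fourier side. -/
def p : H →ₗ.[ℂ] H :=
  ofCLM fourierInvCLM ⊚ mulOp (fun ξ => ((2 * Real.pi * ξ : ℝ) : ℂ)) ⊚ ofCLM fourierCLM

/-- The bounded operator `m(p)`, for an essentially bounded function `m`. -/
def momFun (m : ℝ → ℂ) : H →L[ℂ] H :=
  fourierInvCLM ∘L posFun (fun ξ => m (2 * Real.pi * ξ)) ∘L fourierCLM

/-! ### Fock states and the rotations `exp (iθN)` in phase space -/

/-- The Hermite function
`hₙ(x) = (√π n!)^(-1/2) Heₙ(√2 x) exp (-x²/2)`, the normalised eigenfunction of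
`N = ½ (q² + p² - 1)` for the eigenvalue `n`. -/
def hermiteFun (n : ℕ) (x : ℝ) : ℝ :=
  (√(√Real.pi * n.factorial))⁻¹ *
    (Polynomial.aeval (√2 * x) (Polynomial.hermite n) * Real.exp (-x ^ 2 / 2))


theorem integrable_poly (P : Polynomial ℝ) {b : ℝ} (hb : 0 < b) :
    Integrable fun x : ℝ => P.eval x * Real.exp (-b * x ^ 2) := by
  induction P using Polynomial.induction_on' with
  | add P Q hP hQ => simp only [Polynomial.eval_add, add_mul]; exact hP.add hQ
  | monomial n c =>
    have := (integrable_rpow_mul_exp_neg_mul_sq hb (s := n)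
      (by have : (0 : ℝ) ≤ n := n.cast_nonneg
          linarith)).const_mul c
    simpa [mul_assoc] using this

/-- The real Hermite polynomials. -/
def herm (n : ℕ) : Polynomial ℝ := (Polynomial.hermite n).map (Int.castRingHom ℝ)

theorem herm_zero : herm 0 = 1 := by simp [herm]

theorem herm_succ (n : ℕ) :
    herm (n + 1) = Polynomial.X * herm n - Polynomial.derivative (herm n) := by
  simp [herm, Polynomial.hermite_succ, Polynomial.derivative_map]

theorem aeval_hermite (n : ℕ) (y : ℝ) :
    Polynomial.aeval y (Polynomial.hermite n) = (herm n).eval y := by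
  simp [herm, Polynomial.aeval_def, Polynomial.eval_map]

theorem derivative_herm (n : ℕ) :
    Polynomial.derivative (herm (n + 1)) = ((n : Polynomial ℝ) + 1) * herm n := by
  induction n with
  | zero => simp [herm_succ, herm_zero]
  | succ n ih =>
    rw [herm_succ (n + 1), Polynomial.derivative_sub, Polynomial.derivative_mul, ih,
      Polynomial.derivative_mul]
    have h : herm (n + 1) = Polynomial.X * herm n - Polynomial.derivative (herm n) := herm_succ n
    simp only [Polynomial.derivative_X, Polynomial.derivative_add, Polynomial.derivative_natCast,
      Polynomial.derivative_one, Nat.cast_add, Nat.cast_one]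
    linear_combination (-(n : Polynomial ℝ) - 1) * h

/-- The Gaussian moment functional `P ↦ ∫ P(y) exp (-y²/2) dy`. -/
def gaussInt (P : Polynomial ℝ) : ℝ := ∫ y : ℝ, P.eval y * Real.exp (-(1 / 2) * y ^ 2)

theorem gaussInt_sub (P Q : Polynomial ℝ) : gaussInt (P - Q) = gaussInt P - gaussInt Q := by
  simp only [gaussInt, Polynomial.eval_sub, sub_mul]
  exact integral_sub (integrable_poly P (by norm_num)) (integrable_poly Q (by norm_num))

theorem gaussInt_derivative (P : Polynomial ℝ) :
    gaussInt (Polynomial.derivative P) = gaussInt (Polynomial.X * P) := by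
  rw [← sub_eq_zero, ← gaussInt_sub]
  refine integral_eq_zero_of_hasDerivAt_of_integrable
    (f := fun y => P.eval y * Real.exp (-(1 / 2) * y ^ 2)) (fun y => ?_)
    (integrable_poly _ (by norm_num)) (integrable_poly _ (by norm_num))
  have h1 := P.hasDerivAt y
  have h2 : HasDerivAt (fun y : ℝ => Real.exp (-(1 / 2) * y ^ 2))
      (Real.exp (-(1 / 2) * y ^ 2) * (-(1 / 2) * (2 * y))) y := by
    simpa using ((hasDerivAt_pow 2 y).const_mul (-(1 / 2) : ℝ)).exp
  refine (h1.mul h2).congr_deriv ?_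
  simp only [Polynomial.eval_sub, Polynomial.eval_mul, Polynomial.eval_X]
  ring

theorem gaussInt_natCast_mul (n : ℕ) (P : Polynomial ℝ) :
    gaussInt (((n : Polynomial ℝ) + 1) * P) = (n + 1) * gaussInt P := by
  simp only [gaussInt, Polynomial.eval_mul, Polynomial.eval_add, Polynomial.eval_natCast,
    Polynomial.eval_one, mul_assoc]
  exact integral_const_mul _ _

theorem gaussInt_herm_succ (m : ℕ) (Q : Polynomial ℝ) :
    gaussInt (herm (m + 1) * Q) = gaussInt (herm m * Polynomial.derivative Q) := by
  have h := gaussInt_derivative (herm m * Q)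
  rw [herm_succ, show (Polynomial.X * herm m - Polynomial.derivative (herm m)) * Q
    = Polynomial.X * (herm m * Q) - Polynomial.derivative (herm m) * Q by ring, gaussInt_sub, ← h,
    ← gaussInt_sub, Polynomial.derivative_mul]
  congr 1; ring

theorem gaussInt_herm (m n : ℕ) :
    gaussInt (herm m * herm n) = if m = n then √(2 * Real.pi) * n.factorial else 0 := by
  induction m generalizing n with
  | zero =>
    cases n with
    | zero =>
      have := integral_gaussian (1 / 2)
      simp only [gaussInt, herm_zero, Polynomial.eval_one, one_mul]
      rw [this]
      simp [mul_comm]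
    | succ n =>
      rw [mul_comm, gaussInt_herm_succ, herm_zero]
      simp [gaussInt]
  | succ m ih =>
    cases n with
    | zero =>
      rw [gaussInt_herm_succ, herm_zero]
      simp [gaussInt]
    | succ n =>
      rw [gaussInt_herm_succ, derivative_herm, mul_left_comm, gaussInt_natCast_mul, ih]
      by_cases h : m = n
      · simp [h, Nat.factorial_succ]; ring
      · simp [h]

theorem integral_hermiteFun (m n : ℕ) :
    ∫ x, hermiteFun m x * hermiteFun n x = if m = n then 1 else 0 := by
  have h := Measure.integral_comp_mul_left
    (fun y => (herm m * herm n).eval y * Real.exp (-(1 / 2) * y ^ 2)) (√2)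
  have h' : ∀ x : ℝ, hermiteFun m x * hermiteFun n x =
      ((√(√Real.pi * m.factorial))⁻¹ * (√(√Real.pi * n.factorial))⁻¹) *
      ((herm m * herm n).eval (√2 * x) * Real.exp (-(1 / 2) * (√2 * x) ^ 2)) := by
    intro x
    have e : Real.exp (-(1 / 2) * (√2 * x) ^ 2)
        = Real.exp (-x ^ 2 / 2) * Real.exp (-x ^ 2 / 2) := by
      rw [← Real.exp_add, mul_pow, Real.sq_sqrt (by norm_num)]; ring_nf
    simp only [hermiteFun, aeval_hermite, e, Polynomial.eval_mul]
    ring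
  simp_rw [h']
  rw [integral_const_mul, h]
  have := gaussInt_herm m n
  rw [gaussInt] at this
  rw [this]
  by_cases hmn : m = n
  · subst hmn
    have hp : 0 < √Real.pi * m.factorial := by positivity
    have h2 : 0 < √(2 : ℝ) := by positivity
    rw [if_pos rfl, if_pos rfl, ← mul_inv, Real.mul_self_sqrt hp.le, abs_of_pos (by positivity),
      Real.sqrt_mul (by norm_num), smul_eq_mul]
    field_simp
  · simp [hmn]

theorem continuous_hermiteFun (n : ℕ) : Continuous (hermiteFun n) := by
  unfold hermiteFun
  simp only [aeval_hermite]
  fun_prop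

theorem memLp_hermiteFun (n : ℕ) : MemLp (fun x => (hermiteFun n x : ℂ)) 2 volume := by
  have hm : AEStronglyMeasurable (fun x => (hermiteFun n x : ℂ)) volume :=
    (Complex.continuous_ofReal.comp (continuous_hermiteFun n)).aestronglyMeasurable
  rw [memLp_two_iff_integrable_sq_norm hm]
  have h : ∀ x, ‖(hermiteFun n x : ℂ)‖ ^ 2 = hermiteFun n x * hermiteFun n x := fun x => by
    rw [Complex.norm_real, Real.norm_eq_abs, sq_abs, sq]
  simp_rw [h]
  by_contra hn
  have := integral_hermiteFun n n
  rw [integral_undef hn] at this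
  simp at this

/-- The Fock state `|n⟩`. -/
def fock (n : ℕ) : H := (memLp_hermiteFun n).toLp _

theorem inner_fock (m n : ℕ) : ⟪fock m, fock n⟫_ℂ = if m = n then 1 else 0 := by
  rw [L2.inner_def]
  have h : ∀ᵐ x : ℝ, ⟪fock m x, fock n x⟫_ℂ = ((hermiteFun m x * hermiteFun n x : ℝ) : ℂ) := by
    filter_upwards [(memLp_hermiteFun m).coeFn_toLp, (memLp_hermiteFun n).coeFn_toLp] with x h1 h2
    rw [fock, fock, h1, h2]
    simp [mul_comm]
  rw [integral_congr_ae h, integral_complex_ofReal, integral_hermiteFun]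
  split_ifs <;> simp

theorem orthonormal_rotated_fock (θ : ℝ) :
    Orthonormal ℂ fun n : ℕ => Complex.exp (Complex.I * θ * n) • fock n := by
  rw [orthonormal_iff_ite]
  intro m n
  rw [inner_smul_left, inner_smul_right, inner_fock]
  split_ifs with h
  · subst h
    rw [mul_one, ← Complex.exp_conj, ← Complex.exp_add]
    simp
  · simp

/-- The isometry `ℓ²(ℕ) → L²(ℝ)`, `(cₙ) ↦ ∑ₙ cₙ exp (iθn) |n⟩`. -/
def fockSum (θ : ℝ) : lp (fun _ : ℕ => ℂ) 2 →ₗᵢ[ℂ] H :=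
  (orthonormal_rotated_fock θ).orthogonalFamily.linearIsometry

/-- The phase-space rotation `exp (iθN) = ∑ₙ exp (iθn) |n⟩⟨n|`, for the photon-number operator
`N = ½ (q² + p² - 1)`, which is diagonal in the Fock basis with `N |n⟩ = n |n⟩`. -/
def rotation (θ : ℝ) : H →L[ℂ] H :=
  (fockSum θ).toContinuousLinearMap ∘L (fockSum 0).toContinuousLinearMap.adjoint

theorem hasSum_rotation (θ : ℝ) (ψ : H) :
    HasSum (fun n : ℕ => (Complex.exp (Complex.I * θ * n) * ⟪fock n, ψ⟫_ℂ) • fock n)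
      (rotation θ ψ) := by
  have key := (orthonormal_rotated_fock θ).orthogonalFamily.hasSum_linearIsometry
    ((fockSum 0).toContinuousLinearMap.adjoint ψ)
  have hc : ∀ n : ℕ, ((fockSum 0).toContinuousLinearMap.adjoint ψ : ∀ _ : ℕ, ℂ) n
      = ⟪fock n, ψ⟫_ℂ := by
    intro n
    have h1 := lp.inner_single_left (𝕜 := ℂ) (G := fun _ : ℕ => ℂ) n (1 : ℂ)
      ((fockSum 0).toContinuousLinearMap.adjoint ψ)
    rw [ContinuousLinearMap.adjoint_inner_right] at h1
    have h2 : (fockSum 0).toContinuousLinearMap (lp.single 2 n (1 : ℂ)) = fock n := by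
      simp [fockSum, OrthogonalFamily.linearIsometry_apply_single]
    rw [h2] at h1
    rw [h1]; simp
  have hr : rotation θ ψ = (orthonormal_rotated_fock θ).orthogonalFamily.linearIsometry
      ((fockSum 0).toContinuousLinearMap.adjoint ψ) := rfl
  rw [hr]
  convert key using 2 with n
  rw [hc n]
  simp [smul_smul, mul_comm]

/-! ### The Lindblad dynamics -/

/-- The constant `𝓐 = exp (-εη/2)`. -/
def ampl (η ε : ℝ) : ℝ := Real.exp (-(ε * η / 2))

/-- `L₀ = 𝓐 exp (iηq) (1 - ε p) - 1`. -/
def L₀ (η ε : ℝ) : H →ₗ.[ℂ] H :=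
  (ampl η ε : ℂ) • (ofCLM (posFun fun x => Complex.exp (Complex.I * η * x)) ⊚
    (ofCLM 1 - (ε : ℂ) • p)) - ofCLM 1

/-- `Lₖ = exp (iθₖN) L₀ exp (-iθₖN)` with `θₖ = kπ/M`. -/
def lindbladOp (M : ℕ) (η ε : ℝ) (k : ℕ) : H →ₗ.[ℂ] H :=
  ofCLM (rotation (k * Real.pi / M)) ⊚ L₀ η ε ⊚ ofCLM (rotation (-(k * Real.pi / M)))

/-- `ρ` is a solution, on the set of times `I` (for instance `I = [0, ∞)`), of the Lindblad equation
`dρ/dt = ∑_{k < 2M} 𝓓[Lₖ](ρ) + κ 𝓓[q](ρ) + κ 𝓓[p](ρ)`: each `ρ t` is a density operator, each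
dissipator is defined at `ρ t`, and the equation holds for the trace norm. -/
structure IsLindbladSolution (M : ℕ) (η ε κ : ℝ) (I : Set ℝ) (ρ : ℝ → H →L[ℂ] H) : Prop where
  isDensityOperator : ∀ t ∈ I, IsDensityOperator (ρ t)
  equation : ∀ t ∈ I, ∃ (D : ℕ → H →L[ℂ] H) (Dq Dp : H →L[ℂ] H),
    (∀ k ∈ Finset.range (2 * M), IsDissipator (lindbladOp M η ε k) (ρ t) (D k)) ∧
    IsDissipator q (ρ t) Dq ∧ IsDissipator p (ρ t) Dp ∧
    HasTraceNormDerivWithinAt ρ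
      (∑ k ∈ Finset.range (2 * M), D k + (κ : ℂ) • Dq + (κ : ℂ) • Dp) I t

/-! ### Periodic observables -/

/-- The operator `h(ηq/2, ηp/2) = u(ηq/2) v(ηp/2)` associated with the separable function
`h(θ₁, θ₂) = u(θ₁) v(θ₂)`. -/
def observable (η : ℝ) (u v : ℝ → ℝ) : H →L[ℂ] H :=
  posFun (fun x => (u (η / 2 * x) : ℂ)) ∘L momFun (fun y => (v (η / 2 * y) : ℂ))

/-- `(𝓣_σ f)(θ) = sin(2θ) f'(θ) - σ f''(θ)`. -/
def Tσ (σ : ℝ) (f : ℝ → ℝ) (θ : ℝ) : ℝ :=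
  Real.sin (2 * θ) * deriv f θ - σ * deriv (deriv f) θ

/-- The operator `(𝓛_σ h)(ηq/2, ηp/2)` for `h(θ₁, θ₂) = f(θ₁) g(θ₂)` and
`𝓛_σ = 𝓣_σ ⊗ 1 + 1 ⊗ 𝓣_σ`, that is, for
`(𝓛_σ h)(θ₁, θ₂) = (𝓣_σ f)(θ₁) g(θ₂) + f(θ₁) (𝓣_σ g)(θ₂)`. -/
def generatorObservable (η σ : ℝ) (f g : ℝ → ℝ) : H →L[ℂ] H :=
  observable η (Tσ σ f) g + observable η f (Tσ σ g)

/-- `σ(ε, η, κ) = 𝓐 ε η / 4 + κ η / (8 𝓐 ε)`. -/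
def sigma (η ε κ : ℝ) : ℝ :=
  ampl η ε * ε * η / 4 + κ * η / (8 * ampl η ε * ε)

end GKP

end

/-! In the Heisenberg picture the claim is an algebraic identity. Formally the dual of the
dissipator of `L` sends `A` to `½ (L†[A, L] + [L†, A] L)`. Since `η = 2√π`, `(η/2)·η = 2π`, so
`f(ηq/2)` and `g(ηp/2)` have period `η` in `q` and `p`. As `exp(iηq)` shifts `p` by `η`, it commutes
with `A = f(ηq/2) g(ηp/2)`, and likewise for `exp(iηp)`. Only the factor `1 - εp` of `L₀` therefore
fails to commute with `A`. With `a = 𝓐`, `U = exp(iηq)`, `A₁ = i[p, A]` and `A₂ = i[p, A₁]` one gets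
`[L₀, A] = i a ε U A₁`; the unbounded terms cancel, and what remains is `½ (aε)² A₂ - aε sin(ηq)
A₁`. A quarter turn maps `(q, p)` to `(p, -q)`: the operators with `k = 0, 2` thus act on `f` and
those with `k = 1, 3` on `g`, while `𝓓[p]` and `𝓓[q]` add half of a second derivative each.
Collecting coefficients produces `σ`.

The analytic difficulty is that `L` is unbounded, so cyclicity of the trace is not available.
`trace_comp_dissipator` replaces it by the spectral decomposition `ρ = ∑ lᵢ |eᵢ⟩⟨eᵢ|`: eigenvectors
with `lᵢ ≠ 0` lie in the domain of `L†L`, the bounded extension of `LρL†` is the absolutely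
convergent sum `∑ lᵢ |Leᵢ⟩⟨Leᵢ|`, and only an identity of quadratic forms on the domain of `L` is
left to check. Commutators with a generator are encoded as norm derivatives of `W s A W (-s)`; by
`IsGenerator.apply_conjDeriv` this already implies that `A` preserves the domain.

The quarter turn is identified with an inverse Fourier transform following a dilation
(`fourierCLM_mul_rotation`). This is checked on Hermite functions, which suffices by their
completeness (`eq_zero_of_forall_inner_fock`). Finally `|tr(AT)| ≤ ‖A‖ ‖T‖₁` carries the trace norm
derivative of `ρ` over to the expectation value. -/

noncomputable section

namespace GKP

/-! ### Nuclear expansions, traces and the spectral theorem -/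

section TraceClass

universe u

variable {E : Type u} [NormedAddCommGroup E] [InnerProductSpace ℂ E]

/-- Cauchy–Schwarz on finite sets of indices, then Bessel's inequality for `a` and for `b`. This is
the absolute convergence behind the exchange of sums in `IsNuclearExpansion.hasSum_trace`. -/
theorem summable_inner_mul_inner_norm {κ : Type*} (e : HilbertBasis κ ℂ E) (a b : E) :
    Summable (fun i => ‖⟪e i, a⟫_ℂ * ⟪b, e i⟫_ℂ‖) ∧
      ∑' i, ‖⟪e i, a⟫_ℂ * ⟪b, e i⟫_ℂ‖ ≤ ‖a‖ * ‖b‖ := by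
  have key : ∀ s : Finset κ, ∑ i ∈ s, ‖⟪e i, a⟫_ℂ * ⟪b, e i⟫_ℂ‖ ≤ ‖a‖ * ‖b‖ := by
    intro s
    have h1 := e.orthonormal.sum_inner_products_le (x := a) (s := s)
    have h2 := e.orthonormal.sum_inner_products_le (x := b) (s := s)
    calc ∑ i ∈ s, ‖⟪e i, a⟫_ℂ * ⟪b, e i⟫_ℂ‖
        = ∑ i ∈ s, ‖⟪e i, a⟫_ℂ‖ * ‖⟪e i, b⟫_ℂ‖ := by
          simp_rw [norm_mul, norm_inner_symm b]
      _ ≤ √(∑ i ∈ s, ‖⟪e i, a⟫_ℂ‖ ^ 2) * √(∑ i ∈ s, ‖⟪e i, b⟫_ℂ‖ ^ 2) :=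
          Real.sum_mul_le_sqrt_mul_sqrt _ _ _
      _ ≤ √(‖a‖ ^ 2) * √(‖b‖ ^ 2) := by gcongr
      _ = ‖a‖ * ‖b‖ := by rw [Real.sqrt_sq (norm_nonneg _), Real.sqrt_sq (norm_nonneg _)]
  have hs := summable_of_sum_le (fun _ => norm_nonneg _) key
  exact ⟨hs, hs.tsum_le_of_sum_le key⟩

/-- `T = ∑ᵢ |aᵢ⟩⟨bᵢ|` weakly, with `∑ᵢ ‖aᵢ‖ ‖bᵢ‖ < ∞`. -/
structure IsNuclearExpansion {ι : Type*} (T : E →L[ℂ] E) (a b : ι → E) : Prop where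
  summable : Summable fun i => ‖a i‖ * ‖b i‖
  hasSum : ∀ χ ψ, HasSum (fun i => ⟪χ, a i⟫_ℂ * ⟪b i, ψ⟫_ℂ) ⟪χ, T ψ⟫_ℂ

theorem IsNuclearExpansion.summable_inner {ι : Type*} {T : E →L[ℂ] E} {a b : ι → E}
    (h : IsNuclearExpansion T a b) : Summable fun i => ‖⟪b i, a i⟫_ℂ‖ :=
  h.summable.of_nonneg_of_le (fun _ => norm_nonneg _)
    fun _ => (norm_inner_le_norm _ _).trans_eq (mul_comm _ _)

/-- Fubini for the double sum over rank one terms and basis vectors, with Parseval for the sum over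
the basis. The value does not involve `e`: traces may later be computed in an eigenbasis of `ρ`. -/
theorem IsNuclearExpansion.hasSum_trace {ι κ : Type*} {T : E →L[ℂ] E} {a b : ι → E}
    (h : IsNuclearExpansion T a b) (e : HilbertBasis κ ℂ E) :
    HasSum (fun i => ⟪e i, T (e i)⟫_ℂ) (∑' n, ⟪b n, a n⟫_ℂ) := by
  let F : ι × κ → ℂ := fun x => ⟪e x.2, a x.1⟫_ℂ * ⟪b x.1, e x.2⟫_ℂ
  have hF : Summable F := by
    refine Summable.of_norm ((summable_prod_of_nonneg fun _ => norm_nonneg _).2 ⟨fun n => ?_, ?_⟩)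
    · exact (summable_inner_mul_inner_norm e (a n) (b n)).1
    · exact h.summable.of_nonneg_of_le (fun n => tsum_nonneg fun _ => norm_nonneg _)
        fun n => (summable_inner_mul_inner_norm e (a n) (b n)).2
  have h1 : HasSum (fun n => ⟪b n, a n⟫_ℂ) (∑' x, F x) := by
    refine hF.hasSum.prod_fiberwise fun n => ?_
    simpa [F, mul_comm] using e.hasSum_inner_mul_inner (b n) (a n)
  rw [h1.tsum_eq]
  have hF' := (Equiv.prodComm κ ι).hasSum_iff.2 hF.hasSum
  exact hF'.prod_fiberwise fun i => h.hasSum (e i) (e i)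

theorem IsNuclearExpansion.comp_left [CompleteSpace E] {ι : Type*} {T : E →L[ℂ] E} {a b : ι → E}
    (h : IsNuclearExpansion T a b) (A : E →L[ℂ] E) :
    IsNuclearExpansion (A ∘L T) (fun i => A (a i)) b where
  summable := by
    refine (h.summable.mul_left ‖A‖).of_nonneg_of_le (fun _ => by positivity) fun i => ?_
    rw [← mul_assoc]
    gcongr
    exact A.le_opNorm _
  hasSum χ ψ := by
    simpa [ContinuousLinearMap.adjoint_inner_left] using h.hasSum (A.adjoint χ) ψ

theorem IsNuclearExpansion.comp_right [CompleteSpace E] {ι : Type*} {T : E →L[ℂ] E} {a b : ι → E}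
    (h : IsNuclearExpansion T a b) (A : E →L[ℂ] E) :
    IsNuclearExpansion (T ∘L A) a (fun i => A.adjoint (b i)) where
  summable := by
    refine (h.summable.mul_left ‖A.adjoint‖).of_nonneg_of_le (fun _ => by positivity) fun i => ?_
    rw [mul_left_comm]
    gcongr
    exact A.adjoint.le_opNorm _
  hasSum χ ψ := by
    simpa [ContinuousLinearMap.adjoint_inner_left] using h.hasSum χ (A ψ)

theorem exists_expansion_of_traceNorm_lt {T : E →L[ℂ] E} {c : ℝ≥0∞} (h : traceNorm T < c) :
    ∃ a b : ℕ → E, IsRankOneExpansion T a b ∧ ∑' n, ‖a n‖ₑ * ‖b n‖ₑ < c := by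
  simpa [traceNorm, iInf_lt_iff] using h

theorem IsRankOneExpansion.isNuclearExpansion {T : E →L[ℂ] E} {a b : ℕ → E}
    (h : IsRankOneExpansion T a b) (hs : ∑' n, ‖a n‖ₑ * ‖b n‖ₑ ≠ ∞) :
    IsNuclearExpansion T a b where
  summable := by
    have := ENNReal.summable_toReal hs
    simpa using this
  hasSum χ ψ := by
    have := (h ψ).mapL (innerSL ℂ χ)
    simpa [inner_smul_right, mul_comm] using this

theorem IsTraceClass.exists_expansion {T : E →L[ℂ] E} (h : IsTraceClass T) :
    ∃ a b : ℕ → E, IsNuclearExpansion T a b := by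
  obtain ⟨a, b, hab, hs⟩ := exists_expansion_of_traceNorm_lt (lt_top_iff_ne_top.2 h)
  exact ⟨a, b, hab.isNuclearExpansion hs.ne⟩

theorem IsNuclearExpansion.norm_tsum_le {ι : Type*} {T : E →L[ℂ] E} {a b : ι → E}
    (h : IsNuclearExpansion T a b) :
    ‖∑' n, ⟪b n, a n⟫_ℂ‖ ≤ ∑' n, ‖a n‖ * ‖b n‖ :=
  (norm_tsum_le_tsum_norm h.summable_inner).trans
    (h.summable_inner.tsum_le_tsum (fun _ => (norm_inner_le_norm _ _).trans_eq (mul_comm _ _))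
      h.summable)

/-- `T` has an absolutely convergent expansion into rank one operators. -/
def IsNuclear (T : E →L[ℂ] E) : Prop := ∃ a b : ℕ → E, IsNuclearExpansion T a b

theorem IsTraceClass.isNuclear {T : E →L[ℂ] E} (h : IsTraceClass T) : IsNuclear T :=
  h.exists_expansion

variable [CompleteSpace E]

theorem IsNuclearExpansion.trace_eq {ι : Type*} {T : E →L[ℂ] E} {a b : ι → E}
    (h : IsNuclearExpansion T a b) : trace T = ∑' n, ⟪b n, a n⟫_ℂ :=
  (h.hasSum_trace _).tsum_eq

theorem IsNuclear.comp_left {T : E →L[ℂ] E} (h : IsNuclear T) (A : E →L[ℂ] E) :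
    IsNuclear (A ∘L T) := by
  obtain ⟨a, b, h⟩ := h
  exact ⟨_, _, h.comp_left A⟩

theorem IsNuclear.hasSum_trace {κ : Type*} {T : E →L[ℂ] E} (h : IsNuclear T)
    (e : HilbertBasis κ ℂ E) : HasSum (fun i => ⟪e i, T (e i)⟫_ℂ) (trace T) := by
  obtain ⟨a, b, h⟩ := h
  rw [h.trace_eq]
  exact h.hasSum_trace e

/-- The sum of the diagonal entries of `T` which defines `trace T` converges to `z`. -/
def HasTrace (T : E →L[ℂ] E) (z : ℂ) : Prop :=
  HasSum (fun i => ⟪(exists_hilbertBasis ℂ E).choose_spec.choose i,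
    T ((exists_hilbertBasis ℂ E).choose_spec.choose i)⟫_ℂ) z

theorem HasTrace.trace_eq {T : E →L[ℂ] E} {z : ℂ} (h : HasTrace T z) : trace T = z := h.tsum_eq

theorem IsNuclear.hasTrace {T : E →L[ℂ] E} (h : IsNuclear T) : HasTrace T (trace T) :=
  h.hasSum_trace _

theorem HasTrace.add {S T : E →L[ℂ] E} {y z : ℂ} (hS : HasTrace S y) (hT : HasTrace T z) :
    HasTrace (S + T) (y + z) := by
  simpa [HasTrace, inner_add_right] using HasSum.add hS hT

theorem HasTrace.sub {S T : E →L[ℂ] E} {y z : ℂ} (hS : HasTrace S y) (hT : HasTrace T z) :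
    HasTrace (S - T) (y - z) := by
  simpa [HasTrace, inner_sub_right] using HasSum.sub hS hT

theorem HasTrace.smul {T : E →L[ℂ] E} {z : ℂ} (c : ℂ) (hT : HasTrace T z) :
    HasTrace (c • T) (c * z) := by
  simpa [HasTrace, inner_smul_right] using HasSum.mul_left c hT

/-- An expansion of `T` of cost less than `‖T‖₁ + r` becomes, after applying `A` to the left
vectors, one of `A T` of cost at most `‖A‖ (‖T‖₁ + r)`; then `r → 0`. -/
theorem norm_trace_comp_le {T : E →L[ℂ] E} (hT : IsTraceClass T) (A : E →L[ℂ] E) :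
    ‖trace (A ∘L T)‖ ≤ ‖A‖ * (traceNorm T).toReal := by
  have key : ∀ r : ℝ, 0 < r → ‖trace (A ∘L T)‖ ≤ ‖A‖ * ((traceNorm T).toReal + r) := by
    intro r hr
    have hlt : traceNorm T < ENNReal.ofReal ((traceNorm T).toReal + r) := by
      rw [ENNReal.lt_ofReal_iff_toReal_lt hT]; linarith
    obtain ⟨a, b, hab, hs⟩ := exists_expansion_of_traceNorm_lt hlt
    have hn := hab.isNuclearExpansion (hs.trans ENNReal.ofReal_lt_top).ne
    have hA := hn.comp_left A
    rw [hA.trace_eq]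
    refine hA.norm_tsum_le.trans ?_
    calc ∑' n, ‖A (a n)‖ * ‖b n‖ ≤ ∑' n, ‖A‖ * (‖a n‖ * ‖b n‖) := by
          refine hA.summable.tsum_le_tsum (fun n => ?_) (hn.summable.mul_left _)
          rw [← mul_assoc]
          gcongr
          exact A.le_opNorm _
      _ = ‖A‖ * ∑' n, ‖a n‖ * ‖b n‖ := tsum_mul_left
      _ ≤ _ := by
          gcongr
          have h1 : ∑' n, ‖a n‖ * ‖b n‖ = (∑' n, ‖a n‖ₑ * ‖b n‖ₑ).toReal := by
            rw [ENNReal.tsum_toReal_eq]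
            · simp
            · intro n; exact ENNReal.mul_ne_top enorm_ne_top enorm_ne_top
          rw [h1]
          exact ENNReal.toReal_le_of_le_ofReal (by positivity) hs.le
  refine le_of_forall_pos_le_add fun δ hδ => ?_
  -- The added `1` covers the case `A = 0`.
  refine (key (δ / (‖A‖ + 1)) (by positivity)).trans ?_
  rw [mul_add]
  gcongr
  rw [mul_div_assoc', div_le_iff₀ (by positivity)]
  nlinarith [norm_nonneg A]

theorem IsNuclearExpansion.trace_comp_comm {ι : Type*} {T : E →L[ℂ] E} {a b : ι → E}
    (h : IsNuclearExpansion T a b) (A : E →L[ℂ] E) : trace (A ∘L T) = trace (T ∘L A) := by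
  rw [(h.comp_left A).trace_eq, (h.comp_right A).trace_eq]
  simp [ContinuousLinearMap.adjoint_inner_left]

theorem IsNuclear.comp_right {T : E →L[ℂ] E} (h : IsNuclear T) (A : E →L[ℂ] E) :
    IsNuclear (T ∘L A) := by
  obtain ⟨a, b, h⟩ := h
  exact ⟨_, _, h.comp_right A⟩

theorem IsNuclear.trace_comp_comm {T : E →L[ℂ] E} (h : IsNuclear T) (A : E →L[ℂ] E) :
    trace (A ∘L T) = trace (T ∘L A) := by
  obtain ⟨a, b, h⟩ := h
  exact h.trace_comp_comm A

theorem exists_isNuclearExpansion {ι : Type*} {a b : ι → E}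
    (h : Summable fun i => ‖a i‖ * ‖b i‖) : ∃ T : E →L[ℂ] E, IsNuclearExpansion T a b := by
  have hs : Summable fun i => (innerSL ℂ (b i)).smulRight (a i) := by
    refine Summable.of_norm (h.of_nonneg_of_le (fun _ => norm_nonneg _) fun i => ?_)
    rw [ContinuousLinearMap.norm_smulRight_apply, innerSL_apply_norm, mul_comm]
  refine ⟨∑' i, (innerSL ℂ (b i)).smulRight (a i), h, fun χ ψ => ?_⟩
  have h1 := (hs.hasSum.mapL (ContinuousLinearMap.apply ℂ E ψ)).mapL (innerSL ℂ χ)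
  simpa [inner_smul_right, mul_comm] using h1

/-- The truncated expansions have finite rank and converge in operator norm, the error being at most
the tail of `∑ ‖aₙ‖ ‖bₙ‖`. -/
theorem IsTraceClass.isCompactOperator {T : E →L[ℂ] E} (h : IsTraceClass T) :
    IsCompactOperator T := by
  obtain ⟨a, b, h⟩ := h.exists_expansion
  let S : ℕ → E →L[ℂ] E := fun N =>
    ∑ n ∈ Finset.range N, (innerSL ℂ (b n)).smulRight (a n)
  have hrank : ∀ N, IsCompactOperator (S N) := by
    intro N
    have h1 : ∀ n, IsCompactOperator ((innerSL ℂ (b n)).smulRight (a n)) := fun n => by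
      have : ((innerSL ℂ (b n)).smulRight (a n) : E → E)
          = (ContinuousLinearMap.toSpanSingleton ℂ (a n)) ∘ (innerSL ℂ (b n)) := by
        ext; simp
      rw [this]
      have hid : IsCompactOperator (id : ℂ → ℂ) := by
        simpa using (isCompactOperator_id_iff_finiteDimensional (𝕜 := ℂ) (E := ℂ)).2 inferInstance
      exact (hid.clm_comp (ContinuousLinearMap.toSpanSingleton ℂ (a n))).comp_clm (innerSL ℂ (b n))
    have h2 : ∀ N, S N ∈ compactOperator (RingHom.id ℂ) E E := fun N =>
      Submodule.sum_mem _ fun n _ => h1 n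
    exact h2 N
  have hlim : Tendsto S atTop (𝓝 T) := by
    rw [tendsto_iff_norm_sub_tendsto_zero]
    have ht := h.summable.tendsto_sum_tsum_nat.const_sub (∑' n, ‖a n‖ * ‖b n‖)
    rw [sub_self] at ht
    refine squeeze_zero (fun _ => norm_nonneg _) (fun N => ?_) ht
    have htail : ∑' n, ‖a n‖ * ‖b n‖ - ∑ n ∈ Finset.range N, ‖a n‖ * ‖b n‖
        = ∑' n, ‖a (n + N)‖ * ‖b (n + N)‖ := by
      rw [← h.summable.sum_add_tsum_nat_add N]; ring
    have hsN := (summable_nat_add_iff N).2 h.summable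
    rw [htail]
    have hC : 0 ≤ ∑' n, ‖a (n + N)‖ * ‖b (n + N)‖ := tsum_nonneg fun _ => by positivity
    refine ContinuousLinearMap.opNorm_le_bound _ hC fun ψ => ?_
    -- Testing the weak expansion against the error vector itself gives `‖v‖² ≤ tail · ‖ψ‖ · ‖v‖`.
    set v := (S N - T) ψ with hv
    have hsum := (hasSum_nat_add_iff' N).2 (h.hasSum v ψ)
    have hSN : ∀ χ, ⟪χ, T ψ⟫_ℂ - ∑ n ∈ Finset.range N, ⟪χ, a n⟫_ℂ * ⟪b n, ψ⟫_ℂ = -⟪χ, v⟫_ℂ := by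
      intro χ
      simp [hv, S, mul_comm]
    rw [hSN] at hsum
    have hle : ‖v‖ * ‖v‖ ≤ (∑' n, ‖a (n + N)‖ * ‖b (n + N)‖) * ‖ψ‖ * ‖v‖ := by
      calc ‖v‖ * ‖v‖ = ‖-⟪v, v⟫_ℂ‖ := by
            rw [norm_neg, inner_self_eq_norm_sq_to_K]; simp [sq]
        _ ≤ ∑' n, ‖a (n + N)‖ * ‖b (n + N)‖ * (‖ψ‖ * ‖v‖) := by
          rw [← hsum.tsum_eq]
          refine tsum_of_norm_bounded (hsN.mul_right _).hasSum fun n => ?_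
          rw [norm_mul]
          calc _ ≤ (‖v‖ * ‖a (n + N)‖) * (‖b (n + N)‖ * ‖ψ‖) := by
                gcongr <;> exact norm_inner_le_norm _ _
            _ = _ := by ring
        _ = _ := by rw [tsum_mul_right]; ring
    rcases (norm_nonneg v).eq_or_lt with h0 | h0
    · rw [← h0]; positivity
    · exact le_of_mul_le_mul_right hle h0
  exact isCompactOperator_of_tendsto hlim (Eventually.of_forall hrank)

/-- Hilbert bases of all the eigenspaces are glued together; they are total by the spectral theorem
for compact symmetric operators. The kernel is included, so that the result is a basis of the whole
space and computes traces. -/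
theorem exists_eigenbasis {T : E →L[ℂ] E} (hT : T.IsPositive) (hc : IsCompactOperator T) :
    ∃ (ι : Type u) (e : HilbertBasis ι ℂ E) (l : ι → ℝ), ∀ i, 0 ≤ l i ∧ T (e i) = (l i : ℂ) • e i := by
  have hsym : T.IsSymmetric := hT.isSymmetric
  let V : ℂ → Submodule ℂ E := fun μ => Module.End.eigenspace (T : Module.End ℂ E) μ
  have hclosed : ∀ μ, IsClosed (V μ : Set E) := by
    intro μ
    have : (V μ : Set E) = {x | T x = μ • x} := by
      ext x; simp [V]
    rw [this]
    exact isClosed_eq T.continuous (continuous_const_smul μ)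
  have : ∀ μ, CompleteSpace (V μ) := fun μ => (hclosed μ).completeSpace_coe
  choose w b hb using fun μ => exists_hilbertBasis ℂ (V μ)
  have hfam := hsym.orthogonalFamily_eigenspaces
  have hon := hfam.orthonormal_sigma_orthonormal (v_family := fun μ (i : w μ) => b μ i)
    fun μ => (b μ).orthonormal
  have hmem : ∀ x : (Σ μ, w μ), T (b x.1 x.2 : E) = x.1 • (b x.1 x.2 : E) := fun x =>
    Module.End.mem_eigenspace_iff.1 (b x.1 x.2).2
  have hspan : (Submodule.span ℂ (Set.range fun x : (Σ μ, w μ) => (b x.1 x.2 : E)))ᗮ = ⊥ := by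
    rw [eq_bot_iff, ← ContinuousLinearMap.orthogonalComplement_iSup_eigenspaces_eq_bot hc hsym,
      ← Submodule.iInf_orthogonal]
    refine le_iInf fun μ v hv => ?_
    rw [Submodule.mem_orthogonal'] at hv ⊢
    intro u hu
    have h1 := ((b μ).hasSum_repr ⟨u, hu⟩).mapL ((V μ).subtypeL)
    have h2 := h1.mapL (innerSL ℂ v)
    refine h2.unique ?_
    convert! hasSum_zero with i
    have := hv (b μ i) (Submodule.subset_span ⟨⟨μ, i⟩, rfl⟩)
    simp [this]
  let e := HilbertBasis.mkOfOrthogonalEqBot hon hspan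
  have he : ∀ x, e x = (b x.1 x.2 : E) := fun x =>
    congrFun (HilbertBasis.coe_mkOfOrthogonalEqBot hon hspan) x
  refine ⟨_, e, fun x => x.1.re, fun x => ?_⟩
  have hn : ⟪e x, e x⟫_ℂ = 1 := by
    rw [inner_self_eq_norm_sq_to_K, e.orthonormal.1 x]; simp
  have h1 : T (e x) = x.1 • e x := by rw [he]; exact hmem x
  have h2 := hT.inner_nonneg_right (e x)
  rw [h1, inner_smul_right, hn, mul_one] at h2
  have h3 := Complex.nonneg_iff.1 h2
  refine ⟨h3.1, ?_⟩
  rw [h1]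
  congr 1
  exact Complex.ext (by simp) (by simp [← h3.2])

end TraceClass

/-! ### Duality for the dissipator of an unbounded operator -/

section Dissipator

universe u

variable {E : Type u} [NormedAddCommGroup E] [InnerProductSpace ℂ E]

theorem mem_domain_ofCLM (T : E →L[ℂ] E) (ψ : E) : ψ ∈ (ofCLM T).domain := Submodule.mem_top

theorem ofCLM_apply (T : E →L[ℂ] E) (ψ : (ofCLM T).domain) : ofCLM T ψ = T ψ := rfl

theorem eq_of_le_ofCLM {S : E →ₗ.[ℂ] E} {T : E →L[ℂ] E} (h : S ≤ ofCLM T) (ψ : S.domain) :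
    S ψ = T ψ :=
  h.2 (y := ⟨ψ, mem_domain_ofCLM T ψ⟩) rfl

variable [CompleteSpace E]

theorem inner_adjoint_apply {L : E →ₗ.[ℂ] E} (hL : Dense (L.domain : Set E)) {φ ψ : E}
    (hφ : φ ∈ L†.domain) (hψ : ψ ∈ L.domain) : ⟪L† ⟨φ, hφ⟩, ψ⟫_ℂ = ⟪φ, L ⟨ψ, hψ⟩⟫_ℂ :=
  LinearPMap.adjoint_isFormalAdjoint hL ⟨φ, hφ⟩ ⟨ψ, hψ⟩

theorem inner_apply_adjoint {L : E →ₗ.[ℂ] E} (hL : Dense (L.domain : Set E)) {φ ψ : E}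
    (hφ : φ ∈ L†.domain) (hψ : ψ ∈ L.domain) : ⟪ψ, L† ⟨φ, hφ⟩⟫_ℂ = ⟪L ⟨ψ, hψ⟩, φ⟫_ℂ := by
  rw [← inner_conj_symm, inner_adjoint_apply hL hφ hψ, inner_conj_symm]

/-- In an eigenbasis of `ρ` the three products become weighted sums of form values at eigenvectors
in the domain of `L`, and `hZ` compares them term by term. Invariance of this domain under `A` and
its adjoint allows `L†` to be moved to the other side of the inner product in the anticommutator. -/
theorem trace_comp_dissipator {L : E →ₗ.[ℂ] E} {ρ D A Z : E →L[ℂ] E}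
    (hρ : ρ.IsPositive) (hρ' : IsTraceClass ρ) (hD : IsDissipator L ρ D)
    (hL : Dense (L.domain : Set E)) (hL' : Dense (L†.domain : Set E))
    (hLL : Dense ((L† ⊚ L).domain : Set E))
    (hA : ∀ ψ ∈ L.domain, A ψ ∈ L.domain) (hA' : ∀ ψ ∈ L.domain, A.adjoint ψ ∈ L.domain)
    (hZ : ∀ ψ (hψ : ψ ∈ L.domain), ⟪L ⟨ψ, hψ⟩, A (L ⟨ψ, hψ⟩)⟫_ℂ
      - (1 / 2 : ℂ) * (⟪L ⟨A.adjoint ψ, hA' ψ hψ⟩, L ⟨ψ, hψ⟩⟫_ℂ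
        + ⟪L ⟨ψ, hψ⟩, L ⟨A ψ, hA ψ hψ⟩⟫_ℂ) = ⟪ψ, Z ψ⟫_ℂ) :
    HasTrace (A ∘L D) (trace (Z ∘L ρ)) := by
  classical
  obtain ⟨hdom, J, K, K', hJ, hK, hK', hJe, hKe, hKe', rfl⟩ := hD
  obtain ⟨ι, e, l, hel⟩ := exists_eigenbasis hρ hρ'.isCompactOperator
  have hsym : ∀ x y, ⟪ρ x, y⟫_ℂ = ⟪x, ρ y⟫_ℂ := hρ.isSymmetric
  have hmem : ∀ i, l i ≠ 0 → e i ∈ (L† ⊚ L).domain := by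
    intro i hi
    have h1 : e i = (l i : ℂ)⁻¹ • ρ (e i) := by
      rw [(hel i).2, smul_smul, inv_mul_cancel₀ (by exact_mod_cast hi), one_smul]
    rw [h1]
    exact Submodule.smul_mem _ _ (hdom _)
  have hmemL : ∀ i, l i ≠ 0 → e i ∈ L.domain := fun i hi => (mem_domain_prod.1 (hmem i hi)).1
  -- The default value `0` is harmless: by `hmemL` it can occur only for `l i = 0`.
  let u : ι → E := fun i => if h : e i ∈ L.domain then L ⟨e i, h⟩ else 0
  have hu : ∀ i (hi : e i ∈ L.domain), u i = L ⟨e i, hi⟩ := fun i hi => dif_pos hi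
  have hue : ∀ i φ (hφ : φ ∈ L†.domain), l i ≠ 0 → ⟪e i, L† ⟨φ, hφ⟩⟫_ℂ = ⟪u i, φ⟫_ℂ := by
    intro i φ hφ hi
    rw [hu i (hmemL i hi), inner_apply_adjoint hL]
  have hKapp : ∀ ψ, ∃ h : ρ ψ ∈ L.domain, ∃ h' : L ⟨ρ ψ, h⟩ ∈ L†.domain,
      K ψ = L† ⟨L ⟨ρ ψ, h⟩, h'⟩ := by
    intro ψ
    obtain ⟨h, h'⟩ := mem_domain_prod.1 (hdom ψ)
    have hd : ψ ∈ (L† ⊚ L ⊚ ofCLM ρ).domain :=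
      mem_domain_prod.2 ⟨mem_domain_prod.2 ⟨mem_domain_ofCLM ρ ψ, h⟩, h'⟩
    exact ⟨h, h', (eq_of_le_ofCLM hKe ⟨ψ, hd⟩).symm⟩
  have hJapp : ∀ φ (hφ : φ ∈ L†.domain), ∃ h : ρ (L† ⟨φ, hφ⟩) ∈ L.domain,
      J φ = L ⟨ρ (L† ⟨φ, hφ⟩), h⟩ := by
    intro φ hφ
    have h := (mem_domain_prod.1 (hdom (L† ⟨φ, hφ⟩))).1
    have hd : φ ∈ (L ⊚ ofCLM ρ ⊚ L†).domain :=
      mem_domain_prod.2 ⟨mem_domain_prod.2 ⟨hφ, mem_domain_ofCLM ρ _⟩, h⟩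
    exact ⟨h, (eq_of_le_ofCLM hJe ⟨φ, hd⟩).symm⟩
  -- `K'` is controlled only on the domain of `L†L`; density of this domain and continuity give the
  -- rest.
  have hKadj : K' = K.adjoint := by
    refine ContinuousLinearMap.ext fun φ => ?_
    refine congrFun (Continuous.ext_on hLL K'.continuous K.adjoint.continuous fun φ hφ => ?_) φ
    refine ext_inner_left ℂ fun ψ => ?_
    obtain ⟨h, h'⟩ := mem_domain_prod.1 hφ
    have hd : φ ∈ (ofCLM ρ ⊚ L† ⊚ L).domain :=
      mem_domain_prod.2 ⟨hφ, mem_domain_ofCLM ρ _⟩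
    have h1 : K' φ = ρ (L† ⟨L ⟨φ, h⟩, h'⟩) := (eq_of_le_ofCLM hKe' ⟨φ, hd⟩).symm
    obtain ⟨g, g', h2⟩ := hKapp ψ
    rw [h1, ContinuousLinearMap.adjoint_inner_right, h2, inner_adjoint_apply hL g' h, ← hsym,
      inner_apply_adjoint hL h' g]
  have hJsum : ∀ χ ∈ L†.domain, ∀ φ ∈ L†.domain,
      HasSum (fun i => (l i : ℂ) * (⟪χ, u i⟫_ℂ * ⟪u i, φ⟫_ℂ)) ⟪χ, J φ⟫_ℂ := by
    intro χ hχ φ hφ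
    obtain ⟨h, h'⟩ := hJapp φ hφ
    rw [h', ← inner_adjoint_apply hL hχ h]
    convert! e.hasSum_inner_mul_inner (L† ⟨χ, hχ⟩) (ρ (L† ⟨φ, hφ⟩)) using 2 with i
    rw [← hsym, (hel i).2, inner_smul_left, Complex.conj_ofReal]
    by_cases hi : l i = 0
    · simp [hi]
    · rw [← inner_conj_symm (L† ⟨χ, hχ⟩), hue i _ hφ hi, hue i _ hχ hi, inner_conj_symm]
      ring
  -- The expansion of `J` is known only on the domain of `L†`, but with a finite `F` the inequality
  -- is a closed condition on `φ`.
  have hbound : ∀ (F : Finset ι) (φ : E),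
      ∑ i ∈ F, l i * ‖⟪u i, φ⟫_ℂ‖ ^ 2 ≤ (⟪φ, J φ⟫_ℂ).re := by
    intro F φ
    have hcl : IsClosed {φ : E | ∑ i ∈ F, l i * ‖⟪u i, φ⟫_ℂ‖ ^ 2 ≤ (⟪φ, J φ⟫_ℂ).re} :=
      isClosed_le (by fun_prop) (by fun_prop)
    refine hcl.closure_subset_iff.2 (fun φ hφ => ?_) (hL' φ)
    have h1 := Complex.hasSum_re (hJsum φ hφ φ hφ)
    have h2 : ∀ i, ((l i : ℂ) * (⟪φ, u i⟫_ℂ * ⟪u i, φ⟫_ℂ)).re = l i * ‖⟪u i, φ⟫_ℂ‖ ^ 2 := by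
      intro i
      rw [← inner_conj_symm φ, mul_comm (starRingEnd ℂ _), Complex.mul_conj, Complex.normSq_eq_norm_sq]
      norm_cast
    simp_rw [h2] at h1
    exact sum_le_hasSum F (fun i _ => mul_nonneg (hel i).1 (by positivity)) h1
  -- Summing `hbound` over the basis bounds every partial sum by `tr J`: the trace class hypothesis
  -- on `J` is what makes `∑ l i ‖L (e i)‖²` finite.
  have hsummable : Summable fun i => l i * ‖u i‖ ^ 2 := by
    refine summable_of_sum_le (c := (trace J).re)
      (fun i => mul_nonneg (hel i).1 (by positivity)) fun F => ?_
    have h1 := Complex.hasSum_re (hJ.isNuclear.hasSum_trace e)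
    have h2 : HasSum (fun m => ∑ i ∈ F, l i * ‖⟪u i, e m⟫_ℂ‖ ^ 2) (∑ i ∈ F, l i * ‖u i‖ ^ 2) := by
      refine hasSum_sum fun i _ => HasSum.mul_left _ ?_
      have h3 := Complex.hasSum_re (e.hasSum_inner_mul_inner (u i) (u i))
      rw [inner_self_eq_norm_sq_to_K] at h3
      convert! h3 using 2 with m
      · rw [← inner_conj_symm (e m), Complex.mul_conj, Complex.normSq_eq_norm_sq]
        norm_cast
      · norm_cast
    exact hasSum_le (fun m => hbound F (e m)) h2 h1
  have hJexp : IsNuclearExpansion J (fun i => (l i : ℂ) • u i) u := by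
    have hs : Summable fun i => ‖(l i : ℂ) • u i‖ * ‖u i‖ := by
      convert hsummable using 2 with i
      rw [norm_smul, Complex.norm_real, Real.norm_of_nonneg (hel i).1]; ring
    obtain ⟨J', hJ'⟩ := exists_isNuclearExpansion hs
    suffices J = J' by rwa [this]
    refine ContinuousLinearMap.ext fun φ => ?_
    refine congrFun (Continuous.ext_on hL' J.continuous J'.continuous fun φ hφ => ?_) φ
    refine hL'.eq_of_inner_right ℂ fun χ hχ => ?_
    refine (hJsum χ hχ φ hφ).unique ?_
    convert! hJ'.hasSum χ φ using 2 with i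
    rw [inner_smul_right]; ring
  have tJ : HasSum (fun i => (l i : ℂ) * ⟪u i, A (u i)⟫_ℂ) (trace (A ∘L J)) := by
    have h := hJexp.comp_left A
    rw [h.trace_eq]
    simpa [inner_smul_right] using h.summable_inner.of_norm.hasSum
  have tK := (hK.isNuclear.comp_left A).hasSum_trace e
  have tK' := (hK'.isNuclear.comp_right A).hasSum_trace e
  have tZ := (hρ'.isNuclear.comp_left Z).hasSum_trace e
  have hval : trace (A ∘L J) - (1 / 2 : ℂ) * (trace (A ∘L K) + trace (A ∘L K'))
      = trace (Z ∘L ρ) := by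
    -- For `K' A`, with `K'` the adjoint of `K`, the diagonal entry is `⟨K eᵢ, A eᵢ⟩`, which needs
    -- only the value of `K` at `eᵢ`.
    rw [hK'.isNuclear.trace_comp_comm A]
    refine (tJ.sub ((tK.add tK').mul_left (1 / 2 : ℂ))).unique ?_
    convert! tZ using 2 with i
    simp only [ContinuousLinearMap.comp_apply]
    obtain ⟨g, g', hKi⟩ := hKapp (e i)
    have hZi : ⟪e i, Z (ρ (e i))⟫_ℂ = l i * ⟪e i, Z (e i)⟫_ℂ := by
      rw [(hel i).2, map_smul, inner_smul_right]
    rw [hKadj, ContinuousLinearMap.adjoint_inner_right, hKi, hZi,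
      ← ContinuousLinearMap.adjoint_inner_left A (L† ⟨L ⟨ρ (e i), g⟩, g'⟩)]
    -- For `l i = 0` the vector `e i` need not lie in the domain of `L`, but then `K (e i) = 0` and
    -- every term vanishes.
    by_cases hi : l i = 0
    · have h0 : (⟨ρ (e i), g⟩ : L.domain) = 0 := Subtype.ext (by simp [(hel i).2, hi])
      have h1 : (⟨L ⟨ρ (e i), g⟩, g'⟩ : L†.domain) = 0 := Subtype.ext (by simp [h0])
      rw [h1]; simp [hi]
    · have hm := hmemL i hi
      rw [inner_apply_adjoint hL g' (hA' _ hm), inner_adjoint_apply hL g' (hA _ hm), ← hZ _ hm, hu i hm]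
      have h0 : (⟨ρ (e i), g⟩ : L.domain) = (l i : ℂ) • ⟨e i, hm⟩ := Subtype.ext (hel i).2
      rw [h0, LinearPMap.map_smul, inner_smul_right, inner_smul_left, Complex.conj_ofReal]
      ring
  rw [← hval]
  have h1 := (hJ.isNuclear.comp_left A).hasTrace
  have h2 := (hK.isNuclear.comp_left A).hasTrace
  have h3 := (hK'.isNuclear.comp_left A).hasTrace
  have := h1.sub ((h2.add h3).smul (1 / 2 : ℂ))
  convert this using 1
  ext ψ
  simp

end Dissipator

/-! ### Generators, commutators as derivatives, and the dual dissipators -/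

section Generator

universe u

variable {E : Type u} [NormedAddCommGroup E] [InnerProductSpace ℂ E] [CompleteSpace E]

/-- `P` is the generator of the unitary family `W s = exp (isP)`; moreover `P²` is densely
defined. -/
structure IsGenerator (P : E →ₗ.[ℂ] E) (W : ℝ → E →L[ℂ] E) : Prop where
  zero : W 0 = 1
  mul_neg : ∀ s, W s * W (-s) = 1
  star_eq : ∀ s, star (W s) = W (-s)
  apply_iff : ∀ ψ χ, (∃ h : ψ ∈ P.domain, P ⟨ψ, h⟩ = χ) ↔
    HasDerivAt (fun s => W s ψ) (Complex.I • χ) 0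
  dense_sq : Dense {ψ | ∃ h : ψ ∈ P.domain, P ⟨ψ, h⟩ ∈ P.domain}

/-- `B` is the derivative at `s = 0` of `W s A (W s)⁻¹`. -/
def IsConjDeriv (W : ℝ → E →L[ℂ] E) (A B : E →L[ℂ] E) : Prop :=
  HasDerivAt (fun s => W s * A * W (-s)) B 0

namespace IsGenerator

variable {P : E →ₗ.[ℂ] E} {W : ℝ → E →L[ℂ] E}

theorem neg_mul (hP : IsGenerator P W) (s : ℝ) : W (-s) * W s = 1 := by
  simpa using hP.mul_neg (-s)

theorem hasDerivAt (hP : IsGenerator P W) {ψ : E} (h : ψ ∈ P.domain) :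
    HasDerivAt (fun s => W s ψ) (Complex.I • P ⟨ψ, h⟩) 0 :=
  (hP.apply_iff _ _).1 ⟨h, rfl⟩

theorem dense_domain (hP : IsGenerator P W) : Dense (P.domain : Set E) :=
  hP.dense_sq.mono fun _ h => h.1

/-- Differentiate `⟨W s ψ, φ⟩ = ⟨ψ, W (-s) φ⟩` at `s = 0`. -/
theorem inner_apply (hP : IsGenerator P W) {ψ φ : E} (hψ : ψ ∈ P.domain) (hφ : φ ∈ P.domain) :
    ⟪P ⟨ψ, hψ⟩, φ⟫_ℂ = ⟪ψ, P ⟨φ, hφ⟩⟫_ℂ := by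
  have h1 := (hP.hasDerivAt hψ).inner ℂ (hasDerivAt_const (0 : ℝ) φ)
  have h2 : HasDerivAt (fun s => W (-s) φ) (-(Complex.I • P ⟨φ, hφ⟩)) 0 := by
    have := HasDerivAt.scomp (0 : ℝ) (h := fun s : ℝ => -s) (h' := -1)
      (by simpa using hP.hasDerivAt hφ) (hasDerivAt_neg 0)
    simpa [Function.comp_def] using this
  have h3 := (hasDerivAt_const (0 : ℝ) ψ).inner ℂ h2
  have h4 : (fun s => ⟪W s ψ, φ⟫_ℂ) = fun s => ⟪ψ, W (-s) φ⟫_ℂ := by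
    funext s
    rw [← hP.star_eq, ContinuousLinearMap.star_eq_adjoint, ContinuousLinearMap.adjoint_inner_right]
  rw [h4] at h1
  have := h1.unique h3
  simpa [inner_smul_left, inner_smul_right, inner_neg_right] using this

/-- By the product rule `W s (A ψ) = (W s A W (-s)) (W s ψ)` is differentiable at `0`, and
`apply_iff` converts this into membership in the domain. In short, `B = i[P, A]`. -/
theorem apply_conjDeriv (hP : IsGenerator P W) {A B : E →L[ℂ] E} (hA : IsConjDeriv W A B) {ψ : E}
    (hψ : ψ ∈ P.domain) :
    ∃ h : A ψ ∈ P.domain, P ⟨A ψ, h⟩ = A (P ⟨ψ, hψ⟩) - Complex.I • B ψ := by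
  rw [hP.apply_iff]
  have h1 : HasDerivAt (fun s => (W s * A * W (-s)).restrictScalars ℝ) (B.restrictScalars ℝ) 0 :=
    (ContinuousLinearMap.restrictScalarsL ℂ E E ℝ ℝ).hasFDerivAt.comp_hasDerivAt 0 hA
  have h2 := h1.clm_apply (hP.hasDerivAt hψ)
  have h3 : ∀ s, (W s * A * W (-s)) (W s ψ) = W s (A ψ) := by
    intro s
    have := congrArg (fun T => (W s * A * T) ψ) (hP.neg_mul s)
    simpa using this
  simp only [ContinuousLinearMap.coe_restrictScalars', h3] at h2
  convert h2 using 1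
  simp [hP.zero, smul_sub, smul_smul, add_comm]

theorem conj (hP : IsGenerator P W) {R : E →L[ℂ] E} (h1 : R * star R = 1) (h2 : star R * R = 1) :
    IsGenerator (ofCLM R ⊚ P ⊚ ofCLM (star R)) fun s => R * W s * star R where
  zero := by simp [hP.zero, h1]
  mul_neg s := by
    calc R * W s * star R * (R * W (-s) * star R)
        = R * (W s * (star R * R) * W (-s)) * star R := by simp only [mul_assoc]
      _ = 1 := by rw [h2, mul_one, hP.mul_neg, mul_one, h1]
  star_eq s := by simp [hP.star_eq, mul_assoc]
  apply_iff ψ χ := by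
    have h1' : ∀ φ, R (star R φ) = φ := fun φ => congrArg (fun T => T φ) h1
    have h2' : ∀ φ, star R (R φ) = φ := fun φ => congrArg (fun T => T φ) h2
    have e1 : (∃ h : ψ ∈ (ofCLM R ⊚ P ⊚ ofCLM (star R)).domain,
        (ofCLM R ⊚ P ⊚ ofCLM (star R)) ⟨ψ, h⟩ = χ) ↔
        ∃ h : star R ψ ∈ P.domain, P ⟨star R ψ, h⟩ = star R χ := by
      constructor
      · rintro ⟨h, rfl⟩
        obtain ⟨g, _⟩ := mem_domain_prod.1 h
        obtain ⟨_, g'⟩ := mem_domain_prod.1 g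
        exact ⟨g', (h2' _).symm⟩
      · rintro ⟨h, h'⟩
        refine ⟨mem_domain_prod.2 ⟨mem_domain_prod.2 ⟨mem_domain_ofCLM _ _, h⟩,
          mem_domain_ofCLM _ _⟩, ?_⟩
        rw [← h1' χ, ← h']
        rfl
    rw [e1, hP.apply_iff]
    constructor
    · intro h
      have := (R.restrictScalars ℝ).hasFDerivAt.comp_hasDerivAt 0 h
      simpa [Function.comp_def, h1'] using this
    · intro h
      have := ((star R).restrictScalars ℝ).hasFDerivAt.comp_hasDerivAt 0 h
      simpa [Function.comp_def, h2'] using this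
  dense_sq := by
    have h1' : ∀ φ, R (star R φ) = φ := fun φ => congrArg (fun T => T φ) h1
    have h2' : ∀ φ, star R (R φ) = φ := fun φ => congrArg (fun T => T φ) h2
    have hs : Function.Surjective R := fun φ => ⟨_, h1' φ⟩
    refine (hs.denseRange.dense_image R.continuous hP.dense_sq).mono ?_
    rintro _ ⟨ψ, ⟨h, h'⟩, rfl⟩
    have hd : ∀ φ, φ ∈ P.domain → R φ ∈ (ofCLM R ⊚ P ⊚ ofCLM (star R)).domain := fun φ hφ =>
      mem_domain_prod.2 ⟨mem_domain_prod.2 ⟨mem_domain_ofCLM _ _,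
        by rw [ofCLM_apply]; simpa [h2'] using hφ⟩, mem_domain_ofCLM _ _⟩
    refine ⟨hd ψ h, ?_⟩
    have : (ofCLM R ⊚ P ⊚ ofCLM (star R)) ⟨R ψ, hd ψ h⟩ = R (P ⟨ψ, h⟩) := by
      have hx : ∀ (x y : P.domain), x = y → R (P x) = R (P y) := fun x y e => by rw [e]
      exact hx _ _ (Subtype.ext (h2' ψ))
    rw [this]
    exact hd _ h'

end IsGenerator

theorem IsConjDeriv.adjoint {W : ℝ → E →L[ℂ] E} (hW : ∀ s, star (W s) = W (-s)) {A B : E →L[ℂ] E}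
    (h : IsConjDeriv W A B) : IsConjDeriv W (star A) (star B) := by
  have := HasDerivAt.star h
  unfold IsConjDeriv
  convert! this using 2 with s
  simp [hW, mul_assoc]

theorem IsConjDeriv.mul {W : ℝ → E →L[ℂ] E} (h0 : W 0 = 1) (hW : ∀ s, W (-s) * W s = 1)
    {A B A' B' : E →L[ℂ] E} (h : IsConjDeriv W A B) (h' : IsConjDeriv W A' B') :
    IsConjDeriv W (A * A') (B * A' + A * B') := by
  have := HasDerivAt.mul h h'
  unfold IsConjDeriv
  convert! this using 1
  · funext s
    calc W s * (A * A') * W (-s) = W s * A * 1 * A' * W (-s) := by simp [mul_assoc]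
      _ = _ := by rw [← hW s]; simp [mul_assoc]
  · simp [h0]

/-- For symmetric `P` the dual dissipator is `-½ [P, [P, A]]`, and `A₂ = i[P, i[P, A]]`. The
inclusion of `P` in its adjoint makes the domain of `P†P` contain that of `P²`, which is dense. -/
theorem trace_comp_dissipator_generator {P : E →ₗ.[ℂ] E} {W : ℝ → E →L[ℂ] E}
    {ρ D A A₁ A₂ : E →L[ℂ] E} (hρ : ρ.IsPositive) (hρ' : IsTraceClass ρ) (hP : IsGenerator P W)
    (hD : IsDissipator P ρ D) (hA : IsConjDeriv W A A₁) (hA₁ : IsConjDeriv W A₁ A₂) :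
    HasTrace (A ∘L D) (trace (((1 / 2 : ℂ) • A₂) ∘L ρ)) := by
  have hsub : ∀ ψ ∈ P.domain, ψ ∈ P†.domain := fun ψ hψ =>
    LinearPMap.mem_adjoint_domain_of_exists ψ ⟨P ⟨ψ, hψ⟩, fun x => hP.inner_apply hψ x.2⟩
  have hAs : IsConjDeriv W A.adjoint A₁.adjoint := hA.adjoint hP.star_eq
  refine trace_comp_dissipator hρ hρ' hD hP.dense_domain (hP.dense_domain.mono hsub)
    (hP.dense_sq.mono (by rintro ψ ⟨h, h'⟩; exact mem_domain_prod.2 ⟨h, hsub _ h'⟩))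
    (fun ψ hψ => (hP.apply_conjDeriv hA hψ).1)
    (fun ψ hψ => (hP.apply_conjDeriv hAs hψ).1) fun ψ hψ => ?_
  obtain ⟨g, hg⟩ := hP.apply_conjDeriv hA hψ
  obtain ⟨g', hg'⟩ := hP.apply_conjDeriv hAs hψ
  obtain ⟨g₁, hg₁⟩ := hP.apply_conjDeriv hA₁ hψ
  have h2 := hP.inner_apply hψ g₁
  rw [hg₁] at h2
  rw [hg, hg']
  simp only [inner_sub_left, inner_sub_right, inner_smul_left, inner_smul_right,
    ContinuousLinearMap.adjoint_inner_left, smul_apply,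
    Complex.conj_I] at h2 ⊢
  rw [h2]
  linear_combination (-(1 / 2 : ℂ) * ⟪ψ, A₂ ψ⟫_ℂ) * Complex.I_sq

/-- Here `L = aU(1 - εP) - 1`. As `U` commutes with `A` and `A₁`, `[L, A] = i a ε U A₁`. In `½
(L†[A, L] + [L†, A] L)` the terms containing `P` cancel up to `[P, A₁] = -i A₂`, and the summand
`-1` of `L` leaves `U - U†`. -/
theorem trace_comp_dissipator_shifted {P L : E →ₗ.[ℂ] E} {W : ℝ → E →L[ℂ] E} {a ε : ℝ}
    {ρ D U U₁ A A₁ A₂ : E →L[ℂ] E} (hρ : ρ.IsPositive) (hρ' : IsTraceClass ρ)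
    (hP : IsGenerator P W) (hLP : ∀ ψ, ψ ∈ L.domain ↔ ψ ∈ P.domain)
    (hL : ∀ ψ (h : ψ ∈ L.domain) (h' : ψ ∈ P.domain),
      L ⟨ψ, h⟩ = (a : ℂ) • U (ψ - (ε : ℂ) • P ⟨ψ, h'⟩) - ψ)
    (hD : IsDissipator L ρ D) (hUU : star U * U = 1) (hUU' : U * star U = 1)
    (hU : IsConjDeriv W U U₁) (hA : IsConjDeriv W A A₁) (hA₁ : IsConjDeriv W A₁ A₂)
    (hUA : U * A = A * U) (hUA₁ : U * A₁ = A₁ * U) :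
    HasTrace (A ∘L D) (trace (((1 / 2 : ℂ) • (((a * ε : ℝ) : ℂ) ^ 2 • A₂ +
      (Complex.I * (a * ε : ℝ)) • ((U - star U) * A₁))) ∘L ρ)) := by
  have hUs : IsConjDeriv W U.adjoint U₁.adjoint := hU.adjoint hP.star_eq
  have hsub : ∀ ψ ∈ P.domain, ψ ∈ L†.domain := by
    intro ψ hψ
    obtain ⟨g, -⟩ := hP.apply_conjDeriv hUs hψ
    refine LinearPMap.mem_adjoint_domain_of_exists ψ
      ⟨(a : ℂ) • (U.adjoint ψ - (ε : ℂ) • P ⟨_, g⟩) - ψ, fun x => ?_⟩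
    have hx := (hLP x).1 x.2
    have h3 := hP.inner_apply g hx
    rw [ContinuousLinearMap.adjoint_inner_left] at h3
    rw [hL x x.2 hx]
    simp only [inner_sub_left, inner_sub_right, inner_smul_left, inner_smul_right, map_sub,
      map_smul, h3,
      ContinuousLinearMap.adjoint_inner_left, Complex.conj_ofReal]
  have hAs : IsConjDeriv W A.adjoint A₁.adjoint := hA.adjoint hP.star_eq
  have hdL : (L.domain : Set E) = P.domain := Set.ext hLP
  have cA : ∀ ψ, U (A ψ) = A (U ψ) := fun ψ => congrArg (fun T => T ψ) hUA
  have cA₁ : ∀ ψ, U (A₁ ψ) = A₁ (U ψ) := fun ψ => congrArg (fun T => T ψ) hUA₁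
  have star_comm : ∀ T : E →L[ℂ] E, U * T = T * U → star U * T = T * star U := by
    intro T hT
    calc star U * T = star U * (T * U) * star U := by rw [mul_assoc, mul_assoc, hUU', mul_one]
      _ = T * star U := by rw [← hT, ← mul_assoc, hUU, one_mul]
  -- The adjoint of the relation `U† A = A U†`.
  have cs : ∀ ψ, U (A.adjoint ψ) = A.adjoint (U ψ) := by
    have := congrArg Star.star (star_comm A hUA)
    simp only [star_mul, star_star] at this
    exact fun ψ => (congrArg (fun T => T ψ) this).symm
  have cA₁s : ∀ ψ, U.adjoint (A₁ ψ) = A₁ (U.adjoint ψ) := fun ψ =>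
    congrArg (fun T => T ψ) (star_comm A₁ hUA₁)
  have uU : ∀ ψ, U.adjoint (U ψ) = ψ := fun ψ => congrArg (fun T => T ψ) hUU
  refine trace_comp_dissipator hρ hρ' hD (hdL ▸ hP.dense_domain) (hP.dense_domain.mono hsub)
    (hP.dense_sq.mono ?_)
    (fun ψ hψ => (hLP _).2 (hP.apply_conjDeriv hA ((hLP ψ).1 hψ)).1)
    (fun ψ hψ => (hLP _).2 (hP.apply_conjDeriv hAs ((hLP ψ).1 hψ)).1) fun ψ hψ => ?_
  -- On the domain of `P²` the vector `ψ - εPψ` stays in the domain of `P`, which `U` preserves by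
  -- `hU`; so `Lψ` lies in the domain of `P`, hence in that of `L†`.
  · rintro ψ ⟨h, h'⟩
    refine mem_domain_prod.2 ⟨(hLP ψ).2 h, hsub _ ?_⟩
    rw [hL ψ _ h]
    exact sub_mem (Submodule.smul_mem _ _ (hP.apply_conjDeriv hU
      (sub_mem h (Submodule.smul_mem _ _ h'))).1) h
  · have hψ' := (hLP ψ).1 hψ
    obtain ⟨g, hg⟩ := hP.apply_conjDeriv hA hψ'
    obtain ⟨g', hg'⟩ := hP.apply_conjDeriv hAs hψ'
    obtain ⟨g₁, hg₁⟩ := hP.apply_conjDeriv hA₁ hψ'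
    have h2 := hP.inner_apply hψ' g₁
    rw [hg₁] at h2
    set χ := P ⟨ψ, hψ'⟩ with hχ
    have hLψ : L ⟨ψ, hψ⟩ = (a : ℂ) • U (ψ - (ε : ℂ) • χ) - ψ := hL ψ hψ hψ'
    have e1 : L ⟨A ψ, (hLP _).2 g⟩ =
        A (L ⟨ψ, hψ⟩) + (Complex.I * (a * ε : ℝ)) • U (A₁ ψ) := by
      rw [hL _ _ g, hg, hLψ]
      simp only [map_sub, map_smul, cA, smul_sub, smul_smul]
      push_cast
      module
    have e2 : L ⟨A.adjoint ψ, (hLP _).2 g'⟩ =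
        A.adjoint (L ⟨ψ, hψ⟩) + (Complex.I * (a * ε : ℝ)) • U (A₁.adjoint ψ) := by
      rw [hL _ _ g', hg', hLψ]
      simp only [map_sub, map_smul, cs, smul_sub, smul_smul]
      push_cast
      module
    have e3 : ⟪U (A₁.adjoint ψ), L ⟨ψ, hψ⟩⟫_ℂ =
        a * (⟪ψ, A₁ ψ⟫_ℂ - ε * ⟪ψ, A₁ χ⟫_ℂ) - ⟪ψ, A₁ (U.adjoint ψ)⟫_ℂ := by
      rw [← ContinuousLinearMap.adjoint_inner_right, ContinuousLinearMap.adjoint_inner_left, hLψ]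
      simp only [map_sub, map_smul, uU, inner_sub_right, inner_smul_right]
    -- Unlike in `e3`, here `P` stands to the left of `A₁`; moving it across produces the second
    -- derivative `A₂`.
    have e4 : ⟪L ⟨ψ, hψ⟩, U (A₁ ψ)⟫_ℂ =
        a * (⟪ψ, A₁ ψ⟫_ℂ - ε * (⟪ψ, A₁ χ⟫_ℂ - Complex.I * ⟪ψ, A₂ ψ⟫_ℂ)) - ⟪ψ, U (A₁ ψ)⟫_ℂ := by
      have h3 : ⟪χ, A₁ ψ⟫_ℂ = ⟪ψ, A₁ χ⟫_ℂ - Complex.I * ⟪ψ, A₂ ψ⟫_ℂ := by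
        rw [h2, inner_sub_right, inner_smul_right]
      rw [hLψ, ← h3]
      simp only [inner_sub_left, inner_smul_left, ← ContinuousLinearMap.adjoint_inner_right U,
        uU, Complex.conj_ofReal]
    rw [e1, e2]
    simp only [inner_add_left, inner_add_right, inner_smul_left, inner_smul_right, e3, e4,
      ContinuousLinearMap.adjoint_inner_left, smul_apply, add_apply, sub_apply, mul_apply_eq_comp,
      ContinuousLinearMap.star_eq_adjoint, inner_sub_right, cA₁s, map_mul, Complex.conj_I, Complex.conj_ofReal]
    push_cast
    linear_combination (-(1 / 2 : ℂ) * (a * ε) ^ 2 * ⟪ψ, A₂ ψ⟫_ℂ) * Complex.I_sq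

end Generator

theorem hasDerivAt_zero_iff_tendsto {E : Type*} [NormedAddCommGroup E] [NormedSpace ℂ E]
    {f : ℝ → E} {v : E} :
    HasDerivAt f v 0 ↔ Tendsto (fun s : ℝ => (s : ℂ)⁻¹ • (f s - f 0)) (𝓝[≠] 0) (𝓝 v) := by
  rw [hasDerivAt_iff_tendsto_slope]
  have : slope f 0 = fun s : ℝ => (s : ℂ)⁻¹ • (f s - f 0) := by
    funext s
    rw [slope_def_module, sub_zero, ← Complex.ofReal_inv, Complex.coe_smul]
  rw [this]

/-! ### Bounded multiplication operators and their translates -/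

section Multiplication

/-- `m` is continuous and bounded. -/
structure IsBoundedContinuous (m : ℝ → ℂ) : Prop where
  continuous : Continuous m
  bounded : ∃ C, ∀ x, ‖m x‖ ≤ C

namespace IsBoundedContinuous

variable {m n : ℝ → ℂ}

theorem memLp (hm : IsBoundedContinuous m) : MemLp m ∞ (volume : Measure ℝ) := by
  obtain ⟨C, hC⟩ := hm.bounded
  exact memLp_top_of_bound hm.continuous.aestronglyMeasurable C (Eventually.of_forall hC)

theorem comp (hm : IsBoundedContinuous m) {φ : ℝ → ℝ} (hφ : Continuous φ) :
    IsBoundedContinuous fun x => m (φ x) where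
  continuous := hm.continuous.comp hφ
  bounded := hm.bounded.imp fun _ h _ => h _

theorem mul (hm : IsBoundedContinuous m) (hn : IsBoundedContinuous n) :
    IsBoundedContinuous fun x => m x * n x where
  continuous := hm.continuous.mul hn.continuous
  bounded := by
    obtain ⟨C, hC⟩ := hm.bounded
    obtain ⟨D, hD⟩ := hn.bounded
    refine ⟨C * D, fun x => ?_⟩
    rw [norm_mul]
    exact mul_le_mul (hC x) (hD x) (norm_nonneg _) ((norm_nonneg _).trans (hC x))

theorem add (hm : IsBoundedContinuous m) (hn : IsBoundedContinuous n) :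
    IsBoundedContinuous fun x => m x + n x where
  continuous := hm.continuous.add hn.continuous
  bounded := by
    obtain ⟨C, hC⟩ := hm.bounded
    obtain ⟨D, hD⟩ := hn.bounded
    exact ⟨C + D, fun x => norm_add_le_of_le (hC x) (hD x)⟩

theorem const (c : ℂ) : IsBoundedContinuous fun _ => c := ⟨continuous_const, ‖c‖, fun _ => le_rfl⟩

theorem const_mul (c : ℂ) (hm : IsBoundedContinuous m) : IsBoundedContinuous fun x => c * m x :=
  (const c).mul hm

theorem star (hm : IsBoundedContinuous m) : IsBoundedContinuous fun x => starRingEnd ℂ (m x) where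
  continuous := Complex.continuous_conj.comp hm.continuous
  bounded := by simpa using hm.bounded

theorem exp_mul_I (c : ℝ) : IsBoundedContinuous fun x => Complex.exp (Complex.I * c * x) where
  continuous := by fun_prop
  bounded := ⟨1, fun x => by
    rw [show Complex.I * c * x = ((c * x : ℝ) : ℂ) * Complex.I by push_cast; ring,
      Complex.norm_exp_ofReal_mul_I]⟩

end IsBoundedContinuous

theorem _root_.Function.Periodic.isBoundedContinuous {m : ℝ → ℂ} {T : ℝ}
    (hper : Function.Periodic m T) (hT : T ≠ 0) (hm : Continuous m) : IsBoundedContinuous m where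
  continuous := hm
  bounded := by
    obtain ⟨C, hC⟩ := (hper.isBounded_of_continuous hT hm).exists_norm_le
    exact ⟨C, fun x => hC _ ⟨x, rfl⟩⟩

/-- The function factors through the compact circle `AddCircle T`. -/
theorem _root_.Function.Periodic.uniformContinuous {m : ℝ → ℂ} {T : ℝ}
    (hper : Function.Periodic m T) (hT : 0 < T) (hm : Continuous m) : UniformContinuous m := by
  have : Fact (0 < T) := ⟨hT⟩
  have h1 : Continuous (hper.lift : AddCircle T → ℂ) := hm.quotient_lift _
  have h2 : UniformContinuous ((↑) : ℝ → AddCircle T) :=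
    uniformContinuous_addMonoidHom_of_continuous (f := QuotientAddGroup.mk' _)
      (AddCircle.continuous_mk' T)
  exact (CompactSpace.uniformContinuous_of_continuous h1).comp h2

theorem ext_ae {ψ χ : H} (h : ∀ᵐ x : ℝ, ψ x = χ x) : ψ = χ := Lp.ext h

theorem posFun_mul {m n : ℝ → ℂ} (hm : IsBoundedContinuous m) (hn : IsBoundedContinuous n) :
    posFun (fun x => m x * n x) = posFun m * posFun n := by
  refine ContinuousLinearMap.ext fun ψ => ext_ae ?_
  filter_upwards [posFun_apply (hm.mul hn).memLp ψ, posFun_apply hm.memLp (posFun n ψ),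
    posFun_apply hn.memLp ψ] with x h1 h2 h3
  rw [h1, mul_assoc, ← h3, ← h2]
  rfl

theorem posFun_add {m n : ℝ → ℂ} (hm : IsBoundedContinuous m) (hn : IsBoundedContinuous n) :
    posFun (fun x => m x + n x) = posFun m + posFun n := by
  refine ContinuousLinearMap.ext fun ψ => ext_ae ?_
  filter_upwards [posFun_apply (hm.add hn).memLp ψ, posFun_apply hm.memLp ψ,
    posFun_apply hn.memLp ψ, Lp.coeFn_add (posFun m ψ) (posFun n ψ)] with x h1 h2 h3 h4
  rw [h1, add_mul, ← h2, ← h3]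
  exact h4.symm

theorem posFun_const_mul (c : ℂ) {m : ℝ → ℂ} (hm : IsBoundedContinuous m) :
    posFun (fun x => c * m x) = c • posFun m := by
  refine ContinuousLinearMap.ext fun ψ => ext_ae ?_
  filter_upwards [posFun_apply (hm.const_mul c).memLp ψ, posFun_apply hm.memLp ψ,
    Lp.coeFn_smul c (posFun m ψ)] with x h1 h2 h3
  rw [h1, mul_assoc, ← h2]
  exact h3.symm

theorem posFun_one : posFun (fun _ => 1) = 1 := by
  refine ContinuousLinearMap.ext fun ψ => ext_ae ?_
  filter_upwards [posFun_apply (IsBoundedContinuous.const 1).memLp ψ] with x h1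
  rw [h1, one_mul]
  rfl

theorem star_posFun {m : ℝ → ℂ} (hm : IsBoundedContinuous m) :
    star (posFun m) = posFun fun x => starRingEnd ℂ (m x) := by
  rw [ContinuousLinearMap.star_eq_adjoint, eq_comm, ContinuousLinearMap.eq_adjoint_iff]
  intro ψ χ
  rw [L2.inner_def, L2.inner_def]
  refine integral_congr_ae ?_
  filter_upwards [posFun_apply hm.star.memLp ψ, posFun_apply hm.memLp χ] with x h1 h2
  rw [h1, h2]
  simp only [RCLike.inner_apply, map_mul, Complex.conj_conj]
  ring

theorem norm_posFun_le {m : ℝ → ℂ} (hm : IsBoundedContinuous m) {C : ℝ} (hC : ∀ x, ‖m x‖ ≤ C) :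
    ‖posFun m‖ ≤ C := by
  refine ContinuousLinearMap.opNorm_le_bound _ ((norm_nonneg _).trans (hC 0)) fun ψ => ?_
  refine Lp.norm_le_mul_norm_of_ae_le_mul ?_
  filter_upwards [posFun_apply hm.memLp ψ] with x h1
  rw [h1, norm_mul]
  gcongr
  exact hC x

/-- The operator norm is bounded by the supremum of the symbol, so differentiability in norm
requires difference quotients converging uniformly in `x`; this is where uniform continuity of `m'`
enters. -/
theorem hasDerivAt_posFun_translate {m m' : ℝ → ℂ} (hm : IsBoundedContinuous m)
    (hm' : IsBoundedContinuous m') (hu : UniformContinuous m')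
    (hd : ∀ x, HasDerivAt m (m' x) x) :
    HasDerivAt (fun s => posFun fun x => m (x + s)) (posFun m') 0 := by
  rw [hasDerivAt_iff_isLittleO, Asymptotics.isLittleO_iff]
  intro c hc
  obtain ⟨δ, hδ, hδ'⟩ := Metric.uniformContinuous_iff.1 hu c hc
  filter_upwards [Metric.ball_mem_nhds (0 : ℝ) hδ] with s hs
  rw [mem_ball_zero_iff, Real.norm_eq_abs] at hs
  have h1 : posFun (fun x => m (x + s)) - posFun (fun x => m (x + 0)) - (s - 0) • posFun m'
      = posFun fun x => m (x + s) + ((-1 : ℂ) * m x + (-s : ℂ) * m' x) := by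
    rw [posFun_add (hm.comp (by fun_prop)) ((hm.const_mul _).add (hm'.const_mul _)),
      posFun_add (hm.const_mul _) (hm'.const_mul _), posFun_const_mul _ hm, posFun_const_mul _ hm']
    simp only [add_zero, sub_zero, neg_smul, one_smul, Complex.coe_smul]
    abel
  rw [h1]
  refine norm_posFun_le ((hm.comp (by fun_prop)).add ((hm.const_mul _).add (hm'.const_mul _)))
    fun x => ?_
  -- Mean value inequality for `y ↦ m y - y m'(x)`, whose derivative is at most `c` in norm on the
  -- ball of radius `δ` about `x`.
  have key := Convex.norm_image_sub_le_of_norm_hasDerivWithin_le (s := Metric.ball x δ)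
    (f := fun y => m y - y * m' x) (f' := fun y => m' y - m' x) (C := c) (x := x) (y := x + s)
    (fun y _ => by
      have := (hd y).sub ((hasDerivAt_id y).ofReal_comp.mul_const (m' x))
      simpa using! this.hasDerivWithinAt)
    (fun y hy => by
      have := hδ' (Metric.mem_ball.1 hy)
      rw [dist_eq_norm] at this
      exact this.le)
    (convex_ball x δ) (Metric.mem_ball_self hδ) (by simpa [Real.dist_eq] using hs)
  calc _ = ‖m (x + s) - ((x + s : ℝ) : ℂ) * m' x - (m x - x * m' x)‖ := by
        congr 1; push_cast; ring
    _ ≤ c * ‖x + s - x‖ := key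
    _ = c * ‖s - 0‖ := by simp

end Multiplication

/-! ### The phase group and its generator -/

section MultiplicationGenerator

/-- A Schwartz function, as an element of `L²`. -/
def ofSchwartz (f : SchwartzMap ℝ ℂ) : H := f.toLp 2 volume

theorem ofSchwartz_apply (f : SchwartzMap ℝ ℂ) : ∀ᵐ x : ℝ, ofSchwartz f x = f x :=
  f.coeFn_toLp 2 volume

theorem denseRange_ofSchwartz : DenseRange ofSchwartz :=
  SchwartzMap.denseRange_toLpCLM (E := ℝ) (F := ℂ) (p := 2) (μ := volume) ENNReal.ofNat_ne_top

theorem norm_sq_eq_integral (ψ : H) : ‖ψ‖ ^ 2 = ∫ x, ‖ψ x‖ ^ 2 := by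
  have h := L2.inner_def (𝕜 := ℂ) ψ ψ
  rw [inner_self_eq_norm_sq_to_K] at h
  have h2 : ∀ x, ⟪ψ x, ψ x⟫_ℂ = ((‖ψ x‖ ^ 2 : ℝ) : ℂ) := fun x => by
    rw [inner_self_eq_norm_sq_to_K]; norm_cast
  simp_rw [h2] at h
  rw [integral_complex_ofReal] at h
  exact Complex.ofReal_injective (by simpa using h)

theorem tendsto_of_dominated {F : ℝ → H} {G : H} {l : Filter ℝ} [l.IsCountablyGenerated]
    {f : ℝ → ℝ → ℂ} {B : ℝ → ℝ} (hF : ∀ s, ∀ᵐ x, F s x - G x = f s x) (hB : MemLp B 2 volume)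
    (hfB : ∀ s, ∀ᵐ x, ‖f s x‖ ≤ B x)
    (hlim : ∀ x, Tendsto (fun s => f s x) l (𝓝 0)) : Tendsto F l (𝓝 G) := by
  rw [tendsto_iff_norm_sub_tendsto_zero]
  have h1 : Tendsto (fun s => ∫ x, ‖f s x‖ ^ 2) l (𝓝 (∫ _ : ℝ, (0 : ℝ))) := by
    refine tendsto_integral_filter_of_dominated_convergence (fun x => B x ^ 2) ?_ ?_ ?_ ?_
    · exact Eventually.of_forall fun s =>
        ((((Lp.aestronglyMeasurable (F s)).sub (Lp.aestronglyMeasurable G)).congr (hF s)).norm.pow 2)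
    · refine Eventually.of_forall fun s => ?_
      filter_upwards [hfB s] with x hx
      rw [Real.norm_of_nonneg (by positivity)]
      gcongr
    · exact hB.integrable_sq
    · exact Eventually.of_forall fun x => by simpa using (hlim x).norm.pow 2
  have h2 : ∀ s, ‖F s - G‖ = √(∫ x, ‖f s x‖ ^ 2) := by
    intro s
    rw [← Real.sqrt_sq (norm_nonneg (F s - G)), norm_sq_eq_integral]
    congr 1
    refine integral_congr_ae ?_
    filter_upwards [Lp.coeFn_sub (F s) G, hF s] with x hx hx'
    rw [hx, Pi.sub_apply, hx']
  simp_rw [h2]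
  simpa using h1.sqrt

/-- The unitary group `exp (is c q)`. -/
def phaseGroup (c s : ℝ) : H →L[ℂ] H := posFun fun x => Complex.exp (Complex.I * (s * c : ℝ) * x)

theorem phaseGroup_apply (c s : ℝ) (ψ : H) :
    ∀ᵐ x : ℝ, phaseGroup c s ψ x = Complex.exp (Complex.I * (s * c : ℝ) * x) * ψ x :=
  posFun_apply (IsBoundedContinuous.exp_mul_I _).memLp ψ

theorem phaseGroup_add (c s t : ℝ) : phaseGroup c (s + t) = phaseGroup c s * phaseGroup c t := by
  rw [phaseGroup, phaseGroup, phaseGroup,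
    ← posFun_mul (IsBoundedContinuous.exp_mul_I _) (IsBoundedContinuous.exp_mul_I _)]
  congr 1
  funext x
  rw [← Complex.exp_add]
  congr 1
  push_cast
  ring

theorem phaseGroup_zero (c : ℝ) : phaseGroup c 0 = 1 := by
  rw [← posFun_one, phaseGroup]
  simp

theorem hasDerivAt_phase (a x : ℝ) :
    HasDerivAt (fun s : ℝ => Complex.exp (Complex.I * (s * a : ℝ) * x))
      (Complex.I * ((a * x : ℝ) : ℂ)) 0 := by
  have h1 : HasDerivAt (fun s : ℝ => Complex.I * (s * a : ℝ) * x) (Complex.I * (a : ℝ) * x) 0 := by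
    have := (((hasDerivAt_id (0 : ℝ)).mul_const a).ofReal_comp.const_mul Complex.I).mul_const
      (x : ℂ)
    simpa using this
  have := h1.cexp
  simp only [zero_mul, Complex.ofReal_zero, mul_zero, Complex.exp_zero, one_mul] at this
  convert this using 1
  push_cast; ring

theorem diffQuot_phaseGroup (c s : ℝ) (ψ : H) :
    ∀ᵐ x : ℝ, ((s : ℂ)⁻¹ • (phaseGroup c s ψ - phaseGroup c 0 ψ) : H) x =
      (s : ℂ)⁻¹ * (Complex.exp (Complex.I * (s * c : ℝ) * x) - 1) * ψ x := by
  have h := Lp.coeFn_smul ((s : ℂ)⁻¹) (phaseGroup c s ψ - ψ)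
  filter_upwards [h, Lp.coeFn_sub (phaseGroup c s ψ) ψ, phaseGroup_apply c s ψ] with x h1 h2 h3
  have h0 : phaseGroup c 0 ψ = ψ := by rw [phaseGroup_zero]; rfl
  rw [h0, h1, Pi.smul_apply, h2, Pi.sub_apply, h3, smul_eq_mul]
  ring

theorem norm_diffQuot_phase_le (c s x : ℝ) :
    ‖(s : ℂ)⁻¹ * (Complex.exp (Complex.I * (s * c : ℝ) * x) - 1)‖ ≤ |c * x| := by
  have h := Real.norm_exp_I_mul_ofReal_sub_one_le (x := s * (c * x))
  rw [show Complex.I * (s * c : ℝ) * x = Complex.I * ((s * (c * x) : ℝ) : ℂ) by push_cast; ring,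
    norm_mul]
  rcases eq_or_ne s 0 with rfl | hs
  · simpa using mul_nonneg (abs_nonneg c) (abs_nonneg x)
  · calc _ ≤ ‖(s : ℂ)⁻¹‖ * ‖s * (c * x)‖ := by gcongr
      _ = |c * x| := by
        rw [norm_mul, ← mul_assoc, norm_inv, Complex.norm_real, inv_mul_cancel₀ (by simpa using hs)]
        simp

theorem tendsto_diffQuot_phase (c x : ℝ) :
    Tendsto (fun s : ℝ => (s : ℂ)⁻¹ * (Complex.exp (Complex.I * (s * c : ℝ) * x) - 1)) (𝓝[≠] 0)
      (𝓝 (Complex.I * ((c * x : ℝ) : ℂ))) := by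
  have := hasDerivAt_zero_iff_tendsto.1 (hasDerivAt_phase c x)
  simpa using this

theorem mem_domain_mulOp {m : ℝ → ℂ} {ψ : H} :
    ψ ∈ (mulOp m).domain ↔ MemLp (fun x => m x * ψ x) 2 volume := Iff.rfl

theorem mulOp_apply {m : ℝ → ℂ} {ψ : H} (h : ψ ∈ (mulOp m).domain) :
    ∀ᵐ x : ℝ, mulOp m ⟨ψ, h⟩ x = m x * ψ x := MemLp.coeFn_toLp (mem_domain_mulOp.1 h)

/-- If `cxψ` is in `L²`, dominated convergence gives the derivative. Conversely, `L²` convergence of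
the quotients gives a.e. convergence along a subsequence, which identifies the limit with `icxψ` and
so puts `ψ` in the domain. Schwartz functions supply the density. -/
theorem isGenerator_mulOp (c : ℝ) :
    IsGenerator (mulOp fun x => ((c * x : ℝ) : ℂ)) (phaseGroup c) where
  zero := phaseGroup_zero c
  mul_neg s := by rw [← phaseGroup_add, add_neg_cancel, phaseGroup_zero]
  star_eq s := by
    rw [phaseGroup, star_posFun (IsBoundedContinuous.exp_mul_I _), phaseGroup]
    congr 1
    funext x
    rw [← Complex.exp_conj]
    simp
  apply_iff ψ χ := by
    constructor
    · rintro ⟨h, rfl⟩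
      rw [hasDerivAt_zero_iff_tendsto]
      have hI := Lp.coeFn_smul Complex.I (mulOp (fun x => ((c * x : ℝ) : ℂ)) ⟨ψ, h⟩)
      -- The quotient and its limit are each bounded by `|cx|`, hence the factor `2`.
      have hB : MemLp (fun x => 2 * ‖((c * x : ℝ) : ℂ) * ψ x‖) 2 volume :=
        ((mem_domain_mulOp.1 h).norm.const_mul 2)
      refine tendsto_of_dominated (f := fun s x =>
        ((s : ℂ)⁻¹ * (Complex.exp (Complex.I * (s * c : ℝ) * x) - 1)
          - Complex.I * ((c * x : ℝ) : ℂ)) * ψ x) (fun s => ?_) hB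
        (fun s => Eventually.of_forall fun x => ?_) fun x => ?_
      · filter_upwards [diffQuot_phaseGroup c s ψ, hI, mulOp_apply h] with x h1 h2 h3
        rw [h1, h2, Pi.smul_apply, h3, smul_eq_mul]
        ring
      · rw [norm_mul, norm_mul, ← mul_assoc, two_mul, Complex.norm_real, Real.norm_eq_abs]
        gcongr
        refine (norm_sub_le _ _).trans (add_le_add (norm_diffQuot_phase_le c s x) ?_)
        rw [norm_mul, Complex.norm_I, one_mul, Complex.norm_real, Real.norm_eq_abs]
      · simpa using ((tendsto_diffQuot_phase c x).sub_const (Complex.I * ((c * x : ℝ) : ℂ))).mul_const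
          (ψ x)
    · intro h
      rw [hasDerivAt_zero_iff_tendsto] at h
      have hseq : Tendsto (fun n : ℕ => ((n : ℝ) + 1)⁻¹) atTop (𝓝[≠] 0) := by
        refine tendsto_nhdsWithin_iff.2 ⟨?_, Eventually.of_forall fun n => ?_⟩
        · simpa using tendsto_one_div_add_atTop_nhds_zero_nat (𝕜 := ℝ)
        · have : (n : ℝ) + 1 ≠ 0 := by positivity
          simpa using this
      obtain ⟨ns, hns, hns'⟩ := (tendstoInMeasure_of_tendsto_Lp (h.comp hseq)).exists_seq_tendsto_ae
      have hall := ae_all_iff.2 fun n : ℕ => diffQuot_phaseGroup c (((n : ℝ) + 1)⁻¹) ψ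
      have hχ : ∀ᵐ x : ℝ, χ x = ((c * x : ℝ) : ℂ) * ψ x := by
        filter_upwards [hns', hall, Lp.coeFn_smul Complex.I χ] with x h1 h2 h3
        simp only [Function.comp_apply, h2] at h1
        have h4 := ((tendsto_diffQuot_phase c x).mul_const (ψ x)).comp
          (hseq.comp hns.tendsto_atTop)
        have h5 := tendsto_nhds_unique h1 h4
        rw [h3, Pi.smul_apply, smul_eq_mul, mul_assoc] at h5
        exact mul_left_cancel₀ Complex.I_ne_zero h5
      have hdom : ψ ∈ (mulOp fun x => ((c * x : ℝ) : ℂ)).domain :=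
        mem_domain_mulOp.2 ((Lp.memLp χ).ae_eq hχ)
      refine ⟨hdom, ext_ae ?_⟩
      filter_upwards [mulOp_apply hdom, hχ] with x h1 h2
      rw [h1, h2]
  dense_sq := by
    refine denseRange_ofSchwartz.mono ?_
    have key : ∀ f : SchwartzMap ℝ ℂ, ∃ g : SchwartzMap ℝ ℂ,
        ∃ h : ofSchwartz f ∈ (mulOp fun x => ((c * x : ℝ) : ℂ)).domain,
        mulOp (fun x => ((c * x : ℝ) : ℂ)) ⟨ofSchwartz f, h⟩ = ofSchwartz g := by
      intro f
      have ht : (fun x : ℝ => ((c * x : ℝ) : ℂ)).HasTemperateGrowth := by fun_prop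
      let g : SchwartzMap ℝ ℂ := SchwartzMap.smulLeftCLM ℂ (fun x : ℝ => ((c * x : ℝ) : ℂ)) f
      have hgx : ∀ x, g x = ((c * x : ℝ) : ℂ) * f x := SchwartzMap.smulLeftCLM_apply_apply ht f
      have hg : ∀ᵐ x : ℝ, ofSchwartz g x = ((c * x : ℝ) : ℂ) * ofSchwartz f x := by
        filter_upwards [ofSchwartz_apply f, ofSchwartz_apply g] with x h1 h2
        rw [h1, h2, hgx]
      have hd := mem_domain_mulOp.2 ((Lp.memLp _).ae_eq hg)
      refine ⟨g, hd, ext_ae ?_⟩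
      filter_upwards [mulOp_apply hd, hg] with x h1 h2
      rw [h1, h2]
    rintro _ ⟨f, rfl⟩
    obtain ⟨g, h, hg⟩ := key f
    obtain ⟨_, h', -⟩ := key g
    exact ⟨h, hg ▸ h'⟩

end MultiplicationGenerator

/-! ### Affine changes of variable -/

section Affine

theorem map_affine_volume {a : ℝ} (ha : a ≠ 0) (b : ℝ) :
    Measure.map (fun x => a * x + b) (volume : Measure ℝ) = ENNReal.ofReal |a⁻¹| • volume := by
  have h : (fun x : ℝ => a * x + b) = (fun x => x + b) ∘ fun x => a * x := rfl
  rw [h, ← Measure.map_map (measurable_add_const b) (measurable_const_mul a),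
    Real.map_volume_mul_left ha, Measure.map_smul, map_add_right_eq_self]

theorem quasiMeasurePreserving_affine {a : ℝ} (ha : a ≠ 0) (b : ℝ) :
    Measure.QuasiMeasurePreserving (fun x : ℝ => a * x + b) volume volume := by
  refine ⟨by fun_prop, ?_⟩
  rw [map_affine_volume ha]
  exact Measure.smul_absolutelyContinuous

theorem memLp_comp_affine {a : ℝ} (ha : a ≠ 0) (b : ℝ) (ψ : H) :
    MemLp (fun x => ψ (a * x + b)) 2 volume := by
  have h : MemLp ψ 2 (Measure.map (fun x => a * x + b) (volume : Measure ℝ)) := by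
    rw [map_affine_volume ha]
    exact (Lp.memLp ψ).smul_measure ENNReal.ofReal_ne_top
  exact h.comp_of_map (by fun_prop)

theorem memLp_affine {a : ℝ} (ha : a ≠ 0) (b : ℝ) (ψ : H) :
    MemLp (fun x => (√|a| : ℂ) * ψ (a * x + b)) 2 volume :=
  (memLp_comp_affine ha b ψ).const_mul _

/-- The unitary change of variables `ψ ↦ √|a| ψ(a x + b)`. -/
def affineOp (a b : ℝ) (ha : a ≠ 0) : H →L[ℂ] H :=
  LinearMap.mkContinuous
    { toFun := fun ψ => (memLp_affine ha b ψ).toLp _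
      map_add' := fun ψ χ => by
        refine ext_ae ?_
        filter_upwards [(memLp_affine ha b (ψ + χ)).coeFn_toLp, (memLp_affine ha b ψ).coeFn_toLp,
          (memLp_affine ha b χ).coeFn_toLp,
          Lp.coeFn_add ((memLp_affine ha b ψ).toLp _) ((memLp_affine ha b χ).toLp _),
          (quasiMeasurePreserving_affine ha b).ae (Lp.coeFn_add ψ χ)] with x h1 h2 h3 h4 h5
        rw [h1, h4, Pi.add_apply, h2, h3, h5, Pi.add_apply, mul_add]
      map_smul' := fun c ψ => by
        refine ext_ae ?_
        filter_upwards [(memLp_affine ha b (c • ψ)).coeFn_toLp, (memLp_affine ha b ψ).coeFn_toLp,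
          Lp.coeFn_smul c ((memLp_affine ha b ψ).toLp _),
          (quasiMeasurePreserving_affine ha b).ae (Lp.coeFn_smul c ψ)] with x h1 h2 h3 h4
        rw [RingHom.id_apply, h1, h3, Pi.smul_apply, h2, h4, Pi.smul_apply, smul_eq_mul,
          smul_eq_mul]
        ring }
    1 fun ψ => by
      have h1 : ‖(memLp_affine ha b ψ).toLp _‖ ^ 2 = ‖ψ‖ ^ 2 := by
        rw [norm_sq_eq_integral, norm_sq_eq_integral]
        have e1 : ∫ x, ‖(memLp_affine ha b ψ).toLp _ x‖ ^ 2
            = ∫ x, |a| * ‖ψ (a * x + b)‖ ^ 2 := by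
          refine integral_congr_ae ?_
          filter_upwards [(memLp_affine ha b ψ).coeFn_toLp] with x h1
          rw [h1, norm_mul, mul_pow, Complex.norm_real, Real.norm_eq_abs, sq_abs,
            Real.sq_sqrt (abs_nonneg a)]
        have e2 := Measure.integral_comp_mul_left (fun y => ‖ψ (y + b)‖ ^ 2) a
        rw [e1, integral_const_mul, e2, integral_add_right_eq_self fun y => ‖ψ y‖ ^ 2, abs_inv,
          smul_eq_mul, ← mul_assoc, mul_inv_cancel₀ (by simpa using ha), one_mul]
      rw [one_mul]
      exact (abs_le_of_sq_le_sq' h1.le (norm_nonneg _)).2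

theorem affineOp_apply {a : ℝ} (ha : a ≠ 0) (b : ℝ) (ψ : H) :
    ∀ᵐ x : ℝ, affineOp a b ha ψ x = (√|a| : ℂ) * ψ (a * x + b) :=
  (memLp_affine ha b ψ).coeFn_toLp

theorem affineOp_mul_posFun {a : ℝ} (ha : a ≠ 0) (b : ℝ) {m : ℝ → ℂ}
    (hm : IsBoundedContinuous m) :
    affineOp a b ha * posFun m = posFun (fun x => m (a * x + b)) * affineOp a b ha := by
  refine ContinuousLinearMap.ext fun ψ => ext_ae ?_
  have hm' : IsBoundedContinuous fun x => m (a * x + b) := hm.comp (by fun_prop)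
  filter_upwards [affineOp_apply ha b (posFun m ψ), affineOp_apply ha b ψ,
    posFun_apply hm'.memLp (affineOp a b ha ψ),
    (quasiMeasurePreserving_affine ha b).ae (posFun_apply hm.memLp ψ)] with x h1 h2 h3 h4
  calc (affineOp a b ha * posFun m) ψ x = affineOp a b ha (posFun m ψ) x := rfl
    _ = posFun (fun x => m (a * x + b)) (affineOp a b ha ψ) x := by
      rw [h1, h3, h4, h2]; ring
    _ = _ := rfl

end Affine

/-! ### The momentum operator and translations -/

section Momentum

open FourierTransform in
theorem fourier_ofSchwartz (f : SchwartzMap ℝ ℂ) :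
    fourierCLM (ofSchwartz f) = ofSchwartz (𝓕 f) := SchwartzMap.toLp_fourier_eq f

theorem fourierCLM_mul_inv : fourierCLM * fourierInvCLM = 1 :=
  ContinuousLinearMap.ext fun ψ => fourier.apply_symm_apply ψ

theorem fourierInvCLM_mul : fourierInvCLM * fourierCLM = 1 :=
  ContinuousLinearMap.ext fun ψ => fourier.symm_apply_apply ψ

theorem star_fourierInvCLM : star fourierInvCLM = fourierCLM := by
  rw [ContinuousLinearMap.star_eq_adjoint, eq_comm, ContinuousLinearMap.eq_adjoint_iff]
  intro ψ χ
  have := fourier.inner_map_map ψ (fourier.symm χ)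
  rw [LinearIsometryEquiv.apply_symm_apply] at this
  exact this

theorem momFun_eq (m : ℝ → ℂ) :
    momFun m = fourierInvCLM * posFun (fun ξ => m (2 * Real.pi * ξ)) * fourierCLM := rfl

theorem momFun_mul {m n : ℝ → ℂ} (hm : IsBoundedContinuous m) (hn : IsBoundedContinuous n) :
    momFun (fun x => m x * n x) = momFun m * momFun n := by
  rw [momFun_eq, momFun_eq, momFun_eq,
    posFun_mul (hm.comp (φ := fun ξ => 2 * Real.pi * ξ) (by fun_prop)) (hn.comp (by fun_prop))]
  calc _ = fourierInvCLM * posFun (fun ξ => m (2 * Real.pi * ξ)) * 1 *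
        posFun (fun ξ => n (2 * Real.pi * ξ)) * fourierCLM := by simp only [mul_assoc, mul_one]
    _ = _ := by rw [← fourierCLM_mul_inv]; simp only [mul_assoc]

theorem isGenerator_q : IsGenerator q (phaseGroup 1) := by
  have := isGenerator_mulOp 1
  simp only [one_mul] at this
  exact this

theorem isGenerator_p :
    IsGenerator p fun s => momFun fun y => Complex.exp (Complex.I * s * y) := by
  have h := (isGenerator_mulOp (2 * Real.pi)).conj (R := fourierInvCLM)
    (by rw [star_fourierInvCLM, fourierInvCLM_mul])
    (by rw [star_fourierInvCLM, fourierCLM_mul_inv])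
  rw [star_fourierInvCLM] at h
  convert! h using 2 with s
  rw [momFun_eq, phaseGroup]
  congr 3
  funext ξ
  push_cast
  ring_nf

open FourierTransform in
-- A translation becomes a phase on the Fourier side. This is checked on Schwartz functions, where
-- the transform is an integral, and extended by density.
theorem momFun_exp_eq_affineOp (s : ℝ) :
    momFun (fun y => Complex.exp (Complex.I * s * y)) = affineOp 1 s one_ne_zero := by
  have key : posFun (fun ξ => Complex.exp (Complex.I * s * ((2 * Real.pi * ξ : ℝ) : ℂ))) * fourierCLM
      = fourierCLM * affineOp 1 s one_ne_zero := by
    have hb : IsBoundedContinuous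
        fun ξ => Complex.exp (Complex.I * s * ((2 * Real.pi * ξ : ℝ) : ℂ)) :=
      (IsBoundedContinuous.exp_mul_I s).comp (φ := fun ξ => 2 * Real.pi * ξ) (by fun_prop)
    refine ContinuousLinearMap.ext fun ψ => congrFun
      (denseRange_ofSchwartz.equalizer (ContinuousLinearMap.continuous _)
        (ContinuousLinearMap.continuous _) (funext fun f => ?_)) ψ
    have e1 : affineOp 1 s one_ne_zero (ofSchwartz f)
        = ofSchwartz (SchwartzMap.compSubConstCLM ℂ (-s) f) := by
      refine ext_ae ?_
      filter_upwards [affineOp_apply one_ne_zero s (ofSchwartz f), ofSchwartz_apply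
        (SchwartzMap.compSubConstCLM ℂ (-s) f), (quasiMeasurePreserving_affine one_ne_zero s).ae
        (ofSchwartz_apply f)] with x h1 h2 h3
      rw [h1, h2, h3]
      simp
    have e2 : ∀ ξ, (𝓕 (SchwartzMap.compSubConstCLM ℂ (-s) f)) ξ
        = Complex.exp (Complex.I * s * ((2 * Real.pi * ξ : ℝ) : ℂ)) * (𝓕 f) ξ := by
      intro ξ
      have := congrFun (VectorFourier.fourierIntegral_comp_add_right Real.fourierChar volume
        (innerₗ ℝ) f s) ξ
      have h3 : (f ∘ fun v => v + s) = SchwartzMap.compSubConstCLM ℂ (-s) f := by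
        funext v; simp
      rw [h3] at this
      refine Eq.trans this ?_
      rw [Circle.smul_def, Real.fourierChar_apply, smul_eq_mul]
      congr 1
      congr 1
      simp
      ring
    calc _ = posFun _ (fourierCLM (ofSchwartz f)) := rfl
      _ = fourierCLM (affineOp 1 s one_ne_zero (ofSchwartz f)) := by
        rw [e1, fourier_ofSchwartz, fourier_ofSchwartz]
        refine ext_ae ?_
        filter_upwards [posFun_apply hb.memLp (ofSchwartz (𝓕 f)), ofSchwartz_apply (𝓕 f),
          ofSchwartz_apply (𝓕 (SchwartzMap.compSubConstCLM ℂ (-s) f))] with x h1 h2 h3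
        rw [h1, h2, h3, e2]
      _ = _ := rfl
  rw [momFun_eq, mul_assoc, key, ← mul_assoc, fourierInvCLM_mul, one_mul]

theorem momFun_exp_mul_posFun (s : ℝ) {m : ℝ → ℂ} (hm : IsBoundedContinuous m) :
    momFun (fun y => Complex.exp (Complex.I * s * y)) * posFun m =
      posFun (fun x => m (x + s)) * momFun (fun y => Complex.exp (Complex.I * s * y)) := by
  rw [momFun_exp_eq_affineOp, affineOp_mul_posFun one_ne_zero s hm]
  simp only [one_mul]

end Momentum

/-! ### Hermite functions as eigenfunctions of the Fourier transform -/

section Hermite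

/-- The inequality `yᵏ / k! ≤ exp y` at `y = x²/2` controls `|x|^(2k)`; the summand `1` pays for
`|x|ᵏ ≤ 1 + |x|^(2k)`. -/
theorem pow_mul_gaussian_le (k : ℕ) (x : ℝ) :
    |x| ^ k * Real.exp (-x ^ 2 / 2) ≤ 1 + 2 ^ k * k.factorial := by
  have hexp : Real.exp (-x ^ 2 / 2) ≤ 1 := Real.exp_le_one_iff.2 (by nlinarith [sq_nonneg x])
  have h1 : (x ^ 2 / 2) ^ k / k.factorial ≤ Real.exp (x ^ 2 / 2) :=
    Real.pow_div_factorial_le_exp _ (by positivity) k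
  have h2 : |x| ^ (2 * k) * Real.exp (-x ^ 2 / 2) ≤ 2 ^ k * k.factorial := by
    rw [neg_div, Real.exp_neg, ← div_eq_mul_inv, div_le_iff₀ (Real.exp_pos _), pow_mul, sq_abs]
    rw [div_le_iff₀ (by positivity), div_pow, div_le_iff₀ (by positivity)] at h1
    linarith
  have h3 : |x| ^ k ≤ 1 + |x| ^ (2 * k) := by
    rcases le_total |x| 1 with h | h
    · have : |x| ^ k ≤ 1 := pow_le_one₀ (abs_nonneg x) h
      have : 0 ≤ |x| ^ (2 * k) := by positivity
      linarith
    · have : |x| ^ k ≤ |x| ^ (2 * k) := pow_le_pow_right₀ h (by omega)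
      linarith
  calc |x| ^ k * Real.exp (-x ^ 2 / 2) ≤ (1 + |x| ^ (2 * k)) * Real.exp (-x ^ 2 / 2) := by gcongr
    _ = Real.exp (-x ^ 2 / 2) + |x| ^ (2 * k) * Real.exp (-x ^ 2 / 2) := by ring
    _ ≤ _ := add_le_add hexp h2

theorem exists_poly_mul_gaussian_le (P : Polynomial ℝ) :
    ∃ C, ∀ x : ℝ, |P.eval x| * Real.exp (-x ^ 2 / 2) ≤ C := by
  induction P using Polynomial.induction_on' with
  | add P Q hP hQ =>
    obtain ⟨C, hC⟩ := hP
    obtain ⟨D, hD⟩ := hQ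
    refine ⟨C + D, fun x => ?_⟩
    calc _ ≤ (|P.eval x| + |Q.eval x|) * Real.exp (-x ^ 2 / 2) := by
          rw [Polynomial.eval_add]; gcongr; exact abs_add_le _ _
      _ ≤ _ := by rw [add_mul]; exact add_le_add (hC x) (hD x)
  | monomial n c =>
    refine ⟨|c| * (1 + 2 ^ n * n.factorial), fun x => ?_⟩
    rw [Polynomial.eval_monomial, abs_mul, abs_pow, mul_assoc]
    gcongr
    exact pow_mul_gaussian_le n x

theorem hasDerivAt_poly_mul_gaussian (P : Polynomial ℝ) (x : ℝ) :
    HasDerivAt (fun x => P.eval x * Real.exp (-x ^ 2 / 2))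
      ((Polynomial.derivative P - Polynomial.X * P).eval x * Real.exp (-x ^ 2 / 2)) x := by
  have h2 : HasDerivAt (fun y : ℝ => Real.exp (-y ^ 2 / 2)) (Real.exp (-x ^ 2 / 2) * (-x)) x := by
    have := (((hasDerivAt_pow 2 x).neg).div_const 2).exp
    convert! this using 1
    simp; ring
  refine ((P.hasDerivAt x).mul h2).congr_deriv ?_
  simp only [Polynomial.eval_sub, Polynomial.eval_mul, Polynomial.eval_X]
  ring

theorem exists_iteratedDeriv_gaussian (n : ℕ) : ∃ P : Polynomial ℝ,
    iteratedDeriv n (fun x : ℝ => ((Real.exp (-x ^ 2 / 2) : ℝ) : ℂ)) =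
      fun x => ((P.eval x * Real.exp (-x ^ 2 / 2) : ℝ) : ℂ) := by
  induction n with
  | zero => exact ⟨1, by simp⟩
  | succ n ih =>
    obtain ⟨P, hP⟩ := ih
    refine ⟨Polynomial.derivative P - Polynomial.X * P, ?_⟩
    rw [iteratedDeriv_succ, hP]
    funext x
    exact (hasDerivAt_poly_mul_gaussian P x).ofReal_comp.deriv

/-- The Gaussian `exp (-x²/2)` as a Schwartz function. -/
def schwartzGaussian : SchwartzMap ℝ ℂ where
  toFun x := ((Real.exp (-x ^ 2 / 2) : ℝ) : ℂ)
  smooth' := Complex.ofRealCLM.contDiff.comp (show ContDiff ℝ _ fun x : ℝ => Real.exp (-x ^ 2 / 2) by fun_prop)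
  decay' k n := by
    obtain ⟨P, hP⟩ := exists_iteratedDeriv_gaussian n
    obtain ⟨C, hC⟩ := exists_poly_mul_gaussian_le (Polynomial.X ^ k * P)
    refine ⟨C, fun x => ?_⟩
    rw [norm_iteratedFDeriv_eq_norm_iteratedDeriv, hP, Complex.norm_real, norm_mul]
    refine le_trans (le_of_eq ?_) (hC x)
    rw [Real.norm_of_nonneg (Real.exp_nonneg _), Real.norm_eq_abs, Real.norm_eq_abs,
      Polynomial.eval_mul, abs_mul, Polynomial.eval_pow, Polynomial.eval_X, abs_pow, mul_assoc]

/-- The unnormalised Hermite functions `Heₙ(√2 x) exp (-x²/2)`, through the recursion given by the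
creation operator. -/
def schwartzHermite : ℕ → SchwartzMap ℝ ℂ
  | 0 => schwartzGaussian
  | n + 1 => (((√2)⁻¹ : ℝ) : ℂ) • (SchwartzMap.smulLeftCLM ℂ (fun x : ℝ => (x : ℂ))
      (schwartzHermite n) - SchwartzMap.derivCLM ℂ ℂ (schwartzHermite n))

theorem hasTemperateGrowth_ofReal : (fun x : ℝ => (x : ℂ)).HasTemperateGrowth := by fun_prop

theorem schwartzHermite_succ_apply (n : ℕ) (x : ℝ) :
    schwartzHermite (n + 1) x = (((√2)⁻¹ : ℝ) : ℂ) *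
      (x * schwartzHermite n x - deriv (schwartzHermite n) x) := by
  simp [schwartzHermite, SchwartzMap.smulLeftCLM_apply_apply hasTemperateGrowth_ofReal]

theorem schwartzHermite_apply (n : ℕ) (x : ℝ) :
    schwartzHermite n x = (((herm n).eval (√2 * x) * Real.exp (-x ^ 2 / 2) : ℝ) : ℂ) := by
  induction n generalizing x with
  | zero => simp [schwartzHermite, schwartzGaussian, herm_zero]; rfl
  | succ n ih =>
    let Q : Polynomial ℝ := (herm n).comp (Polynomial.C √2 * Polynomial.X)
    have hQ : ⇑(schwartzHermite n) = fun x => ((Q.eval x * Real.exp (-x ^ 2 / 2) : ℝ) : ℂ) := by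
      funext y; rw [ih]; simp [Q]
    have h2 : √2 * √2 = 2 := Real.mul_self_sqrt (by norm_num)
    have h0 : √2 ≠ 0 := by positivity
    rw [schwartzHermite_succ_apply, hQ, (hasDerivAt_poly_mul_gaussian Q x).ofReal_comp.deriv]
    rw [← Complex.ofReal_mul, ← Complex.ofReal_sub, ← Complex.ofReal_mul]
    congr 1
    rw [herm_succ]
    simp only [Q, Polynomial.derivative_comp, Polynomial.eval_sub, Polynomial.eval_mul,
      Polynomial.eval_comp, Polynomial.eval_X, Polynomial.eval_C, Polynomial.derivative_mul,
      Polynomial.derivative_C, Polynomial.derivative_X, Polynomial.eval_add, Polynomial.eval_zero,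
      Polynomial.eval_one]
    field_simp
    linear_combination (- (herm n).eval (√2 * x) * x) * h2

theorem fock_eq (n : ℕ) :
    fock n = (((√(√Real.pi * n.factorial))⁻¹ : ℝ) : ℂ) • ofSchwartz (schwartzHermite n) := by
  refine ext_ae ?_
  filter_upwards [(memLp_hermiteFun n).coeFn_toLp, ofSchwartz_apply (schwartzHermite n),
    Lp.coeFn_smul (((√(√Real.pi * n.factorial))⁻¹ : ℝ) : ℂ) (ofSchwartz (schwartzHermite n))]
    with x h1 h2 h3
  rw [fock, h1, h3, Pi.smul_apply, h2, schwartzHermite_apply, hermiteFun, aeval_hermite]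
  push_cast
  rfl

open FourierTransform in
-- The Fourier transform exchanges multiplication by `x` and differentiation, so in the variable
-- `2πξ` it maps the creation operator `x - d/dx` to `-i` times itself. Induction starts from the
-- Gaussian.
theorem fourier_schwartzHermite (n : ℕ) (ξ : ℝ) :
    (𝓕 (schwartzHermite n)) ξ = (-Complex.I) ^ n * √(2 * Real.pi) *
      schwartzHermite n (2 * Real.pi * ξ) := by
  induction n generalizing ξ with
  | zero =>
    have h := congrFun (fourier_gaussian_pi (b := (((2 * Real.pi)⁻¹ : ℝ) : ℂ))
      (by rw [Complex.ofReal_re]; positivity)) ξ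
    have e1 : (fun x : ℝ => Complex.exp (-Real.pi * (((2 * Real.pi)⁻¹ : ℝ) : ℂ) * x ^ 2))
        = schwartzHermite 0 := by
      funext x
      rw [schwartzHermite_apply, herm_zero, Polynomial.eval_one, one_mul, Complex.ofReal_exp]
      congr 1
      push_cast
      have : (Real.pi : ℂ) ≠ 0 := by exact_mod_cast Real.pi_ne_zero
      field_simp
    rw [e1] at h
    refine Eq.trans h ?_
    rw [schwartzHermite_apply, herm_zero, Polynomial.eval_one, one_mul, pow_zero, one_mul,
      Complex.ofReal_exp]
    have e2 : (1 : ℂ) / (((2 * Real.pi)⁻¹ : ℝ) : ℂ) ^ (1 / 2 : ℂ) = √(2 * Real.pi) := by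
      have : ((1 / 2 : ℝ) : ℂ) = 1 / 2 := by push_cast; rfl
      rw [← this, ← Complex.ofReal_cpow (by positivity), ← Real.sqrt_eq_rpow, Real.sqrt_inv]
      push_cast
      rw [one_div, inv_inv]
    rw [e2]
    congr 2
    push_cast
    have : (Real.pi : ℂ) ≠ 0 := by exact_mod_cast Real.pi_ne_zero
    field_simp
  | succ n ih =>
    set G := schwartzHermite n with hG
    let c : ℂ := (-Complex.I) ^ n * √(2 * Real.pi)
    have hFG : ⇑(𝓕 G : SchwartzMap ℝ ℂ) = fun ξ => c * G (2 * Real.pi * ξ) := funext ih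
    have hx : ∀ ξ, 𝓕 (fun x : ℝ => (x : ℂ) * G x) ξ = Complex.I * c * deriv G (2 * Real.pi * ξ) := by
      intro ξ
      have hxint : Integrable fun x : ℝ => x • G x := by
        have := (SchwartzMap.smulLeftCLM ℂ (fun x : ℝ => (x : ℂ)) G).integrable (μ := volume)
        refine this.congr (Eventually.of_forall fun x => ?_)
        rw [SchwartzMap.smulLeftCLM_apply_apply hasTemperateGrowth_ofReal]
        simp
      have h1 := congrFun (Real.deriv_fourier G.integrable hxint) ξ
      have h2 : 𝓕 (fun x : ℝ => (-2 * Real.pi * Complex.I * x) • G x) ξ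
          = (-2 * Real.pi * Complex.I) * 𝓕 (fun x : ℝ => (x : ℂ) * G x) ξ := by
        rw [Real.fourier_real_eq, Real.fourier_real_eq, ← integral_const_mul]
        congr 1
        funext v
        simp only [Circle.smul_def, smul_eq_mul]
        ring
      have h3 : HasDerivAt (fun ξ => c * G (2 * Real.pi * ξ))
          (c * ((2 * Real.pi : ℝ) • deriv G (2 * Real.pi * ξ))) ξ := by
        have := HasDerivAt.scomp ξ (h := fun ξ : ℝ => 2 * Real.pi * ξ)
          ((G.differentiable.differentiableAt).hasDerivAt)
          ((hasDerivAt_id ξ).const_mul (2 * Real.pi))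
        simpa [Function.comp_def] using this.const_mul c
      have h4 : deriv (𝓕 (G : ℝ → ℂ)) ξ = c * ((2 * Real.pi : ℝ) • deriv G (2 * Real.pi * ξ)) := by
        have h5 : 𝓕 (G : ℝ → ℂ) = fun ξ => c * G (2 * Real.pi * ξ) := hFG
        rw [h5]
        exact h3.deriv
      rw [h4, h2] at h1
      have hpi : (Real.pi : ℂ) ≠ 0 := by exact_mod_cast Real.pi_ne_zero
      have h6 : (2 * Real.pi * Complex.I) * 𝓕 (fun x : ℝ => (x : ℂ) * G x) ξ
          = (2 * Real.pi * Complex.I) * (Complex.I * c * deriv G (2 * Real.pi * ξ)) := by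
        rw [Complex.real_smul] at h1
        push_cast at h1
        linear_combination h1 - (2 * Real.pi * c * deriv G (2 * Real.pi * ξ)) * Complex.I_sq
      exact mul_left_cancel₀ (by simp [hpi]) h6
    have hd : ∀ ξ, 𝓕 (deriv G) ξ = 2 * Real.pi * Complex.I * ξ * (c * G (2 * Real.pi * ξ)) := by
      intro ξ
      have hdint : Integrable (deriv G) := (SchwartzMap.derivCLM ℂ ℂ G).integrable
      have h1 := congrFun (Real.fourier_deriv G.integrable G.differentiable hdint) ξ
      rw [h1, smul_eq_mul]
      congr 1
      exact ih ξ
    have hlin : (𝓕 (schwartzHermite (n + 1))) ξ = (((√2)⁻¹ : ℝ) : ℂ) *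
        (𝓕 (fun x : ℝ => (x : ℂ) * G x) ξ - 𝓕 (deriv G) ξ) := by
      have e1 : 𝓕 (fun x : ℝ => (x : ℂ) * G x)
          = 𝓕 (SchwartzMap.smulLeftCLM ℂ (fun x : ℝ => (x : ℂ)) G) := by
        rw [SchwartzMap.fourier_coe]
        congr 1
        funext x
        rw [SchwartzMap.smulLeftCLM_apply_apply hasTemperateGrowth_ofReal, smul_eq_mul]
      have e2 : 𝓕 (deriv G) = 𝓕 (SchwartzMap.derivCLM ℂ ℂ G) := by
        rw [SchwartzMap.fourier_coe]; rfl
      rw [e1, e2, schwartzHermite, FourierSMul.fourier_smul, sub_eq_add_neg,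
        FourierTransform.fourier_add, FourierTransform.fourier_neg]
      simp [sub_eq_add_neg, mul_add, G]
    rw [hlin, hx, hd, schwartzHermite_succ_apply]
    push_cast
    simp only [c, pow_succ]
    ring

end Hermite

/-! ### Completeness of the Hermite functions -/

section Completeness

/-- By `X Heₙ = Heₙ₊₁ + n Heₙ₋₁` the span is stable under multiplication by `X`, and it contains
`1`. -/
theorem span_range_herm : Submodule.span ℝ (Set.range herm) = ⊤ := by
  have hX : ∀ P ∈ Submodule.span ℝ (Set.range herm),
      Polynomial.X * P ∈ Submodule.span ℝ (Set.range herm) := by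
    intro P hP
    induction hP using Submodule.span_induction with
    | mem P hP =>
      obtain ⟨n, rfl⟩ := hP
      have h : Polynomial.X * herm n = herm (n + 1) + Polynomial.derivative (herm n) := by
        rw [herm_succ]; ring
      rw [h]
      refine add_mem (Submodule.subset_span ⟨_, rfl⟩) ?_
      cases n with
      | zero => simp [herm_zero]
      | succ n =>
        have : Polynomial.derivative (herm (n + 1)) = ((n : ℝ) + 1) • herm n := by
          rw [derivative_herm, Polynomial.smul_eq_C_mul]; simp
        rw [this]
        exact Submodule.smul_mem _ _ (Submodule.subset_span ⟨_, rfl⟩)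
    | zero => simp
    | add P Q _ _ hP hQ => rw [mul_add]; exact add_mem hP hQ
    | smul c P _ hP => rw [mul_smul_comm]; exact Submodule.smul_mem _ _ hP
  have hpow : ∀ k : ℕ, Polynomial.X ^ k ∈ Submodule.span ℝ (Set.range herm) := by
    intro k
    induction k with
    | zero => exact Submodule.subset_span ⟨0, by simp [herm_zero]⟩
    | succ k ih => rw [pow_succ']; exact hX _ ih
  refine eq_top_iff.2 fun P _ => ?_
  induction P using Polynomial.induction_on' with
  | add P Q hP hQ => exact add_mem (hP trivial) (hQ trivial)
  | monomial n c =>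
    rw [← Polynomial.smul_X_eq_monomial]
    exact Submodule.smul_mem _ _ (hpow n)

theorem memLp_gaussian {b : ℝ} (hb : 0 < b) :
    MemLp (fun x : ℝ => ((Real.exp (-b * x ^ 2) : ℝ) : ℂ)) 2 volume := by
  have hm : AEStronglyMeasurable (fun x : ℝ => ((Real.exp (-b * x ^ 2) : ℝ) : ℂ)) volume :=
    (by fun_prop : Continuous fun x : ℝ => ((Real.exp (-b * x ^ 2) : ℝ) : ℂ)).aestronglyMeasurable
  rw [memLp_two_iff_integrable_sq_norm hm]
  refine (integrable_exp_neg_mul_sq (b := 2 * b) (by positivity)).congr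
    (Eventually.of_forall fun x => ?_)
  simp only
  rw [Complex.norm_real, Real.norm_of_nonneg (Real.exp_nonneg _), ← Real.exp_nat_mul]
  congr 1
  push_cast; ring

/-- Completing the square: half of the Gaussian absorbs the exponential, the other half remains
square integrable and can be paired with `ψ`. -/
theorem exp_abs_mul_gaussian_le (a x : ℝ) :
    Real.exp (|a * x|) * Real.exp (-x ^ 2 / 2) ≤ Real.exp (a ^ 2) * Real.exp (-(1 / 4) * x ^ 2) := by
  rw [← Real.exp_add, ← Real.exp_add, abs_mul]
  refine Real.exp_le_exp.2 ?_
  nlinarith [sq_nonneg (|a| - |x| / 2), sq_abs a, sq_abs x]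

theorem integrable_exp_mul_gaussian (a : ℝ) (ψ : H) :
    Integrable fun x : ℝ => Real.exp (|a * x|) * (Real.exp (-x ^ 2 / 2) * ‖ψ x‖) := by
  have h1 : Integrable fun x : ℝ => ((Real.exp (-(1 / 4) * x ^ 2) : ℝ) : ℂ) * ψ x :=
    (memLp_gaussian (by norm_num)).integrable_mul (Lp.memLp ψ)
  refine (h1.norm.const_mul (Real.exp (a ^ 2))).mono ?_ (Eventually.of_forall fun x => ?_)
  · refine AEStronglyMeasurable.mul ?_ (AEStronglyMeasurable.mul ?_
      (Lp.aestronglyMeasurable ψ).norm)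
    · exact Continuous.aestronglyMeasurable (by fun_prop)
    · exact Continuous.aestronglyMeasurable (by fun_prop)
  · rw [Real.norm_of_nonneg (by positivity), Real.norm_of_nonneg (by positivity), norm_mul,
      Complex.norm_real, Real.norm_of_nonneg (Real.exp_nonneg _), ← mul_assoc, ← mul_assoc]
    exact mul_le_mul_of_nonneg_right (exp_abs_mul_gaussian_le a x) (norm_nonneg _)

theorem integrable_poly_mul_gaussian (P : Polynomial ℝ) (ψ : H) :
    Integrable fun x : ℝ => ((P.eval x * Real.exp (-x ^ 2 / 2) : ℝ) : ℂ) * ψ x := by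
  obtain ⟨C, hC⟩ := exists_poly_mul_gaussian_le (P.comp (Polynomial.C √2 * Polynomial.X))
  have h1 : Integrable fun x : ℝ => ((Real.exp (-(1 / 4) * x ^ 2) : ℝ) : ℂ) * ψ x :=
    (memLp_gaussian (by norm_num)).integrable_mul (Lp.memLp ψ)
  have hC' : ∀ x, |P.eval x| * Real.exp (-(1 / 4) * x ^ 2) ≤ C := by
    intro x
    have h2 : √2 * √2 = 2 := Real.mul_self_sqrt (by norm_num)
    have h0 : √2 ≠ 0 := by positivity
    have := hC (x / √2)
    simp only [Polynomial.eval_comp, Polynomial.eval_mul, Polynomial.eval_C,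
      Polynomial.eval_X, mul_div_cancel₀ _ h0] at this
    convert! this using 3
    rw [div_pow, Real.sq_sqrt (by norm_num)]; ring
  refine (h1.norm.const_mul C).mono ?_ (Eventually.of_forall fun x => ?_)
  · exact (Continuous.aestronglyMeasurable (by fun_prop)).mul (Lp.aestronglyMeasurable ψ)
  · have hC0 : 0 ≤ C := (by positivity : (0 : ℝ) ≤ _).trans (hC' 0)
    rw [norm_mul, norm_mul, norm_norm, norm_mul, Complex.norm_real, Complex.norm_real,
      Real.norm_of_nonneg hC0, Real.norm_of_nonneg (Real.exp_nonneg _), ← mul_assoc, norm_mul,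
      Real.norm_of_nonneg (Real.exp_nonneg _), Real.norm_eq_abs]
    refine mul_le_mul_of_nonneg_right ?_ (norm_nonneg _)
    have : Real.exp (-x ^ 2 / 2) = Real.exp (-(1 / 4) * x ^ 2) * Real.exp (-(1 / 4) * x ^ 2) := by
      rw [← Real.exp_add]; ring_nf
    rw [this, ← mul_assoc]
    gcongr
    exact hC' x

theorem integral_poly_mul_gaussian_eq_zero {ψ : H} (hψ : ∀ n, ⟪fock n, ψ⟫_ℂ = 0)
    (P : Polynomial ℝ) :
    ∫ x : ℝ, ((P.eval x * Real.exp (-x ^ 2 / 2) : ℝ) : ℂ) * ψ x = 0 := by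
  have hint : ∀ Q : Polynomial ℝ, Integrable fun x : ℝ =>
      ((Q.eval (√2 * x) * Real.exp (-x ^ 2 / 2) : ℝ) : ℂ) * ψ x := by
    intro Q
    have h := integrable_poly_mul_gaussian (Q.comp (Polynomial.C √2 * Polynomial.X)) ψ
    simp only [Polynomial.eval_comp, Polynomial.eval_mul, Polynomial.eval_C,
      Polynomial.eval_X] at h
    exact h
  have key : ∀ Q : Polynomial ℝ,
      ∫ x : ℝ, ((Q.eval (√2 * x) * Real.exp (-x ^ 2 / 2) : ℝ) : ℂ) * ψ x = 0 := by
    intro Q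
    have hQ : Q ∈ Submodule.span ℝ (Set.range herm) := by rw [span_range_herm]; trivial
    induction hQ using Submodule.span_induction with
    | mem Q hQ =>
      obtain ⟨n, rfl⟩ := hQ
      have h := hψ n
      rw [fock_eq, inner_smul_left, mul_eq_zero, or_iff_right, L2.inner_def] at h
      · rw [← h]
        refine integral_congr_ae ?_
        filter_upwards [ofSchwartz_apply (schwartzHermite n)] with x hx
        rw [hx, schwartzHermite_apply, RCLike.inner_apply, Complex.conj_ofReal, mul_comm]
      · rw [Complex.conj_ofReal, Complex.ofReal_eq_zero]
        have : (0 : ℝ) < √Real.pi * n.factorial := by positivity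
        positivity
    | zero => simp
    | add Q R _ _ hQ hR =>
      have : (fun x : ℝ => (((Q + R).eval (√2 * x) * Real.exp (-x ^ 2 / 2) : ℝ) : ℂ) * ψ x) =
          fun x : ℝ => ((Q.eval (√2 * x) * Real.exp (-x ^ 2 / 2) : ℝ) : ℂ) * ψ x +
            ((R.eval (√2 * x) * Real.exp (-x ^ 2 / 2) : ℝ) : ℂ) * ψ x := by
        funext x; rw [Polynomial.eval_add]; push_cast; ring
      rw [this, integral_add (hint Q) (hint R), hQ, hR, add_zero]
    | smul c Q _ hQ =>
      have : (fun x : ℝ => (((c • Q).eval (√2 * x) * Real.exp (-x ^ 2 / 2) : ℝ) : ℂ) * ψ x) =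
          fun x : ℝ => (c : ℂ) *
            (((Q.eval (√2 * x) * Real.exp (-x ^ 2 / 2) : ℝ) : ℂ) * ψ x) := by
        funext x; rw [Polynomial.eval_smul, smul_eq_mul]; push_cast; ring
      rw [this, integral_const_mul, hQ, mul_zero]
  have h0 : √2 ≠ 0 := by positivity
  -- Fock states carry the argument `√2 x`; composing with the inverse dilation removes it.
  have := key (P.comp (Polynomial.C (√2)⁻¹ * Polynomial.X))
  simp only [Polynomial.eval_comp, Polynomial.eval_mul, Polynomial.eval_C, Polynomial.eval_X,
    inv_mul_cancel_left₀ h0] at this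
  exact this

/-- Expand the exponential and integrate term by term; every term is a polynomial moment and
vanishes, and `integrable_exp_mul_gaussian` provides the domination. -/
theorem integral_exp_mul_gaussian_eq_zero {ψ : H} (hψ : ∀ n, ⟪fock n, ψ⟫_ℂ = 0) (a : ℝ) :
    ∫ x : ℝ, Complex.exp (Complex.I * a * x) * (((Real.exp (-x ^ 2 / 2) : ℝ) : ℂ) * ψ x) = 0 := by
  have hs := hasSum_integral_of_dominated_convergence (μ := (volume : Measure ℝ))
    (F := fun (n : ℕ) (x : ℝ) => (Complex.I * a * x) ^ n / n.factorial *
      (((Real.exp (-x ^ 2 / 2) : ℝ) : ℂ) * ψ x))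
    (f := fun x => Complex.exp (Complex.I * a * x) * (((Real.exp (-x ^ 2 / 2) : ℝ) : ℂ) * ψ x))
    (fun n x => |a * x| ^ n / n.factorial * (Real.exp (-x ^ 2 / 2) * ‖ψ x‖))
    (fun n => ?_) (fun n => Eventually.of_forall fun x => ?_) (Eventually.of_forall fun x => ?_) ?_
    (Eventually.of_forall fun x => ?_)
  · refine hs.unique ?_
    convert! hasSum_zero with n
    have h1 := integral_poly_mul_gaussian_eq_zero hψ (Polynomial.X ^ n)
    have h2 : (fun x : ℝ => (Complex.I * a * x) ^ n / n.factorial *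
        (((Real.exp (-x ^ 2 / 2) : ℝ) : ℂ) * ψ x)) = fun x : ℝ =>
        ((Complex.I * a) ^ n / n.factorial) *
          ((((Polynomial.X ^ n : Polynomial ℝ).eval x * Real.exp (-x ^ 2 / 2) : ℝ) : ℂ) * ψ x) := by
      funext x
      rw [Polynomial.eval_pow, Polynomial.eval_X, mul_pow]
      push_cast; ring
    rw [h2, integral_const_mul, h1, mul_zero]
  · refine AEStronglyMeasurable.mul ?_ (AEStronglyMeasurable.mul ?_ (Lp.aestronglyMeasurable ψ))
    · exact Continuous.aestronglyMeasurable (by fun_prop)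
    · exact Continuous.aestronglyMeasurable (by fun_prop)
  · rw [norm_mul, norm_mul, norm_div, norm_pow, norm_mul, norm_mul, Complex.norm_I, one_mul,
      Complex.norm_real, Complex.norm_real, Complex.norm_real, Complex.norm_natCast,
      Real.norm_of_nonneg (Real.exp_nonneg _), Real.norm_eq_abs, Real.norm_eq_abs, abs_mul]
  · exact (Real.summable_pow_div_factorial |a * x|).mul_right _
  · refine (integrable_exp_mul_gaussian a ψ).congr (Eventually.of_forall fun x => ?_)
    simp only
    rw [tsum_mul_right, Real.exp_eq_exp_ℝ, NormedSpace.exp_eq_tsum_div]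
  · have := NormedSpace.expSeries_div_hasSum_exp (𝔸 := ℂ) (Complex.I * a * x)
    rw [← Complex.exp_eq_exp_ℂ] at this
    exact this.mul_right _

open FourierTransform in
-- The Fourier transform of the integrable function `exp(-x²/2) ψ` vanishes identically. Writing a
-- test function as the transform of a Schwartz function and moving the transform across the pairing
-- shows that `exp(-x²/2) ψ = 0` a.e., and the Gaussian has no zeros.
theorem eq_zero_of_forall_inner_fock {ψ : H} (hψ : ∀ n, ⟪fock n, ψ⟫_ℂ = 0) : ψ = 0 := by
  set φ : ℝ → ℂ := fun x => ((Real.exp (-x ^ 2 / 2) : ℝ) : ℂ) * ψ x with hφ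
  have hint : Integrable φ := by
    have h := integrable_poly_mul_gaussian 1 ψ
    simp only [Polynomial.eval_one, one_mul] at h
    exact h
  have hF : ∀ ξ, VectorFourier.fourierIntegral Real.fourierChar volume (innerₗ ℝ) φ ξ = 0 := by
    intro ξ
    rw [← integral_exp_mul_gaussian_eq_zero hψ (-(2 * Real.pi * ξ)), VectorFourier.fourierIntegral]
    refine integral_congr_ae (Eventually.of_forall fun x => ?_)
    simp only [Circle.smul_def, Real.fourierChar_apply, smul_eq_mul, hφ]
    congr 2
    simp
    ring
  have h0 : ∀ᵐ x : ℝ, φ x = 0 := by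
    refine ae_eq_zero_of_integral_contDiff_smul_eq_zero hint.locallyIntegrable fun g hg hg' => ?_
    let G : SchwartzMap ℝ ℂ := (hg'.comp_left (g := fun x : ℝ => (x : ℂ)) (by simp)).toSchwartzMap
      (Complex.ofRealCLM.contDiff.comp hg)
    have hG : ∀ x, G x = g x := fun x => rfl
    let S : SchwartzMap ℝ ℂ := 𝓕⁻ G
    have hS : (𝓕 S : SchwartzMap ℝ ℂ) = G := FourierTransform.fourier_fourierInv_eq G
    have h1 := VectorFourier.integral_fourierIntegral_smul_eq_flip (L := innerₗ ℝ)
      (μ := (volume : Measure ℝ)) (ν := (volume : Measure ℝ)) Real.continuous_fourierChar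
      continuous_inner hint S.integrable
    simp only [hF, zero_smul, integral_zero, flip_innerₗ] at h1
    rw [h1]
    refine integral_congr_ae (Eventually.of_forall fun x => ?_)
    have h2 : VectorFourier.fourierIntegral Real.fourierChar volume (innerₗ ℝ) S x = g x := by
      rw [← hG, ← hS]; rfl
    simp only
    rw [h2, smul_eq_mul, mul_comm, Complex.real_smul]
  refine ext_ae ?_
  filter_upwards [h0, Lp.coeFn_zero ℂ 2 (volume : Measure ℝ)] with x hx hx'
  rw [hx', Pi.zero_apply]
  refine (mul_eq_zero.1 hx).resolve_left ?_
  rw [Complex.ofReal_eq_zero]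
  exact (Real.exp_pos _).ne'

end Completeness

/-! ### Quarter turns in phase space -/

section Rotation

/-- Completeness is available as triviality of the orthogonal complement, so it is applied to the
vectors `(S - T)† χ`. -/
theorem clm_ext_fock {S T : H →L[ℂ] H} (h : ∀ n, S (fock n) = T (fock n)) : S = T := by
  have key : (S - T).adjoint = 0 := by
    refine ContinuousLinearMap.ext fun χ => eq_zero_of_forall_inner_fock fun n => ?_
    rw [ContinuousLinearMap.adjoint_inner_right, sub_apply, h, sub_self, inner_zero_left]
  have := congrArg ContinuousLinearMap.adjoint key
  rw [ContinuousLinearMap.adjoint_adjoint, map_zero] at this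
  exact sub_eq_zero.1 this

theorem rotation_fock (θ : ℝ) (n : ℕ) :
    rotation θ (fock n) = Complex.exp (Complex.I * θ * n) • fock n := by
  refine (hasSum_rotation θ (fock n)).unique ?_
  convert! hasSum_single (f := fun k : ℕ =>
    (Complex.exp (Complex.I * θ * k) * ⟪fock k, fock n⟫_ℂ) • fock k) n fun k hk => ?_ using 1
  · rw [inner_fock, if_pos rfl, mul_one]
  · rw [inner_fock, if_neg hk, mul_zero, zero_smul]

theorem rotation_zero : rotation 0 = 1 := clm_ext_fock fun n => by simp [rotation_fock]

theorem rotation_add (a b : ℝ) : rotation (a + b) = rotation a * rotation b := by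
  refine clm_ext_fock fun n => ?_
  rw [mul_apply_eq_comp, rotation_fock, rotation_fock, map_smul, rotation_fock, smul_smul,
    ← Complex.exp_add]
  congr 2
  push_cast; ring

theorem star_rotation (θ : ℝ) : star (rotation θ) = rotation (-θ) := by
  refine clm_ext_fock fun n => sub_eq_zero.1 (eq_zero_of_forall_inner_fock fun m => ?_)
  rw [ContinuousLinearMap.star_eq_adjoint, inner_sub_right,
    ContinuousLinearMap.adjoint_inner_right, rotation_fock, rotation_fock, inner_smul_left,
    inner_smul_right, inner_fock]
  split_ifs with h
  · subst h
    rw [← Complex.exp_conj]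
    simp
  · simp

theorem rotation_mul_star (θ : ℝ) : rotation θ * star (rotation θ) = 1 := by
  rw [star_rotation, ← rotation_add, add_neg_cancel, rotation_zero]

theorem star_rotation_mul (θ : ℝ) : star (rotation θ) * rotation θ = 1 := by
  rw [star_rotation, ← rotation_add, neg_add_cancel, rotation_zero]

/-- On `|n⟩` the factor `iⁿ` of the rotation cancels the Fourier eigenvalue `(-i)ⁿ`; the dilation by
`2π` that remains comes from the normalisation `exp(-2πixξ)`. -/
theorem fourierCLM_mul_rotation :
    fourierCLM * rotation (Real.pi / 2) = affineOp (2 * Real.pi) 0 (by positivity) := by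
  refine clm_ext_fock fun n => ?_
  rw [mul_apply_eq_comp, rotation_fock, map_smul, fock_eq, map_smul, map_smul,
    smul_comm]
  congr 1
  have hexp : Complex.exp (Complex.I * (Real.pi / 2 : ℝ) * n) = Complex.I ^ n := by
    rw [show Complex.I * (Real.pi / 2 : ℝ) * n = n * (Real.pi / 2 * Complex.I) by push_cast; ring,
      Complex.exp_nat_mul, Complex.exp_pi_div_two_mul_I]
  rw [hexp, fourier_ofSchwartz]
  refine ext_ae ?_
  have hpos : (2 * Real.pi : ℝ) ≠ 0 := by positivity
  filter_upwards [Lp.coeFn_smul (Complex.I ^ n) (ofSchwartz (FourierTransform.fourier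
    (schwartzHermite n))), ofSchwartz_apply (FourierTransform.fourier (schwartzHermite n)),
    affineOp_apply hpos 0 (ofSchwartz (schwartzHermite n)),
    (quasiMeasurePreserving_affine hpos 0).ae (ofSchwartz_apply (schwartzHermite n))]
    with x h1 h2 h3 h4
  rw [h1, Pi.smul_apply, h2, h3, h4, fourier_schwartzHermite, smul_eq_mul, ← mul_assoc,
    ← mul_assoc, ← mul_pow, mul_neg, Complex.I_mul_I, neg_neg, one_pow, one_mul, add_zero,
    abs_of_pos (by positivity)]

theorem herm_comp_neg (n : ℕ) :
    (herm n).comp (-Polynomial.X) = (-1 : Polynomial ℝ) ^ n * herm n := by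
  induction n with
  | zero => simp [herm_zero]
  | succ n ih =>
    have h : (Polynomial.derivative (herm n)).comp (-Polynomial.X) =
        -((-1 : Polynomial ℝ) ^ n * Polynomial.derivative (herm n)) := by
      have := congrArg Polynomial.derivative ih
      rw [Polynomial.derivative_comp] at this
      rcases neg_one_pow_eq_or (Polynomial ℝ) n with h | h <;>
      · rw [h] at this ⊢
        simp only [Polynomial.derivative_neg, Polynomial.derivative_X, one_mul, neg_mul,
          neg_inj] at this ⊢
        first
          | linear_combination this
          | linear_combination (-1 : Polynomial ℝ) * this
    rw [herm_succ, Polynomial.sub_comp, Polynomial.mul_comp, Polynomial.X_comp, ih, h]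
    ring

theorem rotation_pi : rotation Real.pi = affineOp (-1) 0 (by norm_num) := by
  refine clm_ext_fock fun n => ?_
  have hexp : Complex.exp (Complex.I * Real.pi * n) = (-1) ^ n := by
    rw [show Complex.I * Real.pi * n = n * (Real.pi * Complex.I) by ring, Complex.exp_nat_mul,
      Complex.exp_pi_mul_I]
  rw [rotation_fock, fock_eq, map_smul, smul_comm, hexp]
  congr 1
  refine ext_ae ?_
  have hneg : (-1 : ℝ) ≠ 0 := by norm_num
  filter_upwards [Lp.coeFn_smul ((-1 : ℂ) ^ n) (ofSchwartz (schwartzHermite n)),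
    ofSchwartz_apply (schwartzHermite n), affineOp_apply hneg 0 (ofSchwartz (schwartzHermite n)),
    (quasiMeasurePreserving_affine hneg 0).ae (ofSchwartz_apply (schwartzHermite n))]
    with x h1 h2 h3 h4
  have h5 := congrArg (Polynomial.eval (√2 * x)) (herm_comp_neg n)
  simp only [Polynomial.eval_comp, Polynomial.eval_neg, Polynomial.eval_X, Polynomial.eval_mul,
    Polynomial.eval_pow, Polynomial.eval_one] at h5
  rw [h1, Pi.smul_apply, h2, h3, h4, schwartzHermite_apply, schwartzHermite_apply,
    show √2 * (-1 * x + 0) = -(√2 * x) by ring, h5, smul_eq_mul]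
  simp [mul_assoc]

/-- The dilation in `fourierCLM_mul_rotation` turns `m(ξ)` into `m(2πξ)`, which is the Fourier
multiplier defining `m(p)`. -/
theorem rotation_conj_posFun {m : ℝ → ℂ} (hm : IsBoundedContinuous m) :
    rotation (Real.pi / 2) * posFun m * star (rotation (Real.pi / 2)) = momFun m := by
  have hV : rotation (Real.pi / 2) = fourierInvCLM * affineOp (2 * Real.pi) 0 (by positivity) := by
    rw [← fourierCLM_mul_rotation, ← mul_assoc, fourierInvCLM_mul, one_mul]
  have h : affineOp (2 * Real.pi) 0 (by positivity) * posFun m =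
      posFun (fun ξ => m (2 * Real.pi * ξ)) * affineOp (2 * Real.pi) 0 (by positivity) := by
    rw [affineOp_mul_posFun _ 0 hm]
    simp only [add_zero]
  calc rotation (Real.pi / 2) * posFun m * star (rotation (Real.pi / 2))
      = fourierInvCLM * (affineOp (2 * Real.pi) 0 (by positivity) * posFun m) *
          star (rotation (Real.pi / 2)) := by
        nth_rewrite 1 [hV]; simp only [mul_assoc]
    _ = fourierInvCLM * posFun (fun ξ => m (2 * Real.pi * ξ)) * fourierCLM *
          (rotation (Real.pi / 2) * star (rotation (Real.pi / 2))) := by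
        rw [h, ← fourierCLM_mul_rotation]; simp only [mul_assoc]
    _ = momFun m := by rw [rotation_mul_star, mul_one, momFun_eq]

/-- Two quarter turns make the half turn, which is parity by `rotation_pi`. -/
theorem rotation_conj_momFun {m : ℝ → ℂ} (hm : IsBoundedContinuous m) :
    rotation (Real.pi / 2) * momFun m * star (rotation (Real.pi / 2)) = posFun fun x => m (-x) := by
  have h : rotation Real.pi * posFun m = posFun (fun x => m (-x)) * rotation Real.pi := by
    rw [rotation_pi, affineOp_mul_posFun _ 0 hm]
    simp only [add_zero, neg_one_mul]
  have hV : rotation (Real.pi / 2) * rotation (Real.pi / 2) = rotation Real.pi := by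
    rw [← rotation_add, add_halves]
  have hV' : star (rotation (Real.pi / 2)) * star (rotation (Real.pi / 2))
      = star (rotation Real.pi) := by rw [← hV, star_mul]
  rw [← rotation_conj_posFun hm]
  calc _ = (rotation (Real.pi / 2) * rotation (Real.pi / 2)) * posFun m *
        (star (rotation (Real.pi / 2)) * star (rotation (Real.pi / 2))) := by
        simp only [mul_assoc]
    _ = posFun fun x => m (-x) := by
      rw [hV, hV', h, mul_assoc, rotation_mul_star, mul_one]

theorem conj_mul {R A B : H →L[ℂ] H} (h : star R * R = 1) :
    R * (A * B) * star R = (R * A * star R) * (R * B * star R) := by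
  calc R * (A * B) * star R = R * A * 1 * B * star R := by simp only [mul_assoc, mul_one]
    _ = _ := by rw [← h]; simp only [mul_assoc]

/-- A quarter turn of `momFun_exp_mul_posFun` at `-s`; no further Fourier computation is needed. -/
theorem posFun_exp_mul_momFun (s : ℝ) {m : ℝ → ℂ} (hm : IsBoundedContinuous m) :
    posFun (fun x => Complex.exp (Complex.I * s * x)) * momFun m =
      momFun (fun y => m (y - s)) * posFun (fun x => Complex.exp (Complex.I * s * x)) := by
  have h := congrArg (fun T => rotation (Real.pi / 2) * T * star (rotation (Real.pi / 2)))
    (momFun_exp_mul_posFun (-s) hm)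
  simp only [conj_mul (star_rotation_mul (Real.pi / 2))] at h
  rw [rotation_conj_posFun hm, rotation_conj_posFun (hm.comp (φ := fun x => x + -s) (by fun_prop)),
    rotation_conj_momFun (IsBoundedContinuous.exp_mul_I (-s))] at h
  simpa [sub_eq_add_neg] using h

end Rotation

/-! ### Differentiating expectation values -/

section TraceDerivative

universe u

variable {E : Type u} [NormedAddCommGroup E] [InnerProductSpace ℂ E] [CompleteSpace E]

theorem trace_add_comp {ρ : E →L[ℂ] E} (hρ : IsTraceClass ρ) (X Y : E →L[ℂ] E) :
    trace ((X + Y) ∘L ρ) = trace (X ∘L ρ) + trace (Y ∘L ρ) := by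
  rw [ContinuousLinearMap.add_comp]
  exact ((hρ.isNuclear.comp_left X).hasTrace.add (hρ.isNuclear.comp_left Y).hasTrace).trace_eq

theorem trace_smul_comp {ρ : E →L[ℂ] E} (hρ : IsTraceClass ρ) (c : ℂ) (X : E →L[ℂ] E) :
    trace ((c • X) ∘L ρ) = c * trace (X ∘L ρ) := by
  rw [ContinuousLinearMap.smul_comp]
  exact ((hρ.isNuclear.comp_left X).hasTrace.smul c).trace_eq

/-- `T ↦ tr(A T)` is continuous for the trace norm. For `D` itself only convergence of the diagonal
sum of `A D` is required. -/
theorem hasDerivWithinAt_trace_comp {ρ : ℝ → E →L[ℂ] E} {D A : E →L[ℂ] E} {I : Set ℝ} {t : ℝ} {z : ℂ}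
    (hρ : ∀ s ∈ I, IsTraceClass (ρ s)) (ht : t ∈ I) (hD : HasTraceNormDerivWithinAt ρ D I t)
    (hz : HasTrace (A ∘L D) z) : HasDerivWithinAt (fun s => trace (A ∘L ρ s)) z I t := by
  rw [hasDerivWithinAt_iff_tendsto_slope, tendsto_iff_norm_sub_tendsto_zero]
  have h0 : Tendsto (fun s => ‖A‖ *
      (traceNorm (((s - t : ℝ) : ℂ)⁻¹ • (ρ s - ρ t) - D)).toReal) (𝓝[I \ {t}] t) (𝓝 0) := by
    have := ((ENNReal.tendsto_toReal ENNReal.zero_ne_top).comp hD).const_mul ‖A‖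
    simpa using this
  refine squeeze_zero' (Eventually.of_forall fun _ => norm_nonneg _) ?_ h0
  -- Near `t` the trace norm of the error is finite, which excludes the junk value of `toReal` at
  -- `∞`.
  filter_upwards [hD.eventually (gt_mem_nhds ENNReal.zero_lt_top), self_mem_nhdsWithin] with s hs hsI
  refine le_trans (le_of_eq ?_) (norm_trace_comp_le hs.ne A)
  congr 1
  have h1 := (((((hρ s hsI.1).isNuclear.comp_left A).hasTrace).sub
    (((hρ t ht).isNuclear.comp_left A).hasTrace)).smul (((s - t : ℝ) : ℂ)⁻¹)).sub hz
  have h2 : A ∘L (((s - t : ℝ) : ℂ)⁻¹ • (ρ s - ρ t) - D)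
      = ((s - t : ℝ) : ℂ)⁻¹ • (A ∘L ρ s - A ∘L ρ t) - A ∘L D := by
    ext ψ
    simp [map_sub]
  rw [h2, h1.trace_eq, slope_def_module, ← Complex.ofReal_inv, Complex.real_smul]

theorem IsConjDeriv.conj {W : ℝ → E →L[ℂ] E} {A B R : E →L[ℂ] E} (hR : star R * R = 1)
    (h : IsConjDeriv W A B) :
    IsConjDeriv (fun s => R * W s * star R) (R * A * star R) (R * B * star R) := by
  have := (HasDerivAt.const_mul R h).mul_const (star R)
  unfold IsConjDeriv
  refine this.congr_of_eventuallyEq (Eventually.of_forall fun s => ?_)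
  calc R * W s * star R * (R * A * star R) * (R * W (-s) * star R)
      = R * (W s * ((star R * R) * (A * ((star R * R) * W (-s))))) * star R := by
        simp only [mul_assoc]
    _ = R * (W s * A * W (-s)) * star R := by rw [hR]; simp only [mul_assoc, one_mul]

end TraceDerivative

section Reverse

variable {E : Type*} [NormedAddCommGroup E] [InnerProductSpace ℂ E]

theorem IsConjDeriv.reverse {W : ℝ → E →L[ℂ] E} {A B : E →L[ℂ] E} (h : IsConjDeriv W A B) :
    IsConjDeriv (fun s => W (-s)) A (-B) := by
  have := HasDerivAt.scomp (0 : ℝ) (h := fun s : ℝ => -s) (h' := -1)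
    (by simpa using! h) (hasDerivAt_neg 0)
  unfold IsConjDeriv
  simpa [Function.comp_def] using! this

theorem isConjDeriv_of_commute {W : ℝ → E →L[ℂ] E} (hW : ∀ s, W s * W (-s) = 1) {A : E →L[ℂ] E}
    (h : ∀ s, W s * A = A * W s) : IsConjDeriv W A 0 := by
  unfold IsConjDeriv
  have : (fun s => W s * A * W (-s)) = fun _ => A := by
    funext s; rw [h, mul_assoc, hW, mul_one]
  rw [this]
  exact hasDerivAt_const _ _

end Reverse

/-! ### Commutators with `q` and `p`, and the rotated Lindblad operators -/

section Lindblad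

/-- The translation group `exp (isp)`. -/
def translationGroup (s : ℝ) : H →L[ℂ] H := momFun fun y => Complex.exp (Complex.I * s * y)

theorem phaseGroup_one (s : ℝ) :
    phaseGroup 1 s = posFun fun x => Complex.exp (Complex.I * s * x) := by
  simp [phaseGroup]

/-- `m` is differentiable with a uniformly continuous derivative `m'`, and both are bounded. -/
structure HasUniformDeriv (m m' : ℝ → ℂ) : Prop where
  left : IsBoundedContinuous m
  right : IsBoundedContinuous m'
  uniformContinuous : UniformContinuous m'
  hasDerivAt : ∀ x, HasDerivAt m (m' x) x

theorem HasUniformDeriv.translation_posFun {m m' : ℝ → ℂ} (h : HasUniformDeriv m m') :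
    IsConjDeriv translationGroup (posFun m) (posFun m') := by
  have := hasDerivAt_posFun_translate h.left h.right h.uniformContinuous h.hasDerivAt
  unfold IsConjDeriv
  convert! this using 2 with s
  rw [translationGroup, momFun_exp_mul_posFun s h.left, mul_assoc]
  have h2 : translationGroup s * translationGroup (-s) = 1 := isGenerator_p.mul_neg s
  exact ((congrArg (posFun (fun x => m (x + s)) * ·) h2).trans (mul_one _))

theorem momFun_commute {m n : ℝ → ℂ} (hm : IsBoundedContinuous m) (hn : IsBoundedContinuous n) :
    momFun m * momFun n = momFun n * momFun m := by
  rw [← momFun_mul hm hn, ← momFun_mul hn hm]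
  simp only [mul_comm]

theorem posFun_commute {m n : ℝ → ℂ} (hm : IsBoundedContinuous m) (hn : IsBoundedContinuous n) :
    posFun m * posFun n = posFun n * posFun m := by
  rw [← posFun_mul hm hn, ← posFun_mul hn hm]
  simp only [mul_comm]

theorem translation_momFun {m : ℝ → ℂ} (hm : IsBoundedContinuous m) :
    IsConjDeriv translationGroup (momFun m) 0 :=
  isConjDeriv_of_commute isGenerator_p.mul_neg
    fun s => momFun_commute (IsBoundedContinuous.exp_mul_I s) hm

theorem phase_posFun {m : ℝ → ℂ} (hm : IsBoundedContinuous m) :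
    IsConjDeriv (phaseGroup 1) (posFun m) 0 :=
  isConjDeriv_of_commute isGenerator_q.mul_neg
    fun s => by rw [phaseGroup_one]; exact posFun_commute (IsBoundedContinuous.exp_mul_I s) hm

theorem rotation_conj_translationGroup (s : ℝ) :
    rotation (Real.pi / 2) * translationGroup s * star (rotation (Real.pi / 2))
      = phaseGroup 1 (-s) := by
  rw [translationGroup, rotation_conj_momFun (IsBoundedContinuous.exp_mul_I s), phaseGroup_one]
  simp

theorem rotation_conj_phaseGroup (s : ℝ) :
    rotation (Real.pi / 2) * phaseGroup 1 s * star (rotation (Real.pi / 2))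
      = translationGroup s := by
  rw [phaseGroup_one, rotation_conj_posFun (IsBoundedContinuous.exp_mul_I s), translationGroup]

/-- A quarter turn of `translation_posFun`: it sends `exp(isp)` to `exp(-isq)`, and this reversal of
time is the origin of the sign. -/
theorem HasUniformDeriv.phase_momFun {m m' : ℝ → ℂ} (h : HasUniformDeriv m m') :
    IsConjDeriv (phaseGroup 1) (momFun m) (-momFun m') := by
  have := IsConjDeriv.reverse
    (IsConjDeriv.conj (star_rotation_mul (Real.pi / 2)) h.translation_posFun)
  simp only [rotation_conj_translationGroup, rotation_conj_posFun h.left,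
    rotation_conj_posFun h.right, neg_neg] at this
  exact this

theorem translation_comp {f f' g : ℝ → ℂ} (hf : HasUniformDeriv f f') (hg : IsBoundedContinuous g) :
    IsConjDeriv translationGroup (posFun f * momFun g) (posFun f' * momFun g) := by
  have := IsConjDeriv.mul isGenerator_p.zero isGenerator_p.neg_mul hf.translation_posFun
    (translation_momFun hg)
  simpa using! this

theorem phase_comp {f g g' : ℝ → ℂ} (hf : IsBoundedContinuous f) (hg : HasUniformDeriv g g') :
    IsConjDeriv (phaseGroup 1) (posFun f * momFun g) (-(posFun f * momFun g')) := by
  have := IsConjDeriv.mul isGenerator_q.zero isGenerator_q.neg_mul (phase_posFun hf)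
    hg.phase_momFun
  simpa using! this

theorem hasUniformDeriv_exp (c : ℝ) :
    HasUniformDeriv (fun x => Complex.exp (Complex.I * c * x))
      fun x => Complex.I * c * Complex.exp (Complex.I * c * x) where
  left := IsBoundedContinuous.exp_mul_I c
  right := (IsBoundedContinuous.exp_mul_I c).const_mul _
  uniformContinuous := by
    rcases eq_or_ne c 0 with rfl | hc
    · simpa using uniformContinuous_const
    · have hT : 0 < 2 * Real.pi / |c| := by positivity
      refine Function.Periodic.uniformContinuous (T := 2 * Real.pi / |c|) (fun x => ?_) hT
        (by fun_prop)
      have hc' : (c : ℂ) ≠ 0 := by exact_mod_cast hc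
      congr 1
      rcases abs_choice c with h | h
      · rw [h, show Complex.I * c * ((x + 2 * Real.pi / c : ℝ) : ℂ)
          = Complex.I * c * x + 2 * Real.pi * Complex.I by push_cast; field_simp]
        exact Complex.exp_periodic _
      · rw [h, show Complex.I * c * ((x + 2 * Real.pi / -c : ℝ) : ℂ)
          = Complex.I * c * x - 2 * Real.pi * Complex.I by push_cast; field_simp; ring]
        exact Complex.exp_periodic.sub_eq _
  hasDerivAt x := by
    have h1 : HasDerivAt (fun x : ℝ => Complex.I * c * x) (Complex.I * c) x := by
      simpa using (hasDerivAt_id x).ofReal_comp.const_mul (Complex.I * c)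
    exact h1.cexp.congr_deriv (mul_comm _ _)

theorem mem_domain_L₀ (η ε : ℝ) (ψ : H) : ψ ∈ (L₀ η ε).domain ↔ ψ ∈ p.domain := by
  have h1 : (L₀ η ε).domain = (ofCLM (posFun fun x => Complex.exp (Complex.I * η * x)) ⊚
    (ofCLM 1 - (ε : ℂ) • p)).domain ⊓ (ofCLM (1 : H →L[ℂ] H)).domain := rfl
  rw [h1, Submodule.mem_inf, and_iff_left (mem_domain_ofCLM _ _), mem_domain_prod]
  have h2 : (ofCLM (1 : H →L[ℂ] H) - (ε : ℂ) • p).domain = (ofCLM (1 : H →L[ℂ] H)).domain ⊓ p.domain :=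
    rfl
  constructor
  · rintro ⟨h, -⟩
    exact (h2 ▸ h).2
  · intro h
    exact ⟨⟨mem_domain_ofCLM _ _, h⟩, mem_domain_ofCLM _ _⟩

theorem L₀_apply (η ε : ℝ) {ψ : H} (h : ψ ∈ (L₀ η ε).domain) (h' : ψ ∈ p.domain) :
    L₀ η ε ⟨ψ, h⟩ = (ampl η ε : ℂ) • posFun (fun x => Complex.exp (Complex.I * η * x))
      (ψ - (ε : ℂ) • p ⟨ψ, h'⟩) - ψ := rfl

/-- A rotated `L₀` again has the form `aU(1 - εP) - 1`, with `U` and `P` rotated, so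
`trace_comp_dissipator_shifted` applies. -/
theorem trace_comp_dissipator_conj {η ε θ : ℝ} {W : ℝ → H →L[ℂ] H}
    {ρ D U A A₁ A₂ : H →L[ℂ] H} (hρ : ρ.IsPositive) (hρ' : IsTraceClass ρ)
    (hD : IsDissipator (ofCLM (rotation θ) ⊚ L₀ η ε ⊚ ofCLM (rotation (-θ))) ρ D)
    (hW : ∀ s, rotation θ * translationGroup s * star (rotation θ) = W s)
    (hU : rotation θ * posFun (fun x => Complex.exp (Complex.I * η * x)) * star (rotation θ) = U)
    (hA : IsConjDeriv W A A₁) (hA₁ : IsConjDeriv W A₁ A₂)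
    (hUA : U * A = A * U) (hUA₁ : U * A₁ = A₁ * U) :
    HasTrace (A ∘L D) (trace (((1 / 2 : ℂ) • (((ampl η ε * ε : ℝ) : ℂ) ^ 2 • A₂ +
      (Complex.I * (ampl η ε * ε : ℝ)) • ((U - star U) * A₁))) ∘L ρ)) := by
  have h1 := rotation_mul_star θ
  have h2 := star_rotation_mul θ
  have hgen := isGenerator_p.conj h1 h2
  have hWf : (fun s : ℝ => rotation θ * momFun (fun y => Complex.exp (Complex.I * s * y)) *
      star (rotation θ)) = W := funext hW
  have hE : IsBoundedContinuous fun x => Complex.exp (Complex.I * η * x) :=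
    IsBoundedContinuous.exp_mul_I η
  have hEE : star (posFun fun x => Complex.exp (Complex.I * η * x)) *
      posFun (fun x => Complex.exp (Complex.I * η * x)) = 1 := by
    rw [star_posFun hE, ← posFun_mul hE.star hE, ← posFun_one]
    congr 1
    funext x
    rw [← Complex.exp_conj, ← Complex.exp_add]
    simp
  have hEE' : posFun (fun x => Complex.exp (Complex.I * η * x)) *
      star (posFun fun x => Complex.exp (Complex.I * η * x)) = 1 := by
    rw [star_posFun hE, posFun_commute hE hE.star, ← star_posFun hE, hEE]
  have hUstar : star U = rotation θ * star (posFun fun x => Complex.exp (Complex.I * η * x)) *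
      star (rotation θ) := by
    rw [← hU]; simp [mul_assoc]
  have hconj := IsConjDeriv.conj h2 (hasUniformDeriv_exp η).translation_posFun
  simp only [hW, hU] at hconj
  rw [hWf] at hgen
  rw [star_rotation] at hgen
  have hR : ∀ ψ, rotation θ (rotation (-θ) ψ) = ψ := fun ψ => by
    rw [← star_rotation]; exact congrArg (fun T => T ψ) h1
  have hR' : ∀ ψ, star (rotation θ) (rotation θ ψ) = ψ := fun ψ => congrArg (fun T => T ψ) h2
  have hdom : ∀ (T : H →ₗ.[ℂ] H) ψ,
      ψ ∈ (ofCLM (rotation θ) ⊚ T ⊚ ofCLM (rotation (-θ))).domain ↔ rotation (-θ) ψ ∈ T.domain := by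
    intro T ψ
    constructor
    · intro h
      obtain ⟨g, _⟩ := mem_domain_prod.1 h
      obtain ⟨_, g'⟩ := mem_domain_prod.1 g
      exact g'
    · intro h
      exact mem_domain_prod.2 ⟨mem_domain_prod.2 ⟨mem_domain_ofCLM _ _, h⟩, mem_domain_ofCLM _ _⟩
  refine trace_comp_dissipator_shifted hρ hρ' hgen (fun ψ => ?_) (fun ψ h h' => ?_) hD ?_ ?_
    hconj hA hA₁ hUA hUA₁
  · rw [hdom, hdom, mem_domain_L₀]
  · have e1 : (ofCLM (rotation θ) ⊚ L₀ η ε ⊚ ofCLM (rotation (-θ))) ⟨ψ, h⟩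
        = rotation θ (L₀ η ε ⟨rotation (-θ) ψ, (hdom _ _).1 h⟩) := rfl
    have e2 : (ofCLM (rotation θ) ⊚ p ⊚ ofCLM (rotation (-θ))) ⟨ψ, h'⟩
        = rotation θ (p ⟨rotation (-θ) ψ, (hdom _ _).1 h'⟩) := rfl
    have e3 : ∀ χ, U (rotation θ χ) =
        rotation θ (posFun (fun x => Complex.exp (Complex.I * η * x)) χ) := by
      intro χ
      rw [← hU]
      simp only [mul_apply_eq_comp, hR']
    have e4 : ψ - (ε : ℂ) • rotation θ (p ⟨rotation (-θ) ψ, (hdom _ _).1 h'⟩) =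
        rotation θ (rotation (-θ) ψ - (ε : ℂ) • p ⟨rotation (-θ) ψ, (hdom _ _).1 h'⟩) := by
      rw [map_sub, map_smul, hR]
    rw [e1, e2, L₀_apply η ε _ ((hdom _ _).1 h'), e4, e3, map_sub, map_smul, hR]
  · rw [hUstar, ← hU, ← conj_mul h2, hEE, mul_one, h1]
  · rw [hUstar, ← hU, ← conj_mul h2, hEE', mul_one, h1]

end Lindblad

/-! ### Commutation at the lattice period -/

section FunctionalCalculus

theorem IsConjDeriv.comp_mul {E : Type*} [NormedAddCommGroup E] [InnerProductSpace ℂ E]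
    {W : ℝ → E →L[ℂ] E} {A B : E →L[ℂ] E} (c : ℝ) (h : IsConjDeriv W A B) :
    IsConjDeriv (fun s => W (c * s)) A ((c : ℂ) • B) := by
  have h1 : HasDerivAt (fun s : ℝ => c * s) c 0 := by
    simpa using (hasDerivAt_id (0 : ℝ)).const_mul c
  have := HasDerivAt.scomp (0 : ℝ) (h := fun s : ℝ => c * s) (h' := c)
    (by simpa using! h) h1
  unfold IsConjDeriv
  simpa [Function.comp_def] using! this

theorem IsConjDeriv.smul {E : Type*} [NormedAddCommGroup E] [InnerProductSpace ℂ E]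
    {W : ℝ → E →L[ℂ] E} {A B : E →L[ℂ] E} (c : ℂ) (h : IsConjDeriv W A B) :
    IsConjDeriv W (c • A) (c • B) := by
  have := HasDerivAt.const_smul c h
  unfold IsConjDeriv
  simpa only [mul_smul_comm, smul_mul_assoc] using! this

theorem momFun_add {m n : ℝ → ℂ} (hm : IsBoundedContinuous m) (hn : IsBoundedContinuous n) :
    momFun (fun x => m x + n x) = momFun m + momFun n := by
  rw [← rotation_conj_posFun (hm.add hn), posFun_add hm hn, mul_add, add_mul,
    rotation_conj_posFun hm, rotation_conj_posFun hn]

theorem momFun_const_mul (c : ℂ) {m : ℝ → ℂ} (hm : IsBoundedContinuous m) :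
    momFun (fun x => c * m x) = c • momFun m := by
  rw [← rotation_conj_posFun (hm.const_mul c), posFun_const_mul c hm, mul_smul_comm, smul_mul_assoc,
    rotation_conj_posFun hm]

theorem isBoundedContinuous_sin (η : ℝ) : IsBoundedContinuous fun x => (Real.sin (η * x) : ℂ) where
  continuous := by fun_prop
  bounded := ⟨1, fun x => by
    rw [Complex.norm_real, Real.norm_eq_abs]
    exact Real.abs_sin_le_one _⟩

theorem star_posFun_exp (s : ℝ) :
    star (posFun fun x => Complex.exp (Complex.I * s * x)) =
      posFun fun x => Complex.exp (Complex.I * (-s : ℝ) * x) := by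
  rw [star_posFun (IsBoundedContinuous.exp_mul_I s)]
  congr 1
  funext x
  rw [← Complex.exp_conj]
  simp

theorem posFun_exp_sub_star (c η : ℝ) (hc : c = 1 ∨ c = -1) :
    (posFun fun x => Complex.exp (Complex.I * (c * η : ℝ) * x)) -
      star (posFun fun x => Complex.exp (Complex.I * (c * η : ℝ) * x)) =
      (2 * Complex.I * c) • posFun fun x => (Real.sin (η * x) : ℂ) := by
  rw [← posFun_const_mul _ (isBoundedContinuous_sin η), star_posFun_exp, sub_eq_iff_eq_add,
    ← posFun_add ((isBoundedContinuous_sin η).const_mul _) (IsBoundedContinuous.exp_mul_I _)]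
  congr 1
  funext x
  have h1 : Complex.exp (Complex.I * (c * η : ℝ) * x) =
      Complex.cos (c * η * x) + Complex.sin (c * η * x) * Complex.I := by
    rw [← Complex.exp_mul_I]; congr 1; push_cast; ring
  have h2 : Complex.exp (Complex.I * (-(c * η) : ℝ) * x) =
      Complex.cos (c * η * x) - Complex.sin (c * η * x) * Complex.I := by
    have := Complex.exp_mul_I (-(c * η * x))
    rw [Complex.cos_neg, Complex.sin_neg, neg_mul (Complex.sin _), ← sub_eq_add_neg] at this
    rw [← this]; congr 1; push_cast; ring
  have h3 : Complex.sin (c * η * x) = c * (Real.sin (η * x) : ℂ) := by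
    rcases hc with rfl | rfl <;> simp
  rw [h1, h2, h3]
  ring

theorem rotation_conj_star (X : H →L[ℂ] H) : star (rotation (Real.pi / 2) * X *
    star (rotation (Real.pi / 2))) =
      rotation (Real.pi / 2) * star X * star (rotation (Real.pi / 2)) := by
  simp [mul_assoc]

theorem momFun_exp_sub_star (c η : ℝ) (hc : c = 1 ∨ c = -1) :
    (momFun fun x => Complex.exp (Complex.I * (c * η : ℝ) * x)) -
      star (momFun fun x => Complex.exp (Complex.I * (c * η : ℝ) * x)) =
      (2 * Complex.I * c) • momFun fun x => (Real.sin (η * x) : ℂ) := by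
  rw [← rotation_conj_posFun (IsBoundedContinuous.exp_mul_I _),
    ← rotation_conj_posFun (isBoundedContinuous_sin η), rotation_conj_star, ← sub_mul, ← mul_sub,
    posFun_exp_sub_star c η hc, mul_smul_comm, smul_mul_assoc]

/-- The step that uses the lattice: `exp(±iηq)` shifts `p` by a period of `m`. -/
theorem posFun_exp_commute {c η : ℝ} (hc : c = 1 ∨ c = -1) {m : ℝ → ℂ}
    (hm : IsBoundedContinuous m) (hper : Function.Periodic m η) :
    posFun (fun x => Complex.exp (Complex.I * (c * η : ℝ) * x)) * momFun m =
      momFun m * posFun fun x => Complex.exp (Complex.I * (c * η : ℝ) * x) := by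
  have h : (fun y => m (y - c * η)) = m := by
    funext y
    rcases hc with rfl | rfl
    · rw [one_mul, hper.sub_eq]
    · rw [neg_one_mul, sub_neg_eq_add, hper]
  rw [posFun_exp_mul_momFun _ hm, h]

theorem momFun_exp_commute {c η : ℝ} (hc : c = 1 ∨ c = -1) {m : ℝ → ℂ}
    (hm : IsBoundedContinuous m) (hper : Function.Periodic m η) :
    momFun (fun x => Complex.exp (Complex.I * (c * η : ℝ) * x)) * posFun m =
      posFun m * momFun fun x => Complex.exp (Complex.I * (c * η : ℝ) * x) := by
  have h : (fun y => m (y + c * η)) = m := by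
    funext y
    rcases hc with rfl | rfl
    · rw [one_mul, hper]
    · rw [neg_one_mul, ← sub_eq_add_neg, hper.sub_eq]
  rw [momFun_exp_mul_posFun _ hm, h]

/-- `sin(ηp)` is a combination of `exp(±iηp)`, both of which commute with `m(q)`. It lets the drift
in `p` pass through `f(ηq/2)`, which stands on the left in the observable. -/
theorem momFun_sin_commute {η : ℝ} {m : ℝ → ℂ} (hm : IsBoundedContinuous m)
    (hper : Function.Periodic m η) :
    momFun (fun x => (Real.sin (η * x) : ℂ)) * posFun m =
      posFun m * momFun fun x => (Real.sin (η * x) : ℂ) := by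
  have hs := momFun_exp_sub_star 1 η (Or.inl rfl)
  have h1 : star (momFun fun x => Complex.exp (Complex.I * (1 * η : ℝ) * x)) =
      momFun fun x => Complex.exp (Complex.I * ((-1) * η : ℝ) * x) := by
    rw [← rotation_conj_posFun (IsBoundedContinuous.exp_mul_I _), rotation_conj_star,
      star_posFun_exp, rotation_conj_posFun (IsBoundedContinuous.exp_mul_I _)]
    simp
  rw [h1] at hs
  have h2 := congrArg (· * posFun m) hs
  have h3 := congrArg (posFun m * ·) hs
  simp only [sub_mul, mul_sub, momFun_exp_commute (Or.inl rfl : (1 : ℝ) = 1 ∨ (1 : ℝ) = -1) hm hper,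
    momFun_exp_commute (Or.inr rfl : (-1 : ℝ) = 1 ∨ (-1 : ℝ) = -1) hm hper] at h2 h3
  have h4 := h2.symm.trans h3
  rw [smul_mul_assoc, mul_smul_comm] at h4
  exact smul_right_injective _ (by simp) h4

end FunctionalCalculus

/-! ### The four rotated dissipators -/

section Rotations

/-- The rotation by `θ` maps the pair `(exp (isp), exp (iηq))` to
`(exp (icsp), exp (icηq))`. -/
structure IsPositionFrame (η θ c : ℝ) : Prop where
  translation : ∀ s, rotation θ * translationGroup s * star (rotation θ) = translationGroup (c * s)
  phase : rotation θ * posFun (fun x => Complex.exp (Complex.I * η * x)) * star (rotation θ) =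
    posFun fun x => Complex.exp (Complex.I * (c * η : ℝ) * x)

/-- The rotation by `θ` maps the pair `(exp (isp), exp (iηq))` to
`(exp (-icsq), exp (icηp))`. -/
structure IsMomentumFrame (η θ c : ℝ) : Prop where
  translation : ∀ s, rotation θ * translationGroup s * star (rotation θ) = phaseGroup 1 (-c * s)
  phase : rotation θ * posFun (fun x => Complex.exp (Complex.I * η * x)) * star (rotation θ) =
    momFun fun x => Complex.exp (Complex.I * (c * η : ℝ) * x)

theorem isPositionFrame_zero (η : ℝ) : IsPositionFrame η 0 1 where
  translation s := by simp [rotation_zero]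
  phase := by simp [rotation_zero]

theorem rotation_add_conj (a b : ℝ) (X : H →L[ℂ] H) :
    rotation (a + b) * X * star (rotation (a + b)) =
      rotation a * (rotation b * X * star (rotation b)) * star (rotation a) := by
  rw [rotation_add, star_mul]
  simp only [mul_assoc]

theorem IsPositionFrame.rotate {η θ c : ℝ} (h : IsPositionFrame η θ c) :
    IsMomentumFrame η (Real.pi / 2 + θ) c where
  translation s := by
    rw [rotation_add_conj, h.translation, rotation_conj_translationGroup, neg_mul]
  phase := by
    rw [rotation_add_conj, h.phase, rotation_conj_posFun (IsBoundedContinuous.exp_mul_I _)]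

theorem IsMomentumFrame.rotate {η θ c : ℝ} (h : IsMomentumFrame η θ c) :
    IsPositionFrame η (Real.pi / 2 + θ) (-c) where
  translation s := by
    rw [rotation_add_conj, h.translation, rotation_conj_phaseGroup]
  phase := by
    rw [rotation_add_conj, h.phase, rotation_conj_momFun (IsBoundedContinuous.exp_mul_I _)]
    simp

variable {η ε θ c : ℝ} {ρ D : H →L[ℂ] H} {F F₁ F₂ G G₁ G₂ : ℝ → ℂ}

/-- The sign `c` enters once through the chain rule in `W` and once through `U - U† = 2ic sin(ηq)`,
or twice in the second derivative. So only `c² = 1` is seen, and a half turn does not change the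
contribution. -/
theorem trace_comp_dissipator_position (h : IsPositionFrame η θ c) (hc : c = 1 ∨ c = -1)
    (hρ : ρ.IsPositive) (hρ' : IsTraceClass ρ)
    (hD : IsDissipator (ofCLM (rotation θ) ⊚ L₀ η ε ⊚ ofCLM (rotation (-θ))) ρ D)
    (hF : HasUniformDeriv F F₁) (hF₁ : HasUniformDeriv F₁ F₂) (hG : IsBoundedContinuous G)
    (hper : Function.Periodic G η) :
    HasTrace ((posFun F * momFun G) ∘L D)
      (trace ((((ampl η ε * ε : ℝ) ^ 2 / 2 : ℂ) • (posFun F₂ * momFun G) +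
        (-((ampl η ε * ε : ℝ) : ℂ)) • (posFun (fun x => (Real.sin (η * x) : ℂ)) *
          posFun F₁ * momFun G)) ∘L ρ)) := by
  have hcc : (c : ℂ) * c = 1 := by rcases hc with rfl | rfl <;> simp
  have hcomm : ∀ {m : ℝ → ℂ}, IsBoundedContinuous m →
      posFun (fun x => Complex.exp (Complex.I * (c * η : ℝ) * x)) * (posFun m * momFun G) =
        posFun m * momFun G * posFun fun x => Complex.exp (Complex.I * (c * η : ℝ) * x) := by
    intro m hm
    rw [← mul_assoc, posFun_commute (IsBoundedContinuous.exp_mul_I _) hm, mul_assoc,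
      posFun_exp_commute hc hG hper, mul_assoc]
  have key := trace_comp_dissipator_conj hρ hρ' hD h.translation h.phase
    ((translation_comp hF hG).comp_mul c) (((translation_comp hF₁ hG).comp_mul c).smul c)
    (hcomm hF.left) (by rw [mul_smul_comm, hcomm hF₁.left, smul_mul_assoc])
  rw [posFun_exp_sub_star c η hc] at key
  convert! key using 3
  rw [smul_smul (c : ℂ) (c : ℂ), hcc, one_smul, smul_mul_smul_comm, smul_add, smul_smul, smul_smul, smul_smul,
    mul_assoc (posFun _)]
  congr 2
  · ring
  · linear_combination (-(ampl η ε * ε : ℝ) * (c * c) : ℂ) * Complex.I_sq +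
      ((ampl η ε * ε : ℝ) : ℂ) * hcc

theorem trace_comp_dissipator_momentum (h : IsMomentumFrame η θ c) (hc : c = 1 ∨ c = -1)
    (hρ : ρ.IsPositive) (hρ' : IsTraceClass ρ)
    (hD : IsDissipator (ofCLM (rotation θ) ⊚ L₀ η ε ⊚ ofCLM (rotation (-θ))) ρ D)
    (hG : HasUniformDeriv G G₁) (hG₁ : HasUniformDeriv G₁ G₂) (hF : IsBoundedContinuous F)
    (hper : Function.Periodic F η) :
    HasTrace ((posFun F * momFun G) ∘L D)
      (trace ((((ampl η ε * ε : ℝ) ^ 2 / 2 : ℂ) • (posFun F * momFun G₂) +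
        (-((ampl η ε * ε : ℝ) : ℂ)) • (posFun F * (momFun (fun x => (Real.sin (η * x) : ℂ)) *
          momFun G₁))) ∘L ρ)) := by
  have hcc : (c : ℂ) * c = 1 := by rcases hc with rfl | rfl <;> simp
  have hcomm : ∀ {m : ℝ → ℂ}, IsBoundedContinuous m →
      momFun (fun x => Complex.exp (Complex.I * (c * η : ℝ) * x)) * (posFun F * momFun m) =
        posFun F * momFun m * momFun fun x => Complex.exp (Complex.I * (c * η : ℝ) * x) := by
    intro m hm
    rw [← mul_assoc, momFun_exp_commute hc hF hper, mul_assoc,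
      momFun_commute (IsBoundedContinuous.exp_mul_I _) hm, mul_assoc]
  -- The reversed phase group `exp(-icsq)` and the sign in `phase_comp` compensate each other.
  have hneg : ∀ X : H →L[ℂ] H, ((-c : ℝ) : ℂ) • -X = (c : ℂ) • X := fun X => by
    rw [Complex.ofReal_neg, neg_smul_neg]
  have hA := (phase_comp hF hG).comp_mul (-c)
  have hA₁ := ((phase_comp hF hG₁).comp_mul (-c)).smul c
  rw [hneg] at hA hA₁
  have key := trace_comp_dissipator_conj hρ hρ' hD h.translation h.phase hA hA₁
    (hcomm hG.left) (by rw [mul_smul_comm, hcomm hG₁.left, smul_mul_assoc])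
  rw [momFun_exp_sub_star c η hc] at key
  convert! key using 3
  rw [smul_smul (c : ℂ) (c : ℂ), hcc, one_smul, smul_mul_smul_comm, smul_add, smul_smul, smul_smul, smul_smul,
    ← mul_assoc (momFun _), momFun_sin_commute hF hper, mul_assoc (posFun _)]
  congr 2
  · ring
  · linear_combination (-(ampl η ε * ε : ℝ) * (c * c) : ℂ) * Complex.I_sq +
      ((ampl η ε * ε : ℝ) : ℂ) * hcc

end Rotations

/-! ### Assembling the generator on observables -/

section Observables

theorem lindbladOp_two (η ε : ℝ) (k : ℕ) : lindbladOp 2 η ε k =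
    ofCLM (rotation (k * (Real.pi / 2))) ⊚ L₀ η ε ⊚ ofCLM (rotation (-(k * (Real.pi / 2)))) := by
  simp only [lindbladOp, Nat.cast_ofNat, mul_div_assoc]

/-- The dilated function `x ↦ f(c x)`, as a complex-valued function. -/
def dilate (c : ℝ) (f : ℝ → ℝ) (x : ℝ) : ℂ := f (c * x)

theorem periodic_dilate {f : ℝ → ℝ} {c T : ℝ} (hf : Function.Periodic f (c * T)) :
    Function.Periodic (dilate c f) T := fun x => by
  rw [GKP.dilate, mul_add, hf]; rfl

theorem hasUniformDeriv_dilate {f : ℝ → ℝ} {c T : ℝ} (hf : ContDiff ℝ 1 f)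
    (hper : Function.Periodic f (c * T)) (hT : 0 < T) :
    HasUniformDeriv (dilate c f) fun x => c * dilate c (deriv f) x := by
  have hf' : Continuous (deriv f) := hf.continuous_deriv le_rfl
  have hper' : Function.Periodic (deriv f) (c * T) := fun x => by
    rw [← deriv_comp_add_const, funext hper]
  have hc : Continuous fun x => (c : ℂ) * dilate c (deriv f) x := by unfold dilate; fun_prop
  have hp : Function.Periodic (fun x => (c : ℂ) * dilate c (deriv f) x) T := fun x => by
    exact congrArg ((c : ℂ) * ·) (periodic_dilate hper' x)
  refine ⟨(periodic_dilate hper).isBoundedContinuous hT.ne' ?_,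
    hp.isBoundedContinuous hT.ne' hc, hp.uniformContinuous hT hc, fun x => ?_⟩
  · have := hf.continuous
    unfold dilate; fun_prop
  · have h1 := ((hf.differentiable one_ne_zero) (c * x)).hasDerivAt
    have h2 : HasDerivAt (fun x : ℝ => c * x) c x := by
      simpa using (hasDerivAt_id x).const_mul c
    refine (h1.comp x h2).ofReal_comp.congr_deriv ?_
    simp [dilate, mul_comm]

theorem HasUniformDeriv.const_mul {m m' : ℝ → ℂ} (c : ℂ) (h : HasUniformDeriv m m') :
    HasUniformDeriv (fun x => c * m x) fun x => c * m' x where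
  left := h.left.const_mul c
  right := h.right.const_mul c
  uniformContinuous := h.uniformContinuous.const_smul c
  hasDerivAt x := (h.hasDerivAt x).const_mul c

theorem hasUniformDeriv_dilate_deriv {f : ℝ → ℝ} {c T : ℝ} (hf : ContDiff ℝ 2 f)
    (hper : Function.Periodic f (c * T)) (hT : 0 < T) :
    HasUniformDeriv (fun x => c * dilate c (deriv f) x)
      fun x => c * (c * dilate c (deriv (deriv f)) x) := by
  have hper' : Function.Periodic (deriv f) (c * T) := fun x => by
    rw [← deriv_comp_add_const, funext hper]
  have hf' : ContDiff ℝ 1 (deriv f) := hf.deriv' (n := 1)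
  exact (hasUniformDeriv_dilate hf' hper' hT).const_mul c

/-- The coefficients `2 / η` and `4 / η ^ 2` undo the chain rule factors `η / 2`, so that the
derivatives appear in the form produced by the dissipators. -/
theorem dilate_Tσ {η σ : ℝ} (hη : η ≠ 0) (f : ℝ → ℝ) :
    dilate (η / 2) (Tσ σ f) = fun x =>
      (2 / η : ℂ) * ((Real.sin (η * x) : ℂ) * ((η / 2 : ℝ) * dilate (η / 2) (deriv f) x)) +
      (-(4 * σ / η ^ 2) : ℂ) *
        ((η / 2 : ℝ) * ((η / 2 : ℝ) * dilate (η / 2) (deriv (deriv f)) x)) := by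
  have hη' : (η : ℂ) ≠ 0 := by exact_mod_cast hη
  funext x
  simp only [dilate, Tσ]
  rw [show 2 * (η / 2 * x) = η * x by ring]
  push_cast
  field_simp
  ring

theorem posFun_dilate_Tσ {η σ : ℝ} (hη : 0 < η) {f : ℝ → ℝ} (hf : ContDiff ℝ 2 f)
    (hper : Function.Periodic f (η / 2 * η)) :
    posFun (dilate (η / 2) (Tσ σ f)) =
      (2 / η : ℂ) • (posFun (fun x => (Real.sin (η * x) : ℂ)) *
        posFun fun x => (η / 2 : ℝ) * dilate (η / 2) (deriv f) x) +
      (-(4 * σ / η ^ 2) : ℂ) •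
        posFun fun x => (η / 2 : ℝ) * ((η / 2 : ℝ) * dilate (η / 2) (deriv (deriv f)) x) := by
  have h := hasUniformDeriv_dilate_deriv hf hper hη
  have hs := (isBoundedContinuous_sin η).mul h.left
  rw [dilate_Tσ hη.ne', posFun_add (hs.const_mul _) (h.right.const_mul _), posFun_const_mul _ hs,
    posFun_const_mul _ h.right, posFun_mul (isBoundedContinuous_sin η) h.left]

theorem momFun_dilate_Tσ {η σ : ℝ} (hη : 0 < η) {f : ℝ → ℝ} (hf : ContDiff ℝ 2 f)
    (hper : Function.Periodic f (η / 2 * η)) :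
    momFun (dilate (η / 2) (Tσ σ f)) =
      (2 / η : ℂ) • (momFun (fun x => (Real.sin (η * x) : ℂ)) *
        momFun fun x => (η / 2 : ℝ) * dilate (η / 2) (deriv f) x) +
      (-(4 * σ / η ^ 2) : ℂ) •
        momFun fun x => (η / 2 : ℝ) * ((η / 2 : ℝ) * dilate (η / 2) (deriv (deriv f)) x) := by
  have h := hasUniformDeriv_dilate_deriv hf hper hη
  have hs := (isBoundedContinuous_sin η).mul h.left
  rw [dilate_Tσ hη.ne', momFun_add (hs.const_mul _) (h.right.const_mul _), momFun_const_mul _ hs,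
    momFun_const_mul _ h.right, momFun_mul (isBoundedContinuous_sin η) h.left]

theorem observable_eq (η : ℝ) (u v : ℝ → ℝ) :
    observable η u v = posFun (dilate (η / 2) u) * momFun (dilate (η / 2) v) := rfl

theorem hasTrace_observable_comp {η ε κ : ℝ} (hη : 0 < η) (hε : 0 < ε) {f g : ℝ → ℝ}
    (hf : ContDiff ℝ 2 f) (hg : ContDiff ℝ 2 g)
    (hfper : Function.Periodic f (η / 2 * η)) (hgper : Function.Periodic g (η / 2 * η))
    {ρ Dq Dp : H →L[ℂ] H} {D : ℕ → H →L[ℂ] H} (hρ : ρ.IsPositive) (hρ' : IsTraceClass ρ)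
    (hD : ∀ k ∈ Finset.range (2 * 2), IsDissipator (lindbladOp 2 η ε k) ρ (D k))
    (hDq : IsDissipator q ρ Dq) (hDp : IsDissipator p ρ Dp) :
    HasTrace (observable η f g ∘L
        (∑ k ∈ Finset.range (2 * 2), D k + (κ : ℂ) • Dq + (κ : ℂ) • Dp))
      (-((ampl η ε * ε * η : ℝ) : ℂ) *
        trace (generatorObservable η (sigma η ε κ) f g ∘L ρ)) := by
  have hF := hasUniformDeriv_dilate (hf.of_le one_le_two) hfper hη
  have hF₁ := hasUniformDeriv_dilate_deriv hf hfper hη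
  have hG := hasUniformDeriv_dilate (hg.of_le one_le_two) hgper hη
  have hG₁ := hasUniformDeriv_dilate_deriv hg hgper hη
  have hFper : Function.Periodic (dilate (η / 2) f) η := periodic_dilate hfper
  have hGper : Function.Periodic (dilate (η / 2) g) η := periodic_dilate hgper
  have f0 := isPositionFrame_zero η
  have f1 := f0.rotate
  have f2 := f1.rotate
  have f3 := f2.rotate
  simp only [lindbladOp_two] at hD
  have h0 := hD 0 (by simp)
  have h1 := hD 1 (by simp)
  have h2 := hD 2 (by simp)
  have h3 := hD 3 (by simp)
  -- The angles are written as iterated quarter turns, in the shape given by `rotate`.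
  rw [show ((0 : ℕ) : ℝ) * (Real.pi / 2) = 0 by simp] at h0
  rw [show ((1 : ℕ) : ℝ) * (Real.pi / 2) = Real.pi / 2 + 0 by simp] at h1
  rw [show ((2 : ℕ) : ℝ) * (Real.pi / 2) = Real.pi / 2 + (Real.pi / 2 + 0) by push_cast; ring] at h2
  rw [show ((3 : ℕ) : ℝ) * (Real.pi / 2) = Real.pi / 2 + (Real.pi / 2 + (Real.pi / 2 + 0)) by
    push_cast; ring] at h3
  have t0 := trace_comp_dissipator_position f0 (Or.inl rfl) hρ hρ' h0 hF hF₁ hG.left hGper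
  have t1 := trace_comp_dissipator_momentum f1 (Or.inl rfl) hρ hρ' h1 hG hG₁ hF.left hFper
  have t2 := trace_comp_dissipator_position f2 (Or.inr rfl) hρ hρ' h2 hF hF₁ hG.left hGper
  have t3 := trace_comp_dissipator_momentum f3 (Or.inr rfl) hρ hρ' h3 hG hG₁ hF.left hFper
  -- The first derivative along `exp(isq)` carries a minus sign; rescaling the next one by `-1`
  -- makes the two signs cancel.
  have tq := trace_comp_dissipator_generator hρ hρ' isGenerator_q hDq (phase_comp hF.left hG)
    (by simpa only [smul_neg, neg_smul, one_smul, neg_neg] using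
      (phase_comp hF.left hG₁).smul (-1))
  have tp := trace_comp_dissipator_generator hρ hρ' isGenerator_p hDp (translation_comp hF hG.left)
    (translation_comp hF₁ hG.left)
  have total := ((((t0.add t1).add t2).add t3).add (tq.smul (κ : ℂ))).add (tp.smul (κ : ℂ))
  rw [generatorObservable, observable_eq, observable_eq, observable_eq,
    posFun_dilate_Tσ hη hf hfper, momFun_dilate_Tσ hη hg hgper]
  simp only [add_mul, mul_add, smul_mul_assoc, mul_smul_comm, trace_add_comp hρ',
    trace_smul_comp hρ'] at total ⊢
  convert! total using 1
  · rw [Finset.sum_range_succ, Finset.sum_range_succ, Finset.sum_range_succ, Finset.sum_range_one]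
    simp only [ContinuousLinearMap.comp_add, ContinuousLinearMap.comp_smul]
  -- The `2` counts the two rotations that act on the same variable.
  · have e1 : ((ampl η ε * ε * η : ℝ) : ℂ) * (2 / η) = 2 * (ampl η ε * ε : ℝ) := by
      have : (η : ℂ) ≠ 0 := by exact_mod_cast hη.ne'
      push_cast; field_simp
    -- This fixes `σ`: each of two rotations contributes `(aε)²/2`, and the dissipator of `p` (for
    -- `f`) or of `q` (for `g`) contributes `κ/2`.
    have e2 : ((ampl η ε * ε * η : ℝ) : ℂ) * (4 * sigma η ε κ / η ^ 2) =
        (ampl η ε * ε : ℝ) ^ 2 + κ / 2 := by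
      have ha : ampl η ε ≠ 0 := (Real.exp_pos _).ne'
      have : ampl η ε * ε * η * (4 * sigma η ε κ / η ^ 2) = (ampl η ε * ε) ^ 2 + κ / 2 := by
        rw [sigma]; field_simp; ring
      exact_mod_cast congrArg Complex.ofReal this
    generalize trace (E := H) _ = x1
    generalize trace (E := H) _ = x2
    generalize trace (E := H) _ = x3
    generalize trace (E := H) _ = x4
    linear_combination (-x1 - x3) * e1 + (x2 + x4) * e2

end Observables

end GKP

end

/-! ### The evolution equation -/

theorem theorem3 (η ε κ : ℝ) (hη : η = 2 * √Real.pi) (hε : 0 < ε)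
    (f g : ℝ → ℝ) (hf : ContDiff ℝ 2 f) (hg : ContDiff ℝ 2 g)
    (hfper : Function.Periodic f (2 * Real.pi)) (hgper : Function.Periodic g (2 * Real.pi))
    (I : Set ℝ) (ρ : ℝ → GKP.H →L[ℂ] GKP.H)
    (hρ : GKP.IsLindbladSolution 2 η ε κ I ρ) :
    ∀ t ∈ I, HasDerivWithinAt (fun s => GKP.trace (GKP.observable η f g ∘L ρ s))
      (-((GKP.ampl η ε * ε * η : ℝ) : ℂ) *
        GKP.trace (GKP.generatorObservable η (GKP.sigma η ε κ) f g ∘L ρ t)) I t := by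
  intro t ht
  have hη0 : 0 < η := by rw [hη]; positivity
  -- The value of `η` matters only here: a shift of `q` or `p` by `η` is one full period of the
  -- angle.
  have hper : η / 2 * η = 2 * Real.pi := by
    rw [hη]
    linear_combination 2 * Real.sq_sqrt Real.pi_pos.le
  obtain ⟨D, Dq, Dp, hD, hDq, hDp, hderiv⟩ := hρ.equation t ht
  exact GKP.hasDerivWithinAt_trace_comp (fun s hs => (hρ.isDensityOperator s hs).isTraceClass) ht
    hderiv (GKP.hasTrace_observable_comp hη0 hε hf hg (by rwa [hper]) (by rwa [hper])
      (hρ.isDensityOperator t ht).isPositive (hρ.isDensityOperator t ht).isTraceClass hD hDq hDp)
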